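/- **Theorem 1.** Let $W(\theta)=-\cos(\theta-\alpha)$ with $\alpha\in[0,\pi]$. Consider the traveling-wave McKean–Vlasov equation $$\rho'+(\mu\,W'\star\rho+k)\,\rho=c\tag{TW}$$ for a $2\pi$-periodic probability density $\rho$ (that is, $\rho\ge 0$ and $\int_{-\pi}^{\pi}\rho\,d\theta=1$) and real constants $k,c$, with parameter $\mu\in\mathbb R$, where $\star$ is convolution on the circle. For $k\neq0$ and $r\in\mathbb R$ let $\chi_{k,r}$ be the unique $2\pi$-periodic solution of $\chi'+(r\sin\phi+k)\chi=k$, and let $\chi_{0,r}(\phi)=\big(\tfrac1{2\pi}\int_{-\pi}^{\pi}e^{r\cos s}ds\big)e^{r\cos\phi}$. Put $$C_n=\tfrac1{2\pi}\int_{-\pi}^{\pi}\cos(n\phi)\chi_{k,r}\,d\phi,\quad S_n=\tfrac1{2\pi}\int_{-\pi}^{\pi}\sin(n\phi)\chi_{k,r}\,d\phi,\quad \rho_{k,r}=\frac{\chi_{k,r}}{2\pi C_0(k,r)}$$ ($\rho_{k,r}$ is the asymmetrically extended von Mises density), and, for $r\ne0$, $$\mathcal C_1=\frac{C_1}{rC_0},\quad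 \mathcal S_1=-\frac{S_1}{rC_0},\quad \mathcal T_1=\frac{\mathcal S_1}{\mathcal C_1},\quad \mathcal R_1=\operatorname{sign}(k)\sqrt{\mathcal C_1^2+\mathcal S_1^2},$$ where at $k=0$ the sign is read as $+1$ if $\alpha<\pi/2$ and as $-1$ if $\alpha>\pi/2$. The solutions $(k,r)$ of the reduced system are the trivial ones, $r=0$, and, for $\alpha\neq\pi/2$, the nontrivial ones, $r\neq0$ with $$\mathcal R_1(k,r)=\tfrac1\mu,\qquad \mathcal T_1(k,r)=\tan\alpha .\tag{1}$$ For $\alpha\ne\pi/2$ and $r\neq0$, (1) is equivalent to $$\mathcal C_1(k,r)=\tfrac{\cos\alpha}\mu,\qquad \mathcal S_1(k,r)=\tfrac{\sin\alpha}\mu,\tag{2}$$ which defines the nontrivial solutions for $\alpha=\pi/2$ ((1) and (2) have no solution for $\mu=0$). Let $\mu_\alpha=2\sec\alpha$. There are functions $k_\alpha(\mu)$, $r_\alpha(\mu)$ and $\mathcal K_\alpha(r)$ such that the following holds. 1. *(Reduced system.)* For $\alpha\in[0,\pi/2)$ (respectively $\alpha\in(\pi/2,\pi]$) the reduced system undergoes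 a supercritical (respectively subcritical) pitchfork bifurcation at $\mu=\mu_\alpha$: for $\mu\le\mu_\alpha$ (resp. $\mu\ge\mu_\alpha$) only the trivial solutions $r=0$ exist; for $\mu>\mu_\alpha$ (resp. $\mu<\mu_\alpha$) there is exactly one additional pair of solutions $(k_\alpha(\mu),\pm r_\alpha(\mu))$, $r_\alpha(\mu)>0$; $k_\alpha,r_\alpha$ are continuous up to $\mu_\alpha$, with $(k_\alpha,r_\alpha)(\mu_\alpha)=(\tan\alpha,0)$; and $(\mu-\mu_\alpha)/r_\alpha(\mu)^2$ has a finite positive (resp. negative) limit as $\mu\to\mu_\alpha$ along the branch. The branch is global: $$\{(k_\alpha(\mu),\pm r_\alpha(\mu)) : \mu\ge\mu_\alpha\ (\text{resp. }\mu\le\mu_\alpha)\}=\{(\mathcal K_\alpha(r),\pm r): r\ge0\},$$ and the points with $r>0$ on the right are exactly the nontrivial solutions $(k,r)$ of the reduced system, over all $\mu\in\mathbb R$. For $\alpha\in(0,\pi/2)$, $\mathcal K_\alpha:[0,\infty)\to[\tan\alpha,\infty)$ is an increasing bijection; for $\alpha\in(\pi/2,\pi)$, $\mathcal K_\alpha:[0,\infty)\to(-\infty,\tan\alpha]$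 is a decreasing bijection; for $\alpha\in\{0,\pi\}$, $\mathcal K_\alpha\equiv0$. For $\alpha=\pi/2$ there are only the trivial solutions, for every $\mu$. 2. *(Traveling waves.)* If $\alpha\in[0,\pi/2)$ and $\mu\le\mu_\alpha$, or $\alpha\in(\pi/2,\pi]$ and $\mu\ge\mu_\alpha$, or $\alpha=\pi/2$ and $\mu$ is arbitrary, then the incoherent state $\rho\equiv\frac1{2\pi}$ (with any $k$, and $c=\frac k{2\pi}$) is the only solution of (TW). If $\alpha\in[0,\pi/2)$ and $\mu>\mu_\alpha$, or $\alpha\in(\pi/2,\pi]$ and $\mu<\mu_\alpha$, then besides the incoherent state the solutions of (TW) are exactly $$\rho(\theta)=\rho_{k,r}(\theta-\theta_0-\alpha),\quad k=k_\alpha(\mu),\ r=r_\alpha(\mu),\ c=\frac{k}{2\pi C_0(k,r)},\quad\theta_0\in[0,2\pi).$$ Here $\rho_{k,r}\not\equiv\frac1{2\pi}$, and $\rho(t,\theta)=\rho_{k,r}(\theta-\theta_0-\alpha-kt)$ is a solution of $\partial_t\rho=\partial_\theta^2\rho+\mu\,\partial_\theta(\rho\,\partial_\theta(W\star\rho))$.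 3. *(Speed and limits.)* $k_\alpha(\mu)>\tan\alpha>0$ for $\alpha\in(0,\pi/2)$, $\mu>\mu_\alpha$; $k_\alpha(\mu)<\tan\alpha<0$ for $\alpha\in(\pi/2,\pi)$, $\mu<\mu_\alpha$; for $\alpha\in\{0,\pi\}$ one has $\mu_\alpha=\pm2$ and $k_\alpha(\mu)=0$ (a coherent steady state). For $\alpha\in(0,\pi/2)$: $k_\alpha(\mu)\to\tan\alpha$ as $\mu\to\mu_\alpha^+$, and $k_\alpha(\mu)\to\infty$ and $r_\alpha(\mu)\to\infty$ as $\mu\to\infty$. Finally, $k_\alpha(\mu)\to\infty$ as $\alpha\to(\pi/2)^-$, uniformly in $\mu>\mu_\alpha$. -/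

import Mathlib

open Real Set Filter Topology

noncomputable section

namespace SakaguchiKuramoto

/-! ### The interaction potential, the evolution equation and the traveling-wave equation -/

/-- The one-mode interaction potential with phase shift `α`. -/
def W (α θ : ℝ) : ℝ := -cos (θ - α)

/-- Convolution on the circle `ℝ / 2πℤ` (of functions on `ℝ` that are `2π`-periodic). -/
def circConv (f g : ℝ → ℝ) (θ : ℝ) : ℝ := ∫ η in (-π)..π, f (θ - η) * g η

/-- A probability density function on the circle, as a `2π`-periodic function on `ℝ`. -/
structure IsCircleDensity (ρ : ℝ → ℝ) : Prop where
  periodic : Function.Periodic ρ (2 * π)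
  nonneg : ∀ θ, 0 ≤ ρ θ
  integrable : IntervalIntegrable ρ MeasureTheory.volume (-π) π
  mass : ∫ θ in (-π)..π, ρ θ = 1

/-- `ρ` is a classical solution of the traveling-wave McKean–Vlasov equation
`ρ' + (μ W' ⋆ ρ + k) ρ = c` with speed `k` and constant of integration `c`. -/
structure IsTravelingWave (α μ k c : ℝ) (ρ : ℝ → ℝ) : Prop where
  density : IsCircleDensity ρ
  differentiable : Differentiable ℝ ρ
  equation : ∀ θ, deriv ρ θ + (μ * circConv (deriv (W α)) ρ θ + k) * ρ θ = c

/-- `u t θ` is a classical solution (for all times) of the McKean–Vlasov equation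
`∂ₜρ = ∂_θ² ρ + μ ∂_θ (ρ ∂_θ (W ⋆ ρ))` on the circle. -/
structure IsMcKeanVlasovSolution (α μ : ℝ) (u : ℝ → ℝ → ℝ) : Prop where
  density : ∀ t, IsCircleDensity (u t)
  smooth : ContDiff ℝ 2 (Function.uncurry u)
  equation : ∀ t θ, deriv (fun s => u s θ) t =
    deriv (deriv (u t)) θ + μ * deriv (fun η => u t η * deriv (circConv (W α) (u t)) η) θ

/-- The incoherent state. -/
def incoherent : ℝ → ℝ := fun _ => 1 / (2 * π)

/-! ### The asymmetrically extended von Mises density -/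

/-- Normalizing factor `k / (1 - exp (-2πk))`, with its limit `1 / (2π)` at `k = 0`. -/
def chiFactor (k : ℝ) : ℝ := if k = 0 then 1 / (2 * π) else k / (1 - exp (-(2 * π * k)))

/-- The function `χ_{k,r}`: for `k ≠ 0` the unique `2π`-periodic solution of
`χ' + (r sin φ + k) χ = k` (see `chi_periodic`, `chi_ode`, `chi_unique`), in closed form;
for `k = 0` it is `I₀(r) exp (r cos φ)` (see `chi_zero_left`), and `χ_{k,0} = 1`
(see `chi_zero_right`). -/
def chi (k r φ : ℝ) : ℝ :=
  chiFactor k * ∫ s in (0 : ℝ)..(2 * π), exp (-(k * s)) * exp (r * cos φ - r * cos (φ - s))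

theorem chi_periodic (k r : ℝ) : Function.Periodic (chi k r) (2 * π) := by
  intro φ
  have h : ∀ s, cos (φ + 2 * π - s) = cos (φ - s) := fun s => by
    rw [show φ + 2 * π - s = φ - s + 2 * π by ring, cos_add_two_pi]
  simp only [chi, h, cos_add_two_pi]

theorem chi_eq (k r φ : ℝ) : chi k r φ = chiFactor k * exp (r * cos φ - k * φ) *
    ∫ x in (φ - 2 * π)..φ, exp (k * x - r * cos x) := by
  have h := intervalIntegral.integral_comp_sub_left (a := 0) (b := 2 * π)
    (fun x => exp (k * x - r * cos x)) φ
  rw [sub_zero] at h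
  rw [← h, chi, mul_assoc,
    ← intervalIntegral.integral_const_mul (μ := MeasureTheory.volume) (exp (r * cos φ - k * φ))]
  congr 1
  refine intervalIntegral.integral_congr fun s _ => ?_
  simp only [← exp_add]
  congr 1
  ring

theorem chiFactor_mul (k : ℝ) : chiFactor k * (1 - exp (-(2 * π * k))) = k := by
  unfold chiFactor
  split_ifs with h
  · simp [h]
  · refine div_mul_cancel₀ _ fun h0 => h ?_
    have h1 : exp (-(2 * π * k)) = 1 := by linarith
    rw [exp_eq_one_iff] at h1
    have := pi_pos
    by_contra hk
    have h2 : 2 * π * k ≠ 0 := by positivity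
    exact h2 (by linarith)

theorem chi_ode (k r φ : ℝ) : HasDerivAt (chi k r) (k - (r * sin φ + k) * chi k r φ) φ := by
  have hc : Continuous fun x : ℝ => exp (k * x - r * cos x) := by fun_prop
  have hI : ∀ y, HasDerivAt (fun y => ∫ x in (0 : ℝ)..y, exp (k * x - r * cos x))
      (exp (k * y - r * cos y)) y := fun y => hc.integral_hasStrictDerivAt 0 y |>.hasDerivAt
  have h2 : HasDerivAt (fun y => ∫ x in (y - 2 * π)..y, exp (k * x - r * cos x))
      (exp (k * φ - r * cos φ) - exp (k * (φ - 2 * π) - r * cos (φ - 2 * π))) φ := by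
    have h := (hI φ).sub ((hI (φ - 2 * π)).comp_sub_const φ (2 * π))
    refine h.congr_of_eventuallyEq (Eventually.of_forall fun y => ?_)
    exact (intervalIntegral.integral_interval_sub_left (hc.intervalIntegrable _ _)
      (hc.intervalIntegrable _ _)).symm
  have h3 : HasDerivAt (fun y => chiFactor k * exp (r * cos y - k * y))
      (chiFactor k * (exp (r * cos φ - k * φ) * (r * -sin φ - k * 1))) φ :=
    ((((hasDerivAt_cos φ).const_mul r).sub ((hasDerivAt_id φ).const_mul k)).exp).const_mul _
  have h4 := h3.mul h2
  have hfun : chi k r = (fun y => chiFactor k * exp (r * cos y - k * y)) *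
      fun y => ∫ x in (y - 2 * π)..y, exp (k * x - r * cos x) := by
    funext y; exact chi_eq k r y
  rw [hfun]
  refine h4.congr_deriv ?_
  have e1 : exp (r * cos φ - k * φ) * exp (k * φ - r * cos φ) = 1 := by
    rw [← exp_add]; simp
  have e2 : exp (r * cos φ - k * φ) * exp (k * (φ - 2 * π) - r * cos (φ - 2 * π))
      = exp (-(2 * π * k)) := by
    rw [← exp_add, cos_sub_two_pi]; congr 1; ring
  have e3 := chiFactor_mul k
  simp only [Pi.mul_apply]
  linear_combination chiFactor k * e1 - chiFactor k * e2 + e3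

theorem chi_unique {k r : ℝ} (hk : k ≠ 0) {f : ℝ → ℝ} (hp : Function.Periodic f (2 * π))
    (hf : ∀ φ, HasDerivAt f (k - (r * sin φ + k) * f φ) φ) : f = chi k r := by
  set g : ℝ → ℝ := fun y => exp (k * y - r * cos y) * (f y - chi k r y) with hg
  have hd : ∀ y, HasDerivAt g 0 y := fun y => by
    have h1 : HasDerivAt (fun y => exp (k * y - r * cos y))
        (exp (k * y - r * cos y) * (k * 1 - r * -sin y)) y :=
      (((hasDerivAt_id y).const_mul k).sub ((hasDerivAt_cos y).const_mul r)).exp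
    refine (h1.mul ((hf y).sub (chi_ode k r y))).congr_deriv ?_
    simp only [Pi.sub_apply]
    ring
  have hconst : ∀ x y, g x = g y :=
    is_const_of_deriv_eq_zero (fun y => (hd y).differentiableAt) fun y => (hd y).deriv
  funext φ
  have h := hconst (φ + 2 * π) φ
  simp only [hg, hp φ, chi_periodic k r φ, cos_add_two_pi] at h
  by_contra hne
  have h1 := mul_right_cancel₀ (sub_ne_zero.2 hne) h
  have h2 := exp_injective h1
  have h3 : k * (2 * π) = 0 := by linarith
  have := pi_pos
  have h4 : k * (2 * π) ≠ 0 := by positivity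
  exact h4 h3

theorem chi_zero_left (r φ : ℝ) :
    chi 0 r φ = (1 / (2 * π) * ∫ s in (-π)..π, exp (r * cos s)) * exp (r * cos φ) := by
  rw [chi_eq]
  have hper : Function.Periodic (fun x => exp (-(r * cos x))) (2 * π) := fun x => by simp
  have h1 := hper.intervalIntegral_add_eq (φ - 2 * π) 0
  have hper2 : Function.Periodic (fun x => exp (r * cos x)) (2 * π) := fun x => by simp
  have h2 := hper2.intervalIntegral_add_eq (-π) π
  have h3 := intervalIntegral.integral_comp_sub_right (a := π) (b := π + 2 * π)
    (fun x => exp (-(r * cos x))) π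
  simp only [cos_sub_pi] at h3
  rw [show π - π = 0 by ring, show π + 2 * π - π = 0 + 2 * π by ring] at h3
  rw [show φ - 2 * π + 2 * π = φ by ring] at h1
  rw [show -π + 2 * π = π by ring] at h2
  simp only [mul_neg, neg_neg] at h3
  simp only [chiFactor, if_true, zero_mul, zero_sub, sub_zero]
  rw [h1, ← h3, h2]
  ring

theorem chi_zero_right (k φ : ℝ) : chi k 0 φ = 1 := by
  rcases eq_or_ne k 0 with rfl | hk
  · have := pi_pos
    rw [chi_zero_left]
    simp
    field_simp
    ring
  · have h := chi_unique (r := 0) hk (f := fun _ => (1 : ℝ)) (fun _ => rfl) fun x => by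
      simpa using hasDerivAt_const x (1 : ℝ)
    exact (congrFun h φ).symm

/-- Cosine moments of `χ_{k,r}`. -/
def Ccoef (n : ℤ) (k r : ℝ) : ℝ := 1 / (2 * π) * ∫ φ in (-π)..π, cos (n * φ) * chi k r φ

/-- Sine moments of `χ_{k,r}`. -/
def Scoef (n : ℤ) (k r : ℝ) : ℝ := 1 / (2 * π) * ∫ φ in (-π)..π, sin (n * φ) * chi k r φ

/-- The asymmetrically extended von Mises density `ρ_{k,r}`. -/
def avm (k r φ : ℝ) : ℝ := chi k r φ / (2 * π * Ccoef 0 k r)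

/-! ### The reduced system

The following functions are only used at `r ≠ 0`. -/

def calC (n : ℤ) (k r : ℝ) : ℝ := Ccoef n k r / (r * Ccoef 0 k r)

def calS (n : ℤ) (k r : ℝ) : ℝ := -Scoef n k r / (r * Ccoef 0 k r)

def calT (n : ℤ) (k r : ℝ) : ℝ := calS n k r / calC n k r

/-- The sign of `k`; at `k = 0` it is the limit of the sign that `k` has on the solution
branches: `1` for `α < π/2` and `-1` for `α > π/2`. -/
def sgn (α k : ℝ) : ℝ := if k = 0 then (if α < π / 2 then 1 else -1) else Real.sign k

def calR (α : ℝ) (n : ℤ) (k r : ℝ) : ℝ := sgn α k * √(calC n k r ^ 2 + calS n k r ^ 2)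

/-- The system `𝓡₁(k,r) = 1/μ`, `𝓣₁(k,r) = tan α`. -/
def PolarSystem (α μ k r : ℝ) : Prop := calR α 1 k r = 1 / μ ∧ calT 1 k r = tan α

/-- The system `𝓒₁(k,r) = cos α / μ`, `𝓢₁(k,r) = sin α / μ`. -/
def CartesianSystem (α μ k r : ℝ) : Prop := calC 1 k r = cos α / μ ∧ calS 1 k r = sin α / μ

/-- Solutions of the reduced system, the trivial ones `r = 0` included. -/
def ReducedSol (α μ k r : ℝ) : Prop := r = 0 ∨ PolarSystem α μ k r

/-- The bifurcation point `2 sec α`. -/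
def muCrit (α : ℝ) : ℝ := 2 / cos α

/-- A supercritical pitchfork bifurcation (in the parameter `μ`, at `μ₀`, with global branch)
from the trivial solutions `r = 0` of a system `Sol μ k r`: for `μ ≤ μ₀` there is only the
trivial solution, and for `μ > μ₀` exactly one additional pair `(kb μ, ± rb μ)`, which emanates
continuously from `(k₀, 0)` at `μ₀`, along a curve that in the `(r, μ)`-plane has a nondegenerate
quadratic tangency with the line `μ = μ₀`, opening to the right. -/
structure SupercriticalPitchfork (Sol : ℝ → ℝ → ℝ → Prop) (μ₀ k₀ : ℝ) (kb rb : ℝ → ℝ) :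
    Prop where
  k_start : kb μ₀ = k₀
  r_start : rb μ₀ = 0
  k_cont : ContinuousOn kb (Ici μ₀)
  r_cont : ContinuousOn rb (Ici μ₀)
  r_pos : ∀ μ, μ₀ < μ → 0 < rb μ
  trivial_only : ∀ μ ≤ μ₀, ∀ k r, Sol μ k r ↔ r = 0
  pair : ∀ μ, μ₀ < μ → ∀ k r, Sol μ k r ↔ r = 0 ∨ (k = kb μ ∧ (r = rb μ ∨ r = -rb μ))
  tangency : ∃ q > 0, Tendsto (fun μ => (μ - μ₀) / rb μ ^ 2) (𝓝[>] μ₀) (𝓝 q)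

/-- A subcritical pitchfork bifurcation: the mirror image under `μ ↦ -μ`. -/
def SubcriticalPitchfork (Sol : ℝ → ℝ → ℝ → Prop) (μ₀ k₀ : ℝ) (kb rb : ℝ → ℝ) : Prop :=
  SupercriticalPitchfork (fun μ => Sol (-μ)) (-μ₀) k₀ (fun μ => kb (-μ)) (fun μ => rb (-μ))

/-- The curve `{(kb μ, ± rb μ) | μ ∈ M}`. -/
def branchCurve (kb rb : ℝ → ℝ) (M : Set ℝ) : Set (ℝ × ℝ) :=
  {p | ∃ μ ∈ M, p = (kb μ, rb μ) ∨ p = (kb μ, -rb μ)}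

/-- The points `(k, r)` of all nontrivial solutions, over all real `μ`. -/
def nontrivialSols (α : ℝ) : Set (ℝ × ℝ) := {p | p.2 ≠ 0 ∧ ∃ μ, PolarSystem α μ p.1 p.2}

/-- The incoherent state is the only solution of the traveling-wave equation (it is a solution
for each `k`, with `c = k / (2π)`). -/
def OnlyIncoherent (α μ : ℝ) : Prop :=
  ∀ k c ρ, IsTravelingWave α μ k c ρ ↔ ρ = incoherent ∧ c = k / (2 * π)

/-- Besides the incoherent state, the traveling-wave equation has, up to rotation, exactly one
solution: the density `ρ_{k₁,r₁}`, which is not the incoherent one, traveling at speed `k₁`, with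
the constant `c = k₁ / (2π C₀(k₁, r₁))`; it gives a solution of the evolution equation. -/
structure UniqueCoherentWave (α μ k₁ r₁ : ℝ) : Prop where
  classification : ∀ k c ρ, IsTravelingWave α μ k c ρ ↔
    (ρ = incoherent ∧ c = k / (2 * π)) ∨
    (k = k₁ ∧ c = k₁ / (2 * π * Ccoef 0 k₁ r₁) ∧
      ∃ θ₀ ∈ Ico 0 (2 * π), ρ = fun θ => avm k₁ r₁ (θ - θ₀ - α))
  coherent : avm k₁ r₁ ≠ incoherent
  evolution : ∀ θ₀ : ℝ, IsMcKeanVlasovSolution α μ fun t θ => avm k₁ r₁ (θ - θ₀ - α - k₁ * t)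

end SakaguchiKuramoto

end

open SakaguchiKuramoto

namespace SakaguchiKuramoto

/-! The convolution of `W'` with any density is a pure first harmonic, so after a rotation the
traveling-wave equation becomes the linear equation `χ' + (r sin φ + k) χ = const`. Its periodic
solutions are the multiples of `chi` (`exists_eq_smul_chi`), and self-consistency of the first
harmonic is `CartesianSystem` (`IsTravelingWave.classify`, `circConv_deriv_W_avm`). It remains to
solve a system of two equations in `(k, r)`.

Put `x = r² / 4`. The moments `C₀`, `C₁`, `S₁` have explicit power series in `x`, up to a factor
`r`, with positive coefficients `momentCoeff` (and a factor `-k` for `S₁`). Up to factors, `C₀` is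
`|I_{ik}(r)|²`, and `waveMass` is `|I_{1+ik}(r)|² / r²`. With the coefficients `waveWeight` of the
latter as weights, let `A = waveMean` be the mean of `m` and `B = waveInvMean` the mean of `1 / (m +
1)`. A quadratic identity between the series (`modulus_identity_powerSeries`) gives `𝓒₁ + i 𝓢₁ = 1 /
((2 + A) - i k (1 + B))`. For `α < π/2` the system therefore reads `k (1 + B) / (2 + A) = tan α` and
`μ = (2 + A) / cos α`.

The ratio of consecutive weights is a factor free of `k`, times `x / ((m + 2)² + k²)`. By likelihood
ratio comparison, `A` increases in `x` and decreases in `|k|`, while `B` does the opposite. Hence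
the phase equation determines `k = waveSpeed (tan α) x`, which increases with `x` when `tan α > 0`.

The crux is that `μ` increases along this curve, where `x` and `k` grow together and their effects
on `A` compete (`waveMean_lt_of_waveTan_eq`). If `A` failed to increase, a comparison of the convex
decreasing function `1 / (m + 1)` (`tsum_inv_mul_le_of_ratio_convex`) would show that `B` does not
decrease. As `k` grows strictly, the phase would then grow strictly, a contradiction. So `r ↦ μ` is
an increasing bijection from `[0, ∞)` to `[μ_α, ∞)`, whose inverse gives the branch. Since `A =
O(x)`, the tangency is quadratic. The case `α > π/2` follows from the reflection `(α, μ, k) ↦ (π -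
α, -μ, -k)`, and at `α = π/2` the positivity of `𝓒₁` excludes nontrivial solutions. -/

/-! ### Interchange of sums and integrals. -/

theorem hasSum_of_eq {f g : ℕ → ℝ} {a b : ℝ} (h : HasSum f a) (hfg : ∀ n, f n = g n)
    (hab : a = b) : HasSum g b := by
  obtain rfl : f = g := funext hfg
  rwa [← hab]

theorem integral_integral_swap_of_continuous {f : ℝ → ℝ → ℝ}
    (hf : Continuous (Function.uncurry f)) (a b c d : ℝ) :
    ∫ x in a..b, ∫ y in c..d, f x y = ∫ y in c..d, ∫ x in a..b, f x y := by
  refine MeasureTheory.intervalIntegral_intervalIntegral_swap ?_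
  exact (hf.continuousOn.integrableOn_compact (isCompact_uIcc.prod isCompact_uIcc)).mono_set
    (Set.prod_mono uIoc_subset_uIcc uIoc_subset_uIcc)

open MeasureTheory in
theorem hasSum_intervalIntegral_of_bounded {a b : ℝ} {F : ℕ → ℝ → ℝ} {G : ℝ → ℝ} {u : ℕ → ℝ}
    (hF : ∀ n, Continuous (F n)) (hu : Summable u) (hb : ∀ n, ∀ t ∈ uIoc a b, |F n t| ≤ u n)
    (hG : ∀ t, HasSum (fun n => F n t) (G t)) :
    HasSum (fun n => ∫ t in a..b, F n t) (∫ t in a..b, G t) :=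
  intervalIntegral.hasSum_integral_of_dominated_convergence (fun n _ => u n)
    (fun n => (hF n).aestronglyMeasurable)
    (fun n => Eventually.of_forall fun t ht => hb n t ht)
    (Eventually.of_forall fun _ _ => hu) intervalIntegrable_const
    (Eventually.of_forall fun t _ => hG t)

/-- Termwise integration of `g * exp (c * y)` over a rectangle. -/
theorem hasSum_integral_mul_exp {a b a' b' c C : ℝ} {g y : ℝ → ℝ → ℝ}
    (hg : Continuous (Function.uncurry g)) (hy : Continuous (Function.uncurry y))
    (hgC : ∀ φ, ∀ s ∈ uIoc a' b', |g φ s| ≤ C) (hy1 : ∀ φ s, |y φ s| ≤ 1) :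
    HasSum (fun n : ℕ => c ^ n / n.factorial * ∫ φ in a..b, ∫ s in a'..b', g φ s * y φ s ^ n)
      (∫ φ in a..b, ∫ s in a'..b', g φ s * exp (c * y φ s)) := by
  have hsum : Summable fun n : ℕ => C * (|c| ^ n / n.factorial) :=
    (Real.summable_pow_div_factorial |c|).mul_left C
  have hbd : ∀ (n : ℕ) φ, ∀ s ∈ uIoc a' b',
      |g φ s * ((c * y φ s) ^ n / n.factorial)| ≤ C * (|c| ^ n / n.factorial) := by
    intro n φ s hs
    rw [abs_mul, abs_div, abs_pow, abs_mul, Nat.abs_cast]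
    have h1 : |c| * |y φ s| ≤ |c| := mul_le_of_le_one_right (abs_nonneg _) (hy1 φ s)
    have h0 := (abs_nonneg _).trans (hgC φ s hs)
    gcongr
    exact hgC φ s hs
  have hcont : ∀ n : ℕ, Continuous
      (Function.uncurry fun φ s => g φ s * ((c * y φ s) ^ n / n.factorial)) := by
    intro n
    exact hg.mul (((continuous_const.mul hy).pow n).div_const _)
  have hexp : ∀ φ s, HasSum (fun n : ℕ => g φ s * ((c * y φ s) ^ n / n.factorial))
      (g φ s * exp (c * y φ s)) := by
    intro φ s
    have h := NormedSpace.expSeries_div_hasSum_exp (c * y φ s)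
    rw [← Real.exp_eq_exp_ℝ] at h
    exact h.mul_left _
  have hin : ∀ φ, HasSum (fun n : ℕ => ∫ s in a'..b', g φ s * ((c * y φ s) ^ n / n.factorial))
      (∫ s in a'..b', g φ s * exp (c * y φ s)) := fun φ =>
    hasSum_intervalIntegral_of_bounded
      (fun n => (hcont n).comp (Continuous.prodMk_right φ)) hsum (fun n => hbd n φ)
      (hexp φ)
  have hout := hasSum_intervalIntegral_of_bounded (a := a) (b := b)
    (F := fun n φ => ∫ s in a'..b', g φ s * ((c * y φ s) ^ n / n.factorial))
    (u := fun n : ℕ => C * (|c| ^ n / n.factorial) * |b' - a'|)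
    (fun n => intervalIntegral.continuous_parametric_intervalIntegral_of_continuous'
      (hcont n) a' b') (hsum.mul_right _)
    (fun n φ _ => by
      have h := intervalIntegral.norm_integral_le_of_norm_le_const
        (f := fun s => g φ s * ((c * y φ s) ^ n / n.factorial)) (hbd n φ)
      rwa [Real.norm_eq_abs] at h) hin
  refine hasSum_of_eq hout (fun n => ?_) rfl
  rw [← intervalIntegral.integral_const_mul]
  congr 1
  funext φ
  rw [← intervalIntegral.integral_const_mul]
  congr 1
  funext s
  rw [mul_pow]
  ring

/-! ### Kernel moments and the power series of `C₀`, `C₁`, `S₁`. -/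

/-- Half of the difference of the cosines in the kernel of `chi`. -/
noncomputable def halfDiff (φ s : ℝ) : ℝ := (cos φ - cos (φ - s)) / 2

theorem halfDiff_eq (φ s : ℝ) : halfDiff φ s = -sin (s / 2) * sin (φ - s / 2) := by
  have h1 : φ = (φ - s / 2) + s / 2 := by ring
  have h2 : φ - s = (φ - s / 2) - s / 2 := by ring
  rw [halfDiff, h2, cos_sub (φ - s / 2)]
  nth_rw 1 [h1]
  rw [cos_add]
  ring

theorem abs_halfDiff_le (φ s : ℝ) : |halfDiff φ s| ≤ 1 := by
  rw [halfDiff, abs_le]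
  constructor <;> linarith [neg_one_le_cos φ, cos_le_one φ, neg_one_le_cos (φ - s),
    cos_le_one (φ - s)]

theorem continuous_halfDiff : Continuous (Function.uncurry halfDiff) := by
  unfold halfDiff Function.uncurry
  fun_prop

/-- Moments of `halfDiff` with respect to the (normalized) exponential kernel. -/
noncomputable def kernelMoment (k : ℝ) (n : ℕ) : ℝ :=
  chiFactor k / (2 * π) *
    ∫ φ in (-π)..π, ∫ s in (0 : ℝ)..(2 * π), exp (-(k * s)) * halfDiff φ s ^ n

theorem chi_eq_halfDiff (k r φ : ℝ) : chi k r φ =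
    chiFactor k * ∫ s in (0 : ℝ)..(2 * π), exp (-(k * s)) * exp (2 * r * halfDiff φ s) := by
  rw [chi]
  congr 2
  funext s
  rw [halfDiff]
  ring_nf

theorem exp_neg_mul_le (k : ℝ) {s : ℝ} (hs : s ∈ uIoc 0 (2 * π)) :
    exp (-(k * s)) ≤ exp (|k| * (2 * π)) := by
  have hπ := pi_pos
  rw [uIoc_of_le (by positivity)] at hs
  refine exp_le_exp.2 ?_
  calc -(k * s) ≤ |k * s| := neg_le_abs _
    _ = |k| * s := by rw [abs_mul, abs_of_pos hs.1]
    _ ≤ _ := by gcongr; exact hs.2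

theorem hasSum_Ccoef_zero_kernelMoment (k r : ℝ) :
    HasSum (fun n : ℕ => (2 * r) ^ n / n.factorial * kernelMoment k n) (Ccoef 0 k r) := by
  have h := hasSum_integral_mul_exp (a := -π) (b := π) (a' := 0) (b' := 2 * π) (c := 2 * r)
    (g := fun _ s => exp (-(k * s))) (y := halfDiff) (C := exp (|k| * (2 * π)))
    (by unfold Function.uncurry; fun_prop) continuous_halfDiff
    (fun φ s hs => by rw [abs_of_pos (exp_pos _)]; exact exp_neg_mul_le k hs) abs_halfDiff_le
  refine hasSum_of_eq (h.mul_left (chiFactor k / (2 * π))) (fun n => ?_) ?_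
  · rw [kernelMoment]
    ring
  · simp only [Ccoef, Int.cast_zero, zero_mul, cos_zero, one_mul, chi_eq_halfDiff]
    rw [intervalIntegral.integral_const_mul]
    ring

/-- The reflection `φ ↦ π + s - φ` preserves `cos φ - cos (φ - s)` and changes the sign of `cos φ +
cos (φ - s)`. Only the antisymmetric half of `cos φ = (sum + difference) / 2` therefore survives
integration over `φ`. -/
theorem integral_cos_mul_eq_integral_halfDiff_mul (k r : ℝ) :
    ∫ φ in (-π)..π, ∫ s in (0 : ℝ)..(2 * π),
        (exp (-(k * s)) * cos φ) * exp (2 * r * halfDiff φ s) =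
      ∫ φ in (-π)..π, ∫ s in (0 : ℝ)..(2 * π),
        (exp (-(k * s)) * halfDiff φ s) * exp (2 * r * halfDiff φ s) := by
  have hy := continuous_halfDiff
  rw [← sub_eq_zero, ← intervalIntegral.integral_sub]
  rotate_left
  · refine Continuous.intervalIntegrable ?_ _ _
    refine intervalIntegral.continuous_parametric_intervalIntegral_of_continuous' ?_ _ _
    unfold halfDiff Function.uncurry
    fun_prop
  · refine Continuous.intervalIntegrable ?_ _ _
    refine intervalIntegral.continuous_parametric_intervalIntegral_of_continuous' ?_ _ _
    unfold halfDiff Function.uncurry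
    fun_prop
  have hin : ∀ φ, (∫ s in (0 : ℝ)..(2 * π),
        (exp (-(k * s)) * cos φ) * exp (2 * r * halfDiff φ s)) - (∫ s in (0 : ℝ)..(2 * π),
        (exp (-(k * s)) * halfDiff φ s) * exp (2 * r * halfDiff φ s)) =
      ∫ s in (0 : ℝ)..(2 * π), exp (-(k * s)) / 2 * ((cos φ + cos (φ - s)) *
        exp (r * (cos φ - cos (φ - s)))) := by
    intro φ
    rw [← intervalIntegral.integral_sub]
    · refine intervalIntegral.integral_congr fun s _ => ?_
      simp only [halfDiff]
      ring_nf
    · refine Continuous.intervalIntegrable ?_ _ _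
      unfold halfDiff
      fun_prop
    · refine Continuous.intervalIntegrable ?_ _ _
      unfold halfDiff
      fun_prop
  simp only [hin]
  rw [integral_integral_swap_of_continuous]
  · have hz : ∀ s, ∫ φ in (-π)..π, exp (-(k * s)) / 2 * ((cos φ + cos (φ - s)) *
        exp (r * (cos φ - cos (φ - s)))) = 0 := by
      intro s
      rw [intervalIntegral.integral_const_mul]
      have hp : Function.Periodic (fun φ => (cos φ + cos (φ - s)) *
          exp (r * (cos φ - cos (φ - s)))) (2 * π) := by
        intro φ
        have : cos (φ + 2 * π - s) = cos (φ - s) := by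
          rw [show φ + 2 * π - s = φ - s + 2 * π by ring, cos_add_two_pi]
        simp only [this, cos_add_two_pi]
      have h1 := intervalIntegral.integral_comp_sub_left (a := -π) (b := π)
        (fun φ => (cos φ + cos (φ - s)) * exp (r * (cos φ - cos (φ - s)))) (π + s)
      have h2 := hp.intervalIntegral_add_eq (π + s - π) (-π)
      rw [show π + s - π + 2 * π = π + s - -π by ring, show -π + 2 * π = π by ring, ← h1] at h2
      have h3 : ∀ x, (cos (π + s - x) + cos (π + s - x - s)) *
          exp (r * (cos (π + s - x) - cos (π + s - x - s))) =
          -((cos x + cos (x - s)) * exp (r * (cos x - cos (x - s)))) := by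
        intro x
        rw [show π + s - x = π - (x - s) by ring, show π - (x - s) - s = π - x by ring,
          cos_pi_sub, cos_pi_sub]
        ring_nf
      simp only [h3] at h2
      rw [intervalIntegral.integral_neg] at h2
      have h4 : ∫ φ in (-π)..π, (cos φ + cos (φ - s)) * exp (r * (cos φ - cos (φ - s))) = 0 := by
        linarith
      rw [h4, mul_zero]
    simp only [hz, intervalIntegral.integral_zero]
  · unfold Function.uncurry
    fun_prop

/-- After `cos φ` is traded for `halfDiff`, the extra factor shifts the moment index by one: `C₁` is
half the `r`-derivative of `C₀`. -/
theorem hasSum_Ccoef_one_kernelMoment (k r : ℝ) :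
    HasSum (fun n : ℕ => (2 * r) ^ n / n.factorial * kernelMoment k (n + 1)) (Ccoef 1 k r) := by
  have h := hasSum_integral_mul_exp (a := -π) (b := π) (a' := 0) (b' := 2 * π) (c := 2 * r)
    (g := fun φ s => exp (-(k * s)) * halfDiff φ s) (y := halfDiff) (C := exp (|k| * (2 * π)))
    (by unfold Function.uncurry halfDiff; fun_prop) continuous_halfDiff
    (fun φ s hs => by
      rw [abs_mul, abs_of_pos (exp_pos _)]
      exact (mul_le_of_le_one_right (exp_pos _).le (abs_halfDiff_le _ _)).trans
        (exp_neg_mul_le k hs)) abs_halfDiff_le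
  refine hasSum_of_eq (h.mul_left (chiFactor k / (2 * π))) (fun n => ?_) ?_
  · rw [kernelMoment]
    simp only [pow_succ', mul_assoc]
    ring
  · rw [← integral_cos_mul_eq_integral_halfDiff_mul, Ccoef]
    simp only [Int.cast_one, one_mul, chi_eq_halfDiff]
    rw [div_mul_eq_mul_div, div_mul_eq_mul_div, one_mul,
      ← intervalIntegral.integral_const_mul]
    congr 2
    funext φ
    rw [← intervalIntegral.integral_const_mul, ← intervalIntegral.integral_const_mul,
      ← intervalIntegral.integral_const_mul]
    congr 1
    funext s
    ring

/-- By `halfDiff_eq`, translating `φ` by `s / 2` over a full period separates the variables. -/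
theorem kernelMoment_eq (k : ℝ) (n : ℕ) : kernelMoment k n =
    chiFactor k / (2 * π) * ((∫ s in (0 : ℝ)..(2 * π), exp (-(k * s)) * sin (s / 2) ^ n) *
      ((-1) ^ n * ∫ φ in (-π)..π, sin φ ^ n)) := by
  rw [kernelMoment, integral_integral_swap_of_continuous]
  · congr 1
    rw [← intervalIntegral.integral_mul_const]
    refine intervalIntegral.integral_congr fun s _ => ?_
    have hp : Function.Periodic (fun φ => sin φ ^ n) (2 * π) := fun φ => by simp
    have h1 := intervalIntegral.integral_comp_sub_right (a := -π) (b := π)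
      (fun φ => sin φ ^ n) (s / 2)
    have h2 := hp.intervalIntegral_add_eq (-π - s / 2) (-π)
    rw [show -π - s / 2 + 2 * π = π - s / 2 by ring, show -π + 2 * π = π by ring, ← h1] at h2
    simp only [halfDiff_eq, mul_pow]
    rw [← h2, ← intervalIntegral.integral_const_mul, ← intervalIntegral.integral_const_mul]
    refine intervalIntegral.integral_congr fun φ _ => ?_
    simp only [neg_pow (sin (s / 2))]
    ring
  · unfold Function.uncurry halfDiff
    fun_prop

theorem kernelMoment_zero (k : ℝ) : kernelMoment k 0 = 1 := by
  have hπ := pi_pos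
  have h : chiFactor k * ∫ s in (0 : ℝ)..(2 * π), exp (-(k * s)) = 1 := by
    rcases eq_or_ne k 0 with rfl | hk
    · simp [chiFactor]
      field_simp
    · have h1 : ∀ s, HasDerivAt (fun s => -exp (-(k * s)) / k) (exp (-(k * s))) s := by
        intro s
        have := ((((hasDerivAt_id s).const_mul k).neg).exp).neg.div_const k
        refine this.congr_deriv ?_
        simp
        field_simp
      rw [intervalIntegral.integral_eq_sub_of_hasDerivAt (fun s _ => h1 s)
        (Continuous.intervalIntegrable (by fun_prop) _ _)]
      have := chiFactor_mul k
      simp only [mul_zero, neg_zero, exp_zero]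
      rw [show k * (2 * π) = 2 * π * k by ring]
      field_simp
      linarith
  rw [kernelMoment_eq]
  simp only [pow_zero, mul_one, intervalIntegral.integral_const, smul_eq_mul, one_mul]
  rw [div_mul_eq_mul_div, ← mul_assoc, h]
  field_simp
  ring

theorem kernelMoment_one (k : ℝ) : kernelMoment k 1 = 0 := by
  simp [kernelMoment_eq]

theorem integral_exp_mul_sin_pow (k : ℝ) (n : ℕ) :
    (∫ s in (0 : ℝ)..(2 * π), exp (-(k * s)) * sin (s / 2) ^ (n + 2)) *
        (k ^ 2 + (n + 2) ^ 2 / 4) =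
      (n + 1) * (n + 2) / 4 * ∫ s in (0 : ℝ)..(2 * π), exp (-(k * s)) * sin (s / 2) ^ n := by
  -- This primitive condenses two integrations by parts. Its power `n + 1` of `sin (s / 2)` is at
  -- least one, so the boundary terms at `0` and `2π` vanish.
  have hd : ∀ s, HasDerivAt (fun s => exp (-(k * s)) * (sin (s / 2) ^ (n + 1) *
      (k * sin (s / 2) + (n + 2) / 2 * cos (s / 2))))
      ((n + 1) * (n + 2) / 4 * (exp (-(k * s)) * sin (s / 2) ^ n) -
        exp (-(k * s)) * sin (s / 2) ^ (n + 2) * (k ^ 2 + (n + 2) ^ 2 / 4)) s := by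
    intro s
    have h0 : HasDerivAt (fun s : ℝ => s / 2) (1 / 2) s := (hasDerivAt_id s).div_const 2
    have hs := h0.sin
    have hc := h0.cos
    have he : HasDerivAt (fun s => exp (-(k * s))) (exp (-(k * s)) * -(k * 1)) s :=
      (((hasDerivAt_id s).const_mul k).neg).exp
    have := he.mul ((hs.pow (n + 1)).mul ((hs.const_mul k).add (hc.const_mul (((n : ℝ) + 2) / 2))))
    refine this.congr_deriv ?_
    simp only [Pi.add_apply, Pi.mul_apply, Pi.pow_apply, Nat.add_sub_cancel]
    push_cast
    have h3 : cos (s / 2) ^ 2 = 1 - sin (s / 2) ^ 2 := by rw [cos_sq']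
    linear_combination exp (-(k * s)) * sin (s / 2) ^ n * ((n + 1) * (n + 2) / 4) * h3
  have h := intervalIntegral.integral_eq_sub_of_hasDerivAt (a := 0) (b := 2 * π)
    (fun s _ => hd s) (Continuous.intervalIntegrable (by fun_prop) _ _)
  rw [intervalIntegral.integral_sub (Continuous.intervalIntegrable (by fun_prop) _ _)
    (Continuous.intervalIntegrable (by fun_prop) _ _), intervalIntegral.integral_const_mul,
    intervalIntegral.integral_mul_const] at h
  simp at h
  linarith

/-- The recursion of the `s`-integral is multiplied by the Wallis factor `(n + 1) / (n + 2)` of the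
`φ`-integral. -/
theorem kernelMoment_add_two (k : ℝ) (n : ℕ) :
    kernelMoment k (n + 2) * (4 * k ^ 2 + (n + 2) ^ 2) = kernelMoment k n * (n + 1) ^ 2 := by
  have h1 := integral_exp_mul_sin_pow k n
  have h2 := integral_sin_pow (a := -π) (b := π) n
  simp only [sin_neg, sin_pi, neg_zero, ne_eq, Nat.add_eq_zero_iff, one_ne_zero, and_false,
    not_false_eq_true, zero_pow, zero_mul, sub_self, zero_div, zero_add] at h2
  rw [kernelMoment_eq, kernelMoment_eq, h2, pow_add]
  have h3 : ((n : ℝ) + 2) ≠ 0 := by positivity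
  rw [show ((-1 : ℝ)) ^ 2 = 1 by norm_num, mul_one]
  have h4 : (∫ s in (0 : ℝ)..(2 * π), exp (-(k * s)) * sin (s / 2) ^ (n + 2)) *
      (4 * k ^ 2 + (n + 2) ^ 2) = (n + 1) * (n + 2) *
        ∫ s in (0 : ℝ)..(2 * π), exp (-(k * s)) * sin (s / 2) ^ n := by
    linarith
  calc _ = chiFactor k / (2 * π) * ((∫ s in (0 : ℝ)..(2 * π),
        exp (-(k * s)) * sin (s / 2) ^ (n + 2)) * (4 * k ^ 2 + (n + 2) ^ 2)) *
        ((-1) ^ n * ((n + 1) / (n + 2) * ∫ φ in (-π)..π, sin φ ^ n)) := by ring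
    _ = _ := by
      rw [h4]
      field_simp

theorem kernelMoment_odd (k : ℝ) (m : ℕ) : kernelMoment k (2 * m + 1) = 0 := by
  induction m with
  | zero => exact kernelMoment_one k
  | succ m ih =>
    have h := kernelMoment_add_two k (2 * m + 1)
    rw [ih, zero_mul] at h
    have h2 : (4 * k ^ 2 + ((2 * m + 1 : ℕ) + 2 : ℝ) ^ 2) ≠ 0 := by positivity
    exact (mul_eq_zero.1 h).resolve_right h2

/-- Taylor coefficients, in the variable `r ^ 2 / 4`, of the moment `C₀(k, r)`. -/
noncomputable def momentCoeff (k : ℝ) (m : ℕ) : ℝ :=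
  ∏ j ∈ Finset.range m, (2 * (2 * j + 1) / ((j + 1) * ((j + 1) ^ 2 + k ^ 2)) : ℝ)

@[simp] theorem momentCoeff_zero (k : ℝ) : momentCoeff k 0 = 1 := by simp [momentCoeff]

theorem momentCoeff_succ (k : ℝ) (m : ℕ) : momentCoeff k (m + 1) =
    momentCoeff k m * (2 * (2 * m + 1) / ((m + 1) * ((m + 1) ^ 2 + k ^ 2))) := by
  rw [momentCoeff, Finset.prod_range_succ, ← momentCoeff]

theorem momentCoeff_pos (k : ℝ) (m : ℕ) : 0 < momentCoeff k m := by
  unfold momentCoeff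
  exact Finset.prod_pos fun j _ => by positivity

theorem kernelMoment_even (k r : ℝ) (m : ℕ) :
    (2 * r) ^ (2 * m) / (2 * m).factorial * kernelMoment k (2 * m) =
      momentCoeff k m * (r ^ 2 / 4) ^ m := by
  induction m with
  | zero => simp [kernelMoment_zero]
  | succ m ih =>
    have h := kernelMoment_add_two k (2 * m)
    have h2 : (4 * k ^ 2 + ((2 * m : ℕ) + 2 : ℝ) ^ 2) ≠ 0 := by positivity
    have h3 : kernelMoment k (2 * m + 2) = kernelMoment k (2 * m) * ((2 * m : ℕ) + 1) ^ 2 /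
      (4 * k ^ 2 + ((2 * m : ℕ) + 2) ^ 2) := by rw [eq_div_iff h2, h]
    rw [show 2 * (m + 1) = 2 * m + 2 by ring, h3, momentCoeff_succ, pow_succ (r ^ 2 / 4),
      pow_add, Nat.factorial_succ, Nat.factorial_succ]
    calc _ = (2 * r) ^ (2 * m) / (2 * m).factorial * kernelMoment k (2 * m) *
          ((2 * r) ^ 2 / (((2 * m : ℕ) + 1) * ((2 * m : ℕ) + 2)) * ((2 * m : ℕ) + 1) ^ 2 /
            (4 * k ^ 2 + ((2 * m : ℕ) + 2) ^ 2)) := by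
          push_cast
          field_simp
          ring
      _ = _ := by
          rw [ih]
          push_cast
          have : (4 * k ^ 2 + (2 * m + 2 : ℝ) ^ 2) = 4 * ((m + 1) ^ 2 + k ^ 2) := by ring
          rw [this]
          field_simp

theorem hasSum_Ccoef_zero (k r : ℝ) :
    HasSum (fun m : ℕ => momentCoeff k m * (r ^ 2 / 4) ^ m) (Ccoef 0 k r) := by
  have h := hasSum_Ccoef_zero_kernelMoment k r
  have h0 : ∀ n ∉ Set.range (fun m : ℕ => 2 * m),
      (2 * r) ^ n / n.factorial * kernelMoment k n = 0 := by
    intro n hn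
    obtain ⟨m, rfl⟩ : Odd n := by
      rw [← Nat.not_even_iff_odd, even_iff_exists_two_mul]
      exact fun ⟨m, hm⟩ => hn ⟨m, hm.symm⟩
    rw [kernelMoment_odd, mul_zero]
  have hi : Function.Injective (fun m : ℕ => 2 * m) := fun a b h => by simpa using h
  exact hasSum_of_eq ((hi.hasSum_iff h0).2 h) (fun m => kernelMoment_even k r m) rfl

theorem hasSum_Ccoef_one (k r : ℝ) :
    HasSum (fun m : ℕ => r / 4 * ((m + 1) * momentCoeff k (m + 1) * (r ^ 2 / 4) ^ m))
      (Ccoef 1 k r) := by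
  have h := hasSum_Ccoef_one_kernelMoment k r
  have h0 : ∀ n ∉ Set.range (fun m : ℕ => 2 * m + 1),
      (2 * r) ^ n / n.factorial * kernelMoment k (n + 1) = 0 := by
    intro n hn
    obtain ⟨m, rfl⟩ : Even n := by
      rw [← Nat.not_odd_iff_even]
      exact fun ⟨m, hm⟩ => hn ⟨m, hm.symm⟩
    rw [← two_mul, kernelMoment_odd, mul_zero]
  have hi : Function.Injective (fun m : ℕ => 2 * m + 1) := fun a b h => by simpa using h
  refine hasSum_of_eq ((hi.hasSum_iff h0).2 h) (fun m => ?_) rfl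
  -- Evaluating at `r = 1` isolates the moment itself, without dividing by a power of `r`.
  have h1 := kernelMoment_even k 1 (m + 1)
  rw [show 2 * (m + 1) = 2 * m + 1 + 1 by ring, Nat.factorial_succ, pow_succ] at h1
  have h2 : kernelMoment k (2 * m + 1 + 1) = momentCoeff k (m + 1) * (1 / 4) ^ (m + 1) *
      ((2 * m + 2) * (2 * m + 1).factorial) / 2 ^ (2 * m + 2) := by
    push_cast at h1
    field_simp at h1 ⊢
    ring_nf at h1 ⊢
    linarith
  simp only [Function.comp_apply]
  rw [h2, div_pow, div_pow, one_pow, pow_succ (4 : ℝ), pow_succ (2 * r), mul_pow,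
    pow_mul r 2, pow_mul (2 : ℝ) 2, pow_add (2 : ℝ), pow_mul (2 : ℝ) 2]
  norm_num
  field_simp
  ring

/-- The zeroth Fourier mode of the equation for `chi`. -/
theorem mul_Scoef_one (k r : ℝ) : r * Scoef 1 k r = k * (1 - Ccoef 0 k r) := by
  have hπ := pi_pos
  have hc : Continuous (chi k r) :=
    continuous_iff_continuousAt.2 fun φ => (chi_ode k r φ).continuousAt
  have h := intervalIntegral.integral_eq_sub_of_hasDerivAt (a := -π) (b := π)
    (fun φ _ => chi_ode k r φ) (Continuous.intervalIntegrable (by fun_prop) _ _)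
  have hp := chi_periodic k r (-π)
  rw [show -π + 2 * π = π by ring] at hp
  rw [hp, sub_self] at h
  have h2 : ∀ φ, k - (r * sin φ + k) * chi k r φ =
      k - r * (sin φ * chi k r φ) - k * chi k r φ := fun φ => by ring
  simp only [h2] at h
  rw [intervalIntegral.integral_sub (Continuous.intervalIntegrable (by fun_prop) _ _)
      (Continuous.intervalIntegrable (by fun_prop) _ _),
    intervalIntegral.integral_sub (Continuous.intervalIntegrable (by fun_prop) _ _)
      (Continuous.intervalIntegrable (by fun_prop) _ _),
    intervalIntegral.integral_const_mul, intervalIntegral.integral_const_mul,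
    intervalIntegral.integral_const, smul_eq_mul] at h
  simp only [Scoef, Ccoef, Int.cast_one, one_mul, Int.cast_zero, zero_mul, cos_zero]
  field_simp
  linarith

theorem hasSum_Scoef_one (k : ℝ) {r : ℝ} (hr : r ≠ 0) :
    HasSum (fun m : ℕ => -(k * r / 4) * (momentCoeff k (m + 1) * (r ^ 2 / 4) ^ m))
      (Scoef 1 k r) := by
  -- By `mul_Scoef_one`, `S₁` is `-k / r` times the series of `C₀` without its constant term `1`.
  have h := (hasSum_nat_add_iff' 1).2 (hasSum_Ccoef_zero k r)
  simp only [Finset.range_one, Finset.sum_singleton, momentCoeff_zero, pow_zero, mul_one] at h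
  refine hasSum_of_eq (h.mul_left (-(k / r))) (fun m => ?_) ?_
  · rw [pow_succ]
    field_simp
  · have := mul_Scoef_one k r
    field_simp
    linarith
-- The weights, their means, and bounds uniform in `k`.
-- Each factor of the product is at most `4 / (j + 1)`. The bound does not depend on `k`, which is
-- what makes the series jointly continuous in `(k, x)`.
theorem momentCoeff_le (k : ℝ) (m : ℕ) : momentCoeff k m ≤ 4 ^ m / m.factorial := by
  induction m with
  | zero => simp
  | succ m ih =>
    have h0 : (0 : ℝ) ≤ m := by positivity
    have h1 : (2 * (2 * m + 1) / ((m + 1) * ((m + 1) ^ 2 + k ^ 2)) : ℝ) ≤ 4 / (m + 1) := by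
      rw [div_le_div_iff₀ (by positivity) (by positivity)]
      have h2 : (2 * m + 1 : ℝ) ≤ 2 * ((m + 1) ^ 2 + k ^ 2) := by
        nlinarith [sq_nonneg k, sq_nonneg (m : ℝ)]
      nlinarith
    calc momentCoeff k (m + 1) ≤ 4 ^ m / m.factorial * (4 / (m + 1)) := by
          rw [momentCoeff_succ]
          exact mul_le_mul ih h1 (by positivity) (by positivity)
      _ = 4 ^ (m + 1) / (m + 1).factorial := by
          rw [Nat.factorial_succ, Nat.cast_mul, pow_succ]
          push_cast
          field_simp

theorem continuous_momentCoeff (m : ℕ) : Continuous fun k => momentCoeff k m := by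
  unfold momentCoeff
  refine continuous_finsetProd _ fun j _ => ?_
  refine Continuous.div continuous_const (by fun_prop) fun k => by positivity

/-- The weights (up to a factor) of the power series in `r ^ 2 / 4` of the squared modulus of the
first Fourier coefficient. -/
noncomputable def waveWeight (k : ℝ) (m : ℕ) : ℝ := (m + 1) / (m + 2) * momentCoeff k (m + 1)

theorem waveWeight_pos (k : ℝ) (m : ℕ) : 0 < waveWeight k m :=
  mul_pos (by positivity) (momentCoeff_pos k _)

theorem continuous_waveWeight (m : ℕ) : Continuous fun k => waveWeight k m :=
  continuous_const.mul (continuous_momentCoeff _)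

theorem succ_mul_momentCoeff_le (k : ℝ) (m : ℕ) :
    (m + 1) * momentCoeff k (m + 1) ≤ 4 * (4 ^ m / m.factorial) := by
  have h := momentCoeff_le k (m + 1)
  rw [Nat.factorial_succ] at h
  calc _ ≤ (m + 1) * ((4 : ℝ) ^ (m + 1) / (((m + 1) * m.factorial : ℕ) : ℝ)) := by gcongr
    _ = _ := by
      push_cast
      field_simp
      ring

theorem succ_mul_waveWeight_le (k : ℝ) (m : ℕ) :
    (m + 1) * waveWeight k m ≤ 4 * (4 ^ m / m.factorial) := by
  refine le_trans ?_ (succ_mul_momentCoeff_le k m)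
  have h1 : ((m : ℝ) + 1) / (m + 2) ≤ 1 := by
    rw [div_le_one (by positivity)]
    linarith
  have h2 := momentCoeff_pos k (m + 1)
  unfold waveWeight
  gcongr
  exact mul_le_of_le_one_left h2.le h1

theorem summable_of_le_factorial {c : ℕ → ℝ} {B : ℝ}
    (hb : ∀ m, |c m| ≤ B * (4 ^ m / m.factorial)) (x : ℝ) :
    Summable fun m => ‖c m * x ^ m‖ := by
  refine Summable.of_nonneg_of_le (fun m => norm_nonneg _) (fun m => ?_)
    ((Real.summable_pow_div_factorial (4 * |x|)).mul_left B)
  rw [Real.norm_eq_abs, abs_mul, abs_pow]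
  calc _ ≤ B * (4 ^ m / m.factorial) * |x| ^ m := by gcongr; exact hb m
    _ = _ := by rw [mul_pow]; ring

/-- On each strip `|x| < R`, an exponential series dominates the terms uniformly in `k`. -/
theorem continuous_tsum_mul_pow {c : ℕ → ℝ → ℝ} {B : ℝ} (hc : ∀ m, Continuous (c m))
    (hb : ∀ m k, |c m k| ≤ B * (4 ^ m / m.factorial)) :
    Continuous fun p : ℝ × ℝ => ∑' m, c m p.1 * p.2 ^ m := by
  have hB : 0 ≤ B := by simpa using (abs_nonneg _).trans (hb 0 0)
  refine continuous_iff_continuousAt.2 fun p => ?_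
  have hopen : IsOpen {q : ℝ × ℝ | |q.2| < |p.2| + 1} :=
    isOpen_lt (by fun_prop) continuous_const
  refine ContinuousOn.continuousAt (s := {q : ℝ × ℝ | |q.2| < |p.2| + 1}) ?_
    (hopen.mem_nhds (by simp))
  refine continuousOn_tsum (u := fun m : ℕ => B * ((4 * (|p.2| + 1)) ^ m / m.factorial))
    (fun m => (((hc m).comp continuous_fst).mul (continuous_snd.pow m)).continuousOn)
    ((Real.summable_pow_div_factorial _).mul_left B) fun m q hq => ?_
  rw [Real.norm_eq_abs, abs_mul, abs_pow]
  calc _ ≤ B * (4 ^ m / m.factorial) * (|p.2| + 1) ^ m := by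
        gcongr
        · exact hb m q.1
        · exact le_of_lt hq
    _ = _ := by rw [mul_pow]; ring

/-- A multiplier with `|c m| ≤ m + 1` gives a series dominated by an exponential series. -/
theorem abs_mul_waveWeight_le {c : ℕ → ℝ} (hc : ∀ m, |c m| ≤ m + 1) (k : ℝ) (m : ℕ) :
    |c m * waveWeight k m| ≤ 4 * (4 ^ m / m.factorial) := by
  rw [abs_mul, abs_of_pos (waveWeight_pos k m)]
  exact (mul_le_mul_of_nonneg_right (hc m) (waveWeight_pos k m).le).trans
    (succ_mul_waveWeight_le k m)

theorem summable_mul_waveWeight {c : ℕ → ℝ} (hc : ∀ m, |c m| ≤ m + 1) (k x : ℝ) :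
    Summable fun m => c m * (waveWeight k m * x ^ m) := by
  have := (summable_of_le_factorial (abs_mul_waveWeight_le hc k) x).of_norm
  simpa only [mul_assoc] using this

/-- The weighted series `∑ c m * waveWeight k m * x ^ m`. -/
noncomputable def waveSum (c : ℕ → ℝ) (k x : ℝ) : ℝ := ∑' m, c m * (waveWeight k m * x ^ m)

theorem continuous_waveSum {c : ℕ → ℝ} (hc : ∀ m, |c m| ≤ m + 1) :
    Continuous fun p : ℝ × ℝ => waveSum c p.1 p.2 := by
  have := continuous_tsum_mul_pow (c := fun m k => c m * waveWeight k m)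
    (fun m => continuous_const.mul (continuous_waveWeight m))
    (fun m k => abs_mul_waveWeight_le hc k m)
  simpa only [waveSum, mul_assoc] using this

/-- The total mass of the weights. -/
noncomputable def waveMass (k x : ℝ) : ℝ := waveSum (fun _ => 1) k x

/-- The mean of `m` with respect to the weights. -/
noncomputable def waveMean (k x : ℝ) : ℝ := waveSum (fun m => m) k x / waveMass k x

/-- The mean of `1 / (m + 1)` with respect to the weights. -/
noncomputable def waveInvMean (k x : ℝ) : ℝ :=
  waveSum (fun m => 1 / ((m : ℝ) + 1)) k x / waveMass k x

theorem abs_one_le_succ (m : ℕ) : |(1 : ℝ)| ≤ m + 1 := by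
  rw [abs_one]
  linarith [(Nat.cast_nonneg m : (0 : ℝ) ≤ m)]

theorem abs_cast_le_succ (m : ℕ) : |(m : ℝ)| ≤ m + 1 := by
  rw [Nat.abs_cast]
  linarith

theorem abs_inv_le_succ (m : ℕ) : |1 / ((m : ℝ) + 1)| ≤ m + 1 := by
  have h : (0 : ℝ) ≤ m := Nat.cast_nonneg m
  rw [abs_of_pos (by positivity), div_le_iff₀ (by positivity)]
  nlinarith

theorem waveMass_pos (k : ℝ) {x : ℝ} (hx : 0 ≤ x) : 0 < waveMass k x := by
  have hs := summable_mul_waveWeight abs_one_le_succ k x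
  refine hs.tsum_pos (fun m => ?_) 0 ?_
  · have := waveWeight_pos k m
    positivity
  · simpa using waveWeight_pos k 0

theorem waveMean_nonneg (k : ℝ) {x : ℝ} (hx : 0 ≤ x) : 0 ≤ waveMean k x := by
  refine div_nonneg (tsum_nonneg fun m => ?_) (waveMass_pos k hx).le
  have := waveWeight_pos k m
  positivity

theorem waveInvMean_nonneg (k : ℝ) {x : ℝ} (hx : 0 ≤ x) : 0 ≤ waveInvMean k x := by
  refine div_nonneg (tsum_nonneg fun m => ?_) (waveMass_pos k hx).le
  have := waveWeight_pos k m
  positivity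

theorem waveInvMean_le_one (k : ℝ) {x : ℝ} (hx : 0 ≤ x) : waveInvMean k x ≤ 1 := by
  refine div_le_one_of_le₀ ?_ (waveMass_pos k hx).le
  refine (summable_mul_waveWeight abs_inv_le_succ k x).tsum_le_tsum (fun m => ?_)
    (summable_mul_waveWeight abs_one_le_succ k x)
  have := waveWeight_pos k m
  have h : 1 / ((m : ℝ) + 1) ≤ 1 := by
    rw [div_le_one (by positivity)]
    linarith [(Nat.cast_nonneg m : (0 : ℝ) ≤ m)]
  gcongr

theorem waveSum_zero_right (c : ℕ → ℝ) (k : ℝ) : waveSum c k 0 = c 0 * waveWeight k 0 := by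
  rw [waveSum, tsum_eq_single 0]
  · simp
  · intro m hm
    simp [hm]

theorem waveMean_zero_right (k : ℝ) : waveMean k 0 = 0 := by
  simp [waveMean, waveSum_zero_right]

theorem waveInvMean_zero_right (k : ℝ) : waveInvMean k 0 = 1 := by
  have := (waveMass_pos k le_rfl).ne'
  simp only [waveInvMean, waveMass, waveSum_zero_right] at this ⊢
  simp at this ⊢
  exact this

theorem waveWeight_neg (k : ℝ) (m : ℕ) : waveWeight (-k) m = waveWeight k m := by
  simp [waveWeight, momentCoeff]

theorem waveMean_neg (k x : ℝ) : waveMean (-k) x = waveMean k x := by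
  simp [waveMean, waveMass, waveSum, waveWeight_neg]

theorem waveInvMean_neg (k x : ℝ) : waveInvMean (-k) x = waveInvMean k x := by
  simp [waveInvMean, waveMass, waveSum, waveWeight_neg]

/-! ### The quadratic identity between the series, and closed forms for `𝓒₁`, `𝓢₁`. -/

section ModulusIdentity

open PowerSeries

/-- The formal power series form of `|g * conj f| ^ 2 = |g| ^ 2 * |f| ^ 2` for the modified Bessel
series `f`, `g` of complex order, after the product expansions. -/
theorem modulus_identity_powerSeries (k : ℝ) :
    (PowerSeries.mk fun m : ℕ => ((m + 1) * momentCoeff k (m + 1) : ℝ)) ^ 2 +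
        C (k ^ 2) * (PowerSeries.mk fun m => momentCoeff k (m + 1)) ^ 2 =
      4 * (PowerSeries.mk (waveWeight k) * PowerSeries.mk (momentCoeff k)) := by
  set F : ℝ⟦X⟧ := PowerSeries.mk (momentCoeff k) with hF
  set n0 : ℝ⟦X⟧ := PowerSeries.mk fun m => momentCoeff k (m + 1) with hn0
  set n1 : ℝ⟦X⟧ := PowerSeries.mk fun m : ℕ => ((m + 1) * momentCoeff k (m + 1) : ℝ) with hn1
  set M : ℝ⟦X⟧ := PowerSeries.mk (waveWeight k) with hM
  have dF : d⁄dX ℝ F = n1 := by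
    ext n
    simp only [hF, hn1, coeff_derivative, coeff_mk]
    ring
  have dn0 : X * d⁄dX ℝ n0 = n1 - n0 := by
    ext n
    cases n with
    | zero => simp [hn0, hn1]
    | succ n =>
      simp only [coeff_succ_X_mul, hn0, hn1, coeff_derivative, coeff_mk, map_sub]
      push_cast
      ring
  have dM : X * d⁄dX ℝ M = n1 - 2 * M := by
    have h2 : (2 : ℝ⟦X⟧) = C 2 := (map_ofNat C 2).symm
    rw [h2]
    ext n
    cases n with
    | zero => simp [hM, hn1, waveWeight]
    | succ n =>
      simp only [coeff_succ_X_mul, hM, hn1, coeff_derivative, coeff_mk, map_sub, coeff_C_mul,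
        waveWeight]
      push_cast
      field_simp
      ring
  -- The recursion of `momentCoeff` enters here: `((n + 1)² + k²) a_{n+1} = 2 a_n + 2 (n / (n + 1))
  -- a_n`, where the last term comes from `X * M`.
  have dn1 : X * d⁄dX ℝ n1 = 2 * F + 2 * (X * M) - n1 - C (k ^ 2) * n0 := by
    have h2 : (2 : ℝ⟦X⟧) = C 2 := (map_ofNat C 2).symm
    rw [h2]
    ext n
    cases n with
    | zero =>
      simp [hF, hn0, hn1, momentCoeff_succ]
      field_simp
      ring
    | succ n =>
      simp only [coeff_succ_X_mul, hM, hF, hn0, hn1, coeff_derivative, coeff_mk, map_sub, map_add,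
        coeff_C_mul, waveWeight, momentCoeff_succ k (n + 1)]
      push_cast
      field_simp
      ring
  -- The defect `D` of the identity satisfies the Euler equation `X D' = -2 D`. Its coefficients
  -- then obey `(n + 2) d_n = 0`, so `D = 0`.
  have key : X * d⁄dX ℝ (n1 ^ 2 + C (k ^ 2) * n0 ^ 2 - 4 * (M * F)) =
      -2 * (n1 ^ 2 + C (k ^ 2) * n0 ^ 2 - 4 * (M * F)) := by
    have h4 : (4 : ℝ⟦X⟧) = C 4 := (map_ofNat C 4).symm
    have hd : d⁄dX ℝ (n1 ^ 2 + C (k ^ 2) * n0 ^ 2 - 4 * (M * F)) =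
        2 * n1 * d⁄dX ℝ n1 + C (k ^ 2) * (2 * n0 * d⁄dX ℝ n0) -
          4 * (M * d⁄dX ℝ F + F * d⁄dX ℝ M) := by
      rw [h4]
      simp only [map_sub, map_add, Derivation.leibniz, Derivation.leibniz_pow, derivative_C,
        smul_eq_mul, nsmul_eq_mul]
      push_cast
      ring
    rw [hd, dF]
    linear_combination 2 * n1 * dn1 + 2 * C (k ^ 2) * n0 * dn0 - 4 * F * dM
  rw [← sub_eq_zero]
  ext n
  have h2 : (-2 : ℝ⟦X⟧) = C (-2) := by rw [map_neg, map_ofNat]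
  have := congrArg (coeff n) key
  rw [h2, coeff_C_mul] at this
  rw [map_zero]
  cases n with
  | zero => simpa using this
  | succ n =>
    rw [coeff_succ_X_mul, coeff_derivative] at this
    have h3 : (coeff (n + 1)) (n1 ^ 2 + C (k ^ 2) * n0 ^ 2 - 4 * (M * F)) * ((n : ℝ) + 3) = 0 := by
      linarith
    exact (mul_eq_zero.1 h3).resolve_right (by positivity)

theorem tsum_mul_tsum_powerSeries {f g : ℕ → ℝ} {x : ℝ} (hf : Summable fun m => ‖f m * x ^ m‖)
    (hg : Summable fun m => ‖g m * x ^ m‖) :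
    HasSum (fun n => coeff n (PowerSeries.mk f * PowerSeries.mk g) * x ^ n)
      ((∑' m, f m * x ^ m) * ∑' m, g m * x ^ m) := by
  have hs := (summable_norm_sum_mul_antidiagonal_of_summable_norm hf hg).of_norm
  rw [tsum_mul_tsum_eq_tsum_sum_antidiagonal_of_summable_norm hf hg]
  refine hasSum_of_eq hs.hasSum (fun n => ?_) rfl
  rw [coeff_mul, Finset.sum_mul]
  refine Finset.sum_congr rfl fun p hp => ?_
  rw [← Finset.HasAntidiagonal.mem_antidiagonal.1 hp, pow_add, coeff_mk, coeff_mk]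
  ring

end ModulusIdentity

/-- Relative to `waveWeight k m` these coefficients are `m + 2`, whose mean is `2 + waveMean`. -/
theorem tsum_succ_mul_momentCoeff (k : ℝ) {x : ℝ} (hx : 0 ≤ x) :
    HasSum (fun m : ℕ => (m + 1) * momentCoeff k (m + 1) * x ^ m)
      (waveMass k x * (2 + waveMean k x)) := by
  have h1 := (summable_mul_waveWeight abs_one_le_succ k x).hasSum
  have h2 := (summable_mul_waveWeight abs_cast_le_succ k x).hasSum
  have h0 := (waveMass_pos k hx).ne'
  refine hasSum_of_eq ((h1.mul_left 2).add h2) (fun m => ?_) ?_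
  · rw [waveWeight]
    field_simp
    ring
  · rw [waveMean]
    change 2 * waveMass k x + waveSum (fun m => m) k x = _
    field_simp

/-- Relative to `waveWeight k m` these coefficients are `1 + 1 / (m + 1)`, whose mean is `1 +
waveInvMean`. -/
theorem tsum_momentCoeff_succ (k : ℝ) {x : ℝ} (hx : 0 ≤ x) :
    HasSum (fun m : ℕ => momentCoeff k (m + 1) * x ^ m)
      (waveMass k x * (1 + waveInvMean k x)) := by
  have h1 := (summable_mul_waveWeight abs_one_le_succ k x).hasSum
  have h2 := (summable_mul_waveWeight abs_inv_le_succ k x).hasSum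
  have h0 := (waveMass_pos k hx).ne'
  refine hasSum_of_eq (h1.add h2) (fun m => ?_) ?_
  · rw [waveWeight]
    field_simp
    ring
  · rw [waveInvMean]
    change waveMass k x + waveSum _ k x = _
    field_simp

/-- The formal identity is evaluated at `x = r² / 4`. Its left side is quadratic in the mass and its
right side linear, so one positive factor `waveMass` cancels. The remaining one cancels in the
quotients `𝓒₁` and `𝓢₁`. -/
theorem Ccoef_zero_eq (k r : ℝ) : 4 * Ccoef 0 k r = waveMass k (r ^ 2 / 4) *
    ((2 + waveMean k (r ^ 2 / 4)) ^ 2 + k ^ 2 * (1 + waveInvMean k (r ^ 2 / 4)) ^ 2) := by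
  have hx : 0 ≤ r ^ 2 / 4 := by positivity
  set x := r ^ 2 / 4
  have h1 := tsum_succ_mul_momentCoeff k hx
  have h0 := tsum_momentCoeff_succ k hx
  have hF := hasSum_Ccoef_zero k r
  have hM := (summable_mul_waveWeight abs_one_le_succ k x).hasSum
  simp only [one_mul] at hM
  have bM : ∀ m, |waveWeight k m| ≤ 4 * (4 ^ m / m.factorial) := fun m => by
    have := abs_mul_waveWeight_le abs_one_le_succ k m
    rwa [one_mul] at this
  have bF : ∀ m, |momentCoeff k m| ≤ 1 * (4 ^ m / m.factorial) := fun m => by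
    rw [abs_of_pos (momentCoeff_pos k m), one_mul]
    exact momentCoeff_le k m
  have b1 : ∀ m : ℕ, |(m + 1) * momentCoeff k (m + 1)| ≤ 4 * (4 ^ m / m.factorial) := fun m => by
    have := momentCoeff_pos k (m + 1)
    rw [abs_of_pos (by positivity)]
    exact succ_mul_momentCoeff_le k m
  have b0 : ∀ m : ℕ, |momentCoeff k (m + 1)| ≤ 4 * (4 ^ m / m.factorial) := fun m => by
    have := momentCoeff_pos k (m + 1)
    rw [abs_of_pos this]
    refine le_trans ?_ (succ_mul_momentCoeff_le k m)
    exact le_mul_of_one_le_left this.le (by linarith [(Nat.cast_nonneg m : (0 : ℝ) ≤ m)])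
  have s1 := summable_of_le_factorial b1 x
  have s0 := summable_of_le_factorial b0 x
  have sM := summable_of_le_factorial bM x
  have sF := summable_of_le_factorial bF x
  have p1 := tsum_mul_tsum_powerSeries s1 s1
  have p0 := tsum_mul_tsum_powerSeries s0 s0
  have pMF := tsum_mul_tsum_powerSeries sM sF
  rw [h1.tsum_eq] at p1
  rw [h0.tsum_eq] at p0
  rw [hF.tsum_eq] at pMF
  have hMe : ∑' m, waveWeight k m * x ^ m = waveMass k x := by
    simp only [waveMass, waveSum, one_mul]
  rw [hMe] at pMF
  have hid := modulus_identity_powerSeries k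
  have h4 : (4 : PowerSeries ℝ) = PowerSeries.C 4 :=
    (map_ofNat PowerSeries.C 4).symm
  have hL := p1.add (p0.mul_left (k ^ 2))
  have hR := pMF.mul_left 4
  have heq := hL.unique (hasSum_of_eq hR (fun n => by
    have := congrArg (PowerSeries.coeff n) hid
    rw [h4, map_add, PowerSeries.coeff_C_mul, PowerSeries.coeff_C_mul,
      sq (PowerSeries.mk _), sq (PowerSeries.mk fun m => momentCoeff k (m + 1))] at this
    linear_combination -x ^ n * this) rfl)
  have hpos := waveMass_pos k hx
  refine mul_left_cancel₀ hpos.ne' ?_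
  linear_combination -heq

theorem Ccoef_zero_pos (k r : ℝ) : 0 < Ccoef 0 k r := by
  have hx : 0 ≤ r ^ 2 / 4 := by positivity
  have h := Ccoef_zero_eq k r
  have h1 := waveMass_pos k hx
  have h2 := waveMean_nonneg k hx
  have : 0 < waveMass k (r ^ 2 / 4) *
    ((2 + waveMean k (r ^ 2 / 4)) ^ 2 + k ^ 2 * (1 + waveInvMean k (r ^ 2 / 4)) ^ 2) := by
    positivity
  linarith

/-- The squared modulus of the reciprocal of `𝓒₁ + i 𝓢₁`. -/
noncomputable def waveModSq (k x : ℝ) : ℝ :=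
  (2 + waveMean k x) ^ 2 + k ^ 2 * (1 + waveInvMean k x) ^ 2

theorem waveModSq_pos (k : ℝ) {x : ℝ} (hx : 0 ≤ x) : 0 < waveModSq k x := by
  have := waveMean_nonneg k hx
  unfold waveModSq
  positivity

theorem calC_eq (k : ℝ) {r : ℝ} (hr : r ≠ 0) :
    calC 1 k r = (2 + waveMean k (r ^ 2 / 4)) / waveModSq k (r ^ 2 / 4) := by
  have hx : 0 ≤ r ^ 2 / 4 := by positivity
  have h := Ccoef_zero_eq k r
  rw [← waveModSq] at h
  have h1 := ((tsum_succ_mul_momentCoeff k hx).mul_left (r / 4)).unique (hasSum_Ccoef_one k r)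
  have hM := (waveMass_pos k hx).ne'
  have hQ := (waveModSq_pos k hx).ne'
  have hC : Ccoef 0 k r = waveMass k (r ^ 2 / 4) * waveModSq k (r ^ 2 / 4) / 4 := by linarith
  rw [calC, ← h1, hC]
  field_simp

theorem calS_eq (k : ℝ) {r : ℝ} (hr : r ≠ 0) :
    calS 1 k r = k * (1 + waveInvMean k (r ^ 2 / 4)) / waveModSq k (r ^ 2 / 4) := by
  have hx : 0 ≤ r ^ 2 / 4 := by positivity
  have h := Ccoef_zero_eq k r
  rw [← waveModSq] at h
  have h1 := ((tsum_momentCoeff_succ k hx).mul_left (-(k * r / 4))).unique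
    (hasSum_Scoef_one k hr)
  have hM := (waveMass_pos k hx).ne'
  have hQ := (waveModSq_pos k hx).ne'
  have hC : Ccoef 0 k r = waveMass k (r ^ 2 / 4) * waveModSq k (r ^ 2 / 4) / 4 := by linarith
  rw [calS, ← h1, hC]
  field_simp

/-! ### Comparison of means under a change of weights. -/

/-- A strictly increasing likelihood ratio increases the mean of a strictly increasing function. -/
theorem tsum_mul_lt_of_ratio_lt {v w φ : ℕ → ℝ} (hv : ∀ m, 0 < v m)
    (hr : ∀ m, w m * v (m + 1) < w (m + 1) * v m) (hφ : StrictMono φ) (sv : Summable v)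
    (sw : Summable w) (sφv : Summable fun m => φ m * v m) (sφw : Summable fun m => φ m * w m) :
    (∑' m, φ m * v m) * ∑' m, w m < (∑' m, φ m * w m) * ∑' m, v m := by
  set V := ∑' m, v m with hV
  set W := ∑' m, w m with hW
  have hVpos : 0 < V := sv.tsum_pos (fun m => (hv m).le) 0 (hv 0)
  have hsum : HasSum (fun m => w m * V - v m * W) 0 := by
    have := (sw.hasSum.mul_right V).sub (sv.hasSum.mul_right W)
    rwa [← hV, ← hW, mul_comm W V, sub_self] at this
  -- The difference of the normalized weights, scaled by `V * W`, changes sign at most once, from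
  -- negative to positive.
  have hstep : ∀ m, 0 ≤ w m * V - v m * W → 0 < w (m + 1) * V - v (m + 1) * W := by
    intro m hm
    have h1 := mul_lt_mul_of_pos_right (hr m) hVpos
    have h2 := mul_le_mul_of_nonneg_right (sub_nonneg.1 hm) (hv (m + 1)).le
    have h3 : v m * (v (m + 1) * W) < v m * (w (m + 1) * V) := by nlinarith
    exact sub_pos.2 (lt_of_mul_lt_mul_left h3 (hv m).le)
  have hex : ∃ p, 0 ≤ w p * V - v p * W := by
    by_contra! hcon
    have := hsum.summable.tsum_lt_tsum (g := fun _ => (0 : ℝ)) (fun m => (hcon m).le) (hcon 0)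
      summable_zero
    rw [hsum.tsum_eq, tsum_zero] at this
    exact lt_irrefl _ this
  classical
  set p := Nat.find hex with hp
  have hlt : ∀ m < p, w m * V - v m * W < 0 := fun m hm => not_le.1 (Nat.find_min hex hm)
  have hgt : ∀ m, 0 < w (p + m + 1) * V - v (p + m + 1) * W := by
    intro m
    induction m with
    | zero => exact hstep p (Nat.find_spec hex)
    | succ m ih => exact hstep _ ih.le
  -- Subtracting `φ p` costs nothing because the differences sum to zero; it makes both factors
  -- change sign at the same place `p`.
  have htot : HasSum (fun m => (φ m - φ p) * (w m * V - v m * W))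
      ((∑' m, φ m * w m) * V - (∑' m, φ m * v m) * W - φ p * 0) := by
    refine hasSum_of_eq (((sφw.hasSum.mul_right V).sub (sφv.hasSum.mul_right W)).sub
      (hsum.mul_left (φ p))) (fun m => ?_) rfl
    ring
  have hpos : 0 < ∑' m, (φ m - φ p) * (w m * V - v m * W) := by
    refine htot.summable.tsum_pos (fun m => ?_) (p + 0 + 1)
      (mul_pos (sub_pos.2 (hφ (by omega))) (hgt 0))
    rcases lt_trichotomy m p with h | h | h
    · exact mul_nonneg_of_nonpos_of_nonpos (sub_nonpos.2 (hφ h).le) (hlt m h).le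
    · rw [h, sub_self, zero_mul]
    · obtain ⟨j, rfl⟩ := Nat.exists_eq_add_of_lt h
      exact mul_nonneg (sub_nonneg.2 (hφ h).le) (hgt j).le
  rw [htot.tsum_eq] at hpos
  linarith

/-- A log-convex change of weights that does not increase the mean of `m` does not decrease the
mean of the convex decreasing function `1 / (m + 1)`. -/
theorem tsum_inv_mul_le_of_ratio_convex {v w : ℕ → ℝ} (hv : ∀ m, 0 < v m)
    (hr : ∀ m, w m * v (m + 1) < w (m + 1) * v m → w (m + 1) * v (m + 2) < w (m + 2) * v (m + 1))
    (sv : Summable v) (sw : Summable w) (smv : Summable fun m : ℕ => (m : ℝ) * v m)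
    (smw : Summable fun m : ℕ => (m : ℝ) * w m)
    (siv : Summable fun m : ℕ => 1 / ((m : ℝ) + 1) * v m)
    (siw : Summable fun m : ℕ => 1 / ((m : ℝ) + 1) * w m)
    (hmean : (∑' m : ℕ, (m : ℝ) * w m) * ∑' m, v m ≤ (∑' m : ℕ, (m : ℝ) * v m) * ∑' m, w m) :
    (∑' m : ℕ, 1 / ((m : ℝ) + 1) * v m) * ∑' m, w m ≤
      (∑' m : ℕ, 1 / ((m : ℝ) + 1) * w m) * ∑' m, v m := by
  set V := ∑' m, v m with hV
  set W := ∑' m, w m with hW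
  have hVpos : 0 < V := sv.tsum_pos (fun m => (hv m).le) 0 (hv 0)
  set h : ℕ → ℝ := fun m => w m * V - v m * W with hh
  have hsum : HasSum h 0 := by
    have := (sw.hasSum.mul_right V).sub (sv.hasSum.mul_right W)
    rwa [← hV, ← hW, mul_comm W V, sub_self] at this
  have hi : HasSum (fun m : ℕ => 1 / ((m : ℝ) + 1) * h m)
      ((∑' m : ℕ, 1 / ((m : ℝ) + 1) * w m) * V - (∑' m : ℕ, 1 / ((m : ℝ) + 1) * v m) * W) := by
    refine hasSum_of_eq ((siw.hasSum.mul_right V).sub (siv.hasSum.mul_right W)) (fun m => ?_) rfl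
    simp only [hh]
    ring
  have hm : HasSum (fun m : ℕ => (m : ℝ) * h m)
      ((∑' m : ℕ, (m : ℝ) * w m) * V - (∑' m : ℕ, (m : ℝ) * v m) * W) := by
    refine hasSum_of_eq ((smw.hasSum.mul_right V).sub (smv.hasSum.mul_right W)) (fun m => ?_) rfl
    simp only [hh]
    ring
  rw [← sub_nonneg]
  have hstep : ∀ m, w m * v (m + 1) < w (m + 1) * v m → 0 ≤ h m → 0 ≤ h (m + 1) := by
    intro m hrm hm
    have h1 := mul_lt_mul_of_pos_right hrm hVpos
    have h2 := mul_le_mul_of_nonneg_right (sub_nonneg.1 hm) (hv (m + 1)).le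
    have h3 : v m * (v (m + 1) * W) < v m * (w (m + 1) * V) := by nlinarith
    exact (sub_pos.2 (lt_of_mul_lt_mul_left h3 (hv m).le)).le
  have hstep' : ∀ m, h m < 0 → 0 ≤ h (m + 1) → w m * v (m + 1) < w (m + 1) * v m := by
    intro m h1 h2
    by_contra! hcon
    have h3 := mul_le_mul_of_nonneg_right hcon hVpos.le
    have h4 := mul_lt_mul_of_pos_right (sub_neg.1 h1) (hv (m + 1))
    have h5 := mul_le_mul_of_nonneg_right (sub_nonneg.1 h2) (hv m).le
    nlinarith
  -- By `hr`, the ratio `w / v` increases forever once it has increased. If `h` returned from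
  -- negative to nonnegative, the ratio has risen before, so `h` can never become negative again.
  -- The set `h < 0` is thus an interval.
  have hinterval : ∀ i j l, i ≤ j → j ≤ l → h i < 0 → h l < 0 → h j < 0 := by
    intro i j l hij hjl hhi hhl
    by_contra! hj
    have hex : ∃ s, s < j ∧ w s * v (s + 1) < w (s + 1) * v s := by
      by_contra! hcon
      have : ∀ t, i ≤ t → t ≤ j → h t < 0 := by
        intro t ht
        induction t, ht using Nat.le_induction with
        | base => exact fun _ => hhi
        | succ t ht ih =>
          intro htj
          by_contra! h0
          exact absurd (hstep' t (ih (by omega)) h0) (not_lt.2 (hcon t (by omega)))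
      exact absurd (this j hij le_rfl) (not_lt.2 hj)
    obtain ⟨s, hsj, hs⟩ := hex
    have hP : ∀ t, s ≤ t → w t * v (t + 1) < w (t + 1) * v t := by
      intro t ht
      induction t, ht using Nat.le_induction with
      | base => exact hs
      | succ t ht ih => exact hr t ih
    have : ∀ t, j ≤ t → 0 ≤ h t := by
      intro t ht
      induction t, ht using Nat.le_induction with
      | base => exact hj
      | succ t ht ih => exact hstep t (hP t (by omega)) ih
    exact absurd hhl (not_lt.2 (this l hjl))
  by_cases hne : ∃ m, h m < 0
  swap
  · push Not at hne
    rw [← hi.tsum_eq]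
    exact tsum_nonneg fun m => mul_nonneg (by positivity) (hne m)
  classical
  obtain ⟨p, hp, hpmin⟩ : ∃ p, h p < 0 ∧ ∀ m < p, 0 ≤ h m :=
    ⟨Nat.find hne, Nat.find_spec hne, fun m hm => not_lt.1 (Nat.find_min hne hm)⟩
  by_cases hbdd : ∃ q, ∀ l, q < l → 0 ≤ h l
  · obtain ⟨q, hq, hqmin⟩ : ∃ q, (∀ l, q < l → 0 ≤ h l) ∧ ∀ t < q, ∃ l, t < l ∧ h l < 0 := by
      refine ⟨Nat.find hbdd, Nat.find_spec hbdd, fun t ht => ?_⟩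
      have := Nat.find_min hbdd ht
      push Not at this
      exact this
    have hmid : ∀ m, p ≤ m → m ≤ q → h m ≤ 0 := by
      intro m hpm hmq
      rcases hpm.eq_or_lt with rfl | hlt
      · exact hp.le
      · obtain ⟨l, hl, hl0⟩ := hqmin (m - 1) (by omega)
        exact (hinterval p m l hpm (by omega) hp hl0).le
    have hpq : p ≤ q := by
      by_contra! hcon
      exact absurd hp (not_lt.2 (hq p hcon))
    -- When `h < 0` has a last point `q`, this multiplier has the same sign pattern as `h`, and it
    -- equals `m - (p + q + 1) + (p + 1)(q + 1) / (m + 1)`. The first part contributes at most zero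
    -- by `hmean`, the constant contributes zero, and the last is the wanted sum.
    have htot : HasSum (fun m : ℕ => ((m : ℝ) - p) * (m - q) / (m + 1) * h m)
        (((∑' m : ℕ, (m : ℝ) * w m) * V - (∑' m : ℕ, (m : ℝ) * v m) * W) -
          ((p : ℝ) + q + 1) * 0 + ((p : ℝ) + 1) * (q + 1) *
          ((∑' m : ℕ, 1 / ((m : ℝ) + 1) * w m) * V -
            (∑' m : ℕ, 1 / ((m : ℝ) + 1) * v m) * W)) := by
      refine hasSum_of_eq ((hm.sub (hsum.mul_left ((p : ℝ) + q + 1))).add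
        (hi.mul_left (((p : ℝ) + 1) * (q + 1)))) (fun m => ?_) rfl
      field_simp
      ring
    have hnn : 0 ≤ ∑' m : ℕ, ((m : ℝ) - p) * (m - q) / (m + 1) * h m := by
      refine tsum_nonneg fun m => ?_
      rcases lt_or_ge m p with h1 | h1
      · have h2 : (m : ℝ) < p := by exact_mod_cast h1
        have h3 : (p : ℝ) ≤ q := by exact_mod_cast hpq
        exact mul_nonneg (div_nonneg (mul_nonneg_of_nonpos_of_nonpos (by linarith)
          (by linarith)) (by positivity)) (hpmin m h1)
      · have h2 : (p : ℝ) ≤ m := by exact_mod_cast h1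
        rcases le_or_gt m q with h3 | h3
        · have h4 : (m : ℝ) ≤ q := by exact_mod_cast h3
          exact mul_nonneg_of_nonpos_of_nonpos (div_nonpos_of_nonpos_of_nonneg
            (mul_nonpos_of_nonneg_of_nonpos (by linarith) (by linarith)) (by positivity))
            (hmid m h1 h3)
        · have h4 : (q : ℝ) < m := by exact_mod_cast h3
          exact mul_nonneg (div_nonneg (mul_nonneg (by linarith) (by linarith))
            (by positivity)) (hq m h3)
    rw [htot.tsum_eq] at hnn
    have hpq' : (0 : ℝ) < ((p : ℝ) + 1) * (q + 1) := by positivity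
    refine le_of_mul_le_mul_left ?_ hpq'
    linarith
  · push Not at hbdd
    -- Here `h` is nonpositive from `p` on. One sign change remains, and monotonicity of `1 / (m +
    -- 1)` alone suffices, without `hmean`.
    have hneg : ∀ m, p ≤ m → h m ≤ 0 := by
      intro m hpm
      obtain ⟨l, hl, hl0⟩ := hbdd m
      exact (hinterval p m l hpm hl.le hp hl0).le
    have htot := hi.sub (hsum.mul_left (1 / ((p : ℝ) + 1)))
    have hnn : 0 ≤ ∑' m : ℕ, (1 / ((m : ℝ) + 1) * h m - 1 / ((p : ℝ) + 1) * h m) := by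
      refine tsum_nonneg fun m => ?_
      rw [← sub_mul]
      rcases lt_or_ge m p with h1 | h1
      · have h2 : (m : ℝ) ≤ p := by exact_mod_cast h1.le
        refine mul_nonneg (sub_nonneg.2 ?_) (hpmin m h1)
        gcongr
      · have h2 : (p : ℝ) ≤ m := by exact_mod_cast h1
        refine mul_nonneg_of_nonpos_of_nonpos (sub_nonpos.2 ?_) (hneg m h1)
        gcongr
    rw [htot.tsum_eq] at hnn
    linarith

/-! ### Dependence of the two means on `k` and `x`. -/

theorem waveWeight_succ (k : ℝ) (m : ℕ) : waveWeight k (m + 1) = waveWeight k m *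
    (2 * (2 * m + 3) * (m + 2) / ((m + 1) * (m + 3)) / ((m + 2) ^ 2 + k ^ 2)) := by
  rw [waveWeight, waveWeight, momentCoeff_succ k (m + 1)]
  have h : (((m + 1 : ℕ) : ℝ) + 1) ^ 2 + k ^ 2 = (m + 2) ^ 2 + k ^ 2 := by push_cast; ring
  rw [h]
  have h0 : ((m : ℝ) + 2) ^ 2 + k ^ 2 ≠ 0 := by positivity
  push_cast
  field_simp
  ring

/-- Everything in the ratio of consecutive weights except `x / ((m + 2)² + k²)` is common to both
parameter pairs and drops out. -/
theorem waveWeight_ratio_lt_iff {k₁ k₂ x₁ x₂ : ℝ} (h₁ : 0 < x₁) (h₂ : 0 < x₂) (m : ℕ) :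
    (waveWeight k₂ m * x₂ ^ m) * (waveWeight k₁ (m + 1) * x₁ ^ (m + 1)) <
        (waveWeight k₂ (m + 1) * x₂ ^ (m + 1)) * (waveWeight k₁ m * x₁ ^ m) ↔
      x₁ * ((m + 2) ^ 2 + k₂ ^ 2) < x₂ * ((m + 2) ^ 2 + k₁ ^ 2) := by
  have hw₁ := waveWeight_pos k₁ m
  have hw₂ := waveWeight_pos k₂ m
  have hk₁ : 0 < ((m : ℝ) + 2) ^ 2 + k₁ ^ 2 := by positivity
  have hk₂ : 0 < ((m : ℝ) + 2) ^ 2 + k₂ ^ 2 := by positivity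
  rw [waveWeight_succ, waveWeight_succ]
  set g : ℝ := 2 * (2 * m + 3) * (m + 2) / ((m + 1) * (m + 3)) with hg
  have hgp : 0 < g := by positivity
  have e1 : (waveWeight k₂ m * x₂ ^ m) * (waveWeight k₁ m * (g / ((m + 2) ^ 2 + k₁ ^ 2)) *
      x₁ ^ (m + 1)) = (waveWeight k₂ m * x₂ ^ m * (waveWeight k₁ m * x₁ ^ m) * g) *
        (x₁ / ((m + 2) ^ 2 + k₁ ^ 2)) := by
    rw [pow_succ]
    ring
  have e2 : (waveWeight k₂ m * (g / ((m + 2) ^ 2 + k₂ ^ 2)) * x₂ ^ (m + 1)) *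
      (waveWeight k₁ m * x₁ ^ m) = (waveWeight k₂ m * x₂ ^ m * (waveWeight k₁ m * x₁ ^ m) * g) *
        (x₂ / ((m + 2) ^ 2 + k₂ ^ 2)) := by
    rw [pow_succ]
    ring
  rw [e1, e2, mul_lt_mul_iff_right₀ (by positivity), div_lt_div_iff₀ hk₁ hk₂]

theorem waveSum_mul_lt {c : ℕ → ℝ} (hc : ∀ m, |c m| ≤ m + 1) (hmono : StrictMono c)
    {k₁ k₂ x₁ x₂ : ℝ} (h₁ : 0 < x₁) (h₂ : 0 < x₂)
    (h : ∀ m : ℕ, x₁ * ((m + 2) ^ 2 + k₂ ^ 2) < x₂ * ((m + 2) ^ 2 + k₁ ^ 2)) :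
    waveSum c k₁ x₁ / waveMass k₁ x₁ < waveSum c k₂ x₂ / waveMass k₂ x₂ := by
  have hp : ∀ k {x : ℝ}, 0 < x → ∀ m, 0 < waveWeight k m * x ^ m := fun k x hx m =>
    mul_pos (waveWeight_pos k m) (pow_pos hx m)
  have hs : ∀ k x, Summable fun m => waveWeight k m * x ^ m := fun k x => by
    simpa only [one_mul] using summable_mul_waveWeight abs_one_le_succ k x
  have := tsum_mul_lt_of_ratio_lt (hp k₁ h₁)
    (fun m => (waveWeight_ratio_lt_iff h₁ h₂ m).2 (h m)) hmono (hs _ _) (hs _ _)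
    (summable_mul_waveWeight hc k₁ x₁) (summable_mul_waveWeight hc k₂ x₂)
  rw [div_lt_div_iff₀ (waveMass_pos k₁ h₁.le) (waveMass_pos k₂ h₂.le)]
  simpa only [waveMass, waveSum, one_mul] using this

theorem waveMean_lt {k₁ k₂ x₁ x₂ : ℝ} (h₁ : 0 < x₁) (h₂ : 0 < x₂)
    (h : ∀ m : ℕ, x₁ * ((m + 2) ^ 2 + k₂ ^ 2) < x₂ * ((m + 2) ^ 2 + k₁ ^ 2)) :
    waveMean k₁ x₁ < waveMean k₂ x₂ :=
  waveSum_mul_lt abs_cast_le_succ Nat.strictMono_cast h₁ h₂ h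

theorem waveInvMean_lt {k₁ k₂ x₁ x₂ : ℝ} (h₁ : 0 < x₁) (h₂ : 0 < x₂)
    (h : ∀ m : ℕ, x₁ * ((m + 2) ^ 2 + k₂ ^ 2) < x₂ * ((m + 2) ^ 2 + k₁ ^ 2)) :
    waveInvMean k₂ x₂ < waveInvMean k₁ x₁ := by
  have hmono : StrictMono fun m : ℕ => -(1 / ((m : ℝ) + 1)) := fun m n hmn => by
    have : (m : ℝ) < n := by exact_mod_cast hmn
    simp only [neg_lt_neg_iff]
    gcongr
  have := waveSum_mul_lt (c := fun m : ℕ => -(1 / ((m : ℝ) + 1)))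
    (fun m => by rw [abs_neg]; exact abs_inv_le_succ m) hmono h₁ h₂ h
  have hneg : ∀ k x, waveSum (fun m : ℕ => -(1 / ((m : ℝ) + 1))) k x =
      -waveSum (fun m : ℕ => 1 / ((m : ℝ) + 1)) k x := fun k x => by
    simp only [waveSum, neg_mul, tsum_neg]
  rw [hneg, hneg, neg_div, neg_div, neg_lt_neg_iff] at this
  exact this

theorem waveMean_pos (k : ℝ) {x : ℝ} (hx : 0 < x) : 0 < waveMean k x := by
  refine div_pos ((summable_mul_waveWeight abs_cast_le_succ k x).tsum_pos (fun m => ?_) 1 ?_)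
    (waveMass_pos k hx.le)
  · have := waveWeight_pos k m
    positivity
  · have := waveWeight_pos k 1
    positivity

theorem waveMean_strictMonoOn (k : ℝ) : StrictMonoOn (waveMean k) (Ici 0) := by
  intro x₁ h₁ x₂ h₂ h
  rcases (mem_Ici.1 h₁).eq_or_lt with rfl | h₁'
  · rw [waveMean_zero_right]
    exact waveMean_pos k h
  · refine waveMean_lt h₁' (h₁'.trans h) fun m => ?_
    gcongr

theorem waveInvMean_antitoneOn (k : ℝ) : AntitoneOn (waveInvMean k) (Ici 0) := by
  intro x₁ h₁ x₂ h₂ h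
  rcases (mem_Ici.1 h₁).eq_or_lt with rfl | h₁'
  · rw [waveInvMean_zero_right]
    exact waveInvMean_le_one k h₂
  · rcases h.eq_or_lt with rfl | h
    · rfl
    refine (waveInvMean_lt h₁' (h₁'.trans h) fun m => ?_).le
    gcongr

theorem waveMean_le_of_le {k₁ k₂ x : ℝ} (hx : 0 ≤ x) (hk₁ : 0 ≤ k₁) (hk : k₁ ≤ k₂) :
    waveMean k₂ x ≤ waveMean k₁ x := by
  rcases hx.eq_or_lt with rfl | hx
  · rw [waveMean_zero_right, waveMean_zero_right]
  rcases hk.eq_or_lt with rfl | hk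
  · rfl
  refine (waveMean_lt hx hx fun m => ?_).le
  gcongr

theorem waveInvMean_le_of_le {k₁ k₂ x : ℝ} (hx : 0 ≤ x) (hk₁ : 0 ≤ k₁) (hk : k₁ ≤ k₂) :
    waveInvMean k₁ x ≤ waveInvMean k₂ x := by
  rcases hx.eq_or_lt with rfl | hx
  · rw [waveInvMean_zero_right, waveInvMean_zero_right]
  rcases hk.eq_or_lt with rfl | hk
  · rfl
  refine (waveInvMean_lt hx hx fun m => ?_).le
  gcongr

/-- For `x₁ < x₂` the likelihood ratio rises at `m` exactly when `x₁ k₂² - x₂ k₁² < (x₂ - x₁)(m +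
2)²`, which persists for larger `m`. This covers the case of competing changes in `x` and `k`, where
the ratio need not be monotone. -/
theorem waveInvMean_le_of_waveMean_le {k₁ k₂ x₁ x₂ : ℝ} (h₁ : 0 < x₁) (h : x₁ < x₂)
    (hmean : waveMean k₂ x₂ ≤ waveMean k₁ x₁) : waveInvMean k₁ x₁ ≤ waveInvMean k₂ x₂ := by
  have h₂ := h₁.trans h
  have hp : ∀ k {x : ℝ}, 0 < x → ∀ m, 0 < waveWeight k m * x ^ m := fun k x hx m =>
    mul_pos (waveWeight_pos k m) (pow_pos hx m)
  have hs : ∀ k x, Summable fun m => waveWeight k m * x ^ m := fun k x => by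
    simpa only [one_mul] using summable_mul_waveWeight abs_one_le_succ k x
  unfold waveMean at hmean
  rw [div_le_div_iff₀ (waveMass_pos k₂ h₂.le) (waveMass_pos k₁ h₁.le)] at hmean
  have := tsum_inv_mul_le_of_ratio_convex (hp k₁ h₁) (fun m hm => by
      rw [waveWeight_ratio_lt_iff h₁ h₂] at hm
      have := waveWeight_ratio_lt_iff (k₁ := k₁) (k₂ := k₂) h₁ h₂ (m + 1)
      refine this.2 ?_
      push_cast
      nlinarith [(Nat.cast_nonneg m : (0 : ℝ) ≤ m)])
    (hs _ _) (hs _ _) (summable_mul_waveWeight abs_cast_le_succ k₁ x₁)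
    (summable_mul_waveWeight abs_cast_le_succ k₂ x₂)
    (summable_mul_waveWeight abs_inv_le_succ k₁ x₁)
    (summable_mul_waveWeight abs_inv_le_succ k₂ x₂)
    (by simpa only [waveMass, waveSum, one_mul] using hmean)
  unfold waveInvMean
  rw [div_le_div_iff₀ (waveMass_pos k₁ h₁.le) (waveMass_pos k₂ h₂.le)]
  simpa only [waveMass, waveSum, one_mul] using this

theorem continuousOn_waveMass :
    ContinuousOn (fun p : ℝ × ℝ => waveMass p.1 p.2) (univ ×ˢ Ici 0) :=
  (continuous_waveSum abs_one_le_succ).continuousOn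

theorem continuousOn_waveMean :
    ContinuousOn (fun p : ℝ × ℝ => waveMean p.1 p.2) (univ ×ˢ Ici 0) :=
  (continuous_waveSum abs_cast_le_succ).continuousOn.div continuousOn_waveMass
    fun p hp => (waveMass_pos p.1 hp.2).ne'

theorem continuousOn_waveInvMean :
    ContinuousOn (fun p : ℝ × ℝ => waveInvMean p.1 p.2) (univ ×ˢ Ici 0) :=
  (continuous_waveSum abs_inv_le_succ).continuousOn.div continuousOn_waveMass
    fun p hp => (waveMass_pos p.1 hp.2).ne'

/-- To get a mean of at least `N`, consider the sum of `(m - N)` against the weights. Its negative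
terms are bounded by a multiple of `x ^ N`, and for large `x` the term at `N + 1` outweighs them. -/
theorem tendsto_waveMean_atTop (k : ℝ) : Tendsto (waveMean k) atTop atTop := by
  refine tendsto_atTop.2 fun B => ?_
  obtain ⟨N, hN⟩ := exists_nat_ge B
  set C : ℝ := ∑ m ∈ Finset.range N, N * waveWeight k m with hC
  filter_upwards [eventually_ge_atTop (1 : ℝ),
    eventually_ge_atTop (C / waveWeight k (N + 1))] with x hx1 hxC
  have hx : 0 < x := by linarith
  refine hN.trans ?_
  rw [waveMean, le_div_iff₀ (waveMass_pos k hx.le)]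
  have h1 := (summable_mul_waveWeight abs_cast_le_succ k x)
  have h2 := (summable_mul_waveWeight abs_one_le_succ k x).mul_left (N : ℝ)
  have hs := h1.sub h2
  have hw := waveWeight_pos k (N + 1)
  rw [div_le_iff₀ hw] at hxC
  have hle := hs.sum_le_tsum (Finset.range (N + 2)) fun m hm => by
    have hm' : N + 2 ≤ m := by simpa using hm
    have hm'' : (N : ℝ) ≤ m := by exact_mod_cast (by omega : N ≤ m)
    have := waveWeight_pos k m
    have h3 : (0 : ℝ) ≤ (m - N) * (waveWeight k m * x ^ m) :=
      mul_nonneg (by linarith) (by positivity)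
    linarith
  rw [h1.tsum_sub h2, tsum_mul_left, Finset.sum_range_succ, Finset.sum_range_succ] at hle
  have hlow : -(C * x ^ N) ≤ ∑ m ∈ Finset.range N,
      ((m : ℝ) * (waveWeight k m * x ^ m) - N * (1 * (waveWeight k m * x ^ m))) := by
    rw [hC, Finset.sum_mul, ← Finset.sum_neg_distrib]
    refine Finset.sum_le_sum fun m hm => ?_
    have hm' : m ≤ N := (Finset.mem_range.1 hm).le
    have h3 := waveWeight_pos k m
    have h4 : x ^ m ≤ x ^ N := pow_le_pow_right₀ hx1 hm'
    have h5 : (N : ℝ) * (waveWeight k m * x ^ m) ≤ N * waveWeight k m * x ^ N := by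
      rw [mul_assoc]
      gcongr
    have h6 : (0 : ℝ) ≤ m * (waveWeight k m * x ^ m) := by positivity
    linarith
  have hxN : 0 < x ^ N := pow_pos hx N
  have h7 : C * x ^ N ≤ waveWeight k (N + 1) * x ^ (N + 1) := by
    rw [pow_succ]
    nlinarith
  change (N : ℝ) * waveSum (fun _ => 1) k x ≤ waveSum (fun m => m) k x
  simp only [waveSum]
  push_cast at hle
  linarith

/-! ### The phase and its level curves. -/

/-- The tangent of the phase of `𝓒₁ + i 𝓢₁`. -/
noncomputable def waveTan (k x : ℝ) : ℝ := k * (1 + waveInvMean k x) / (2 + waveMean k x)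

theorem continuousOn_waveTan :
    ContinuousOn (fun p : ℝ × ℝ => waveTan p.1 p.2) (univ ×ˢ Ici 0) := by
  refine ContinuousOn.div (continuousOn_fst.mul (continuousOn_const.add continuousOn_waveInvMean))
    (continuousOn_const.add continuousOn_waveMean) fun p hp => ?_
  have := waveMean_nonneg p.1 (mem_Ici.1 hp.2)
  positivity

/-- Raising `k` raises the numerator, explicitly and through `waveInvMean`, and does not raise the
denominator. -/
theorem waveTan_strictMonoOn {x : ℝ} (hx : 0 ≤ x) : StrictMonoOn (waveTan · x) (Ici 0) := by
  intro k₁ h₁ k₂ h₂ h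
  have h₁' : 0 ≤ k₁ := h₁
  have a := waveMean_le_of_le hx h₁ h.le
  have b := waveInvMean_le_of_le hx h₁ h.le
  have a2 := waveMean_nonneg k₂ hx
  have b1 := waveInvMean_nonneg k₁ hx
  have b2 := waveInvMean_nonneg k₂ hx
  have h3 : k₁ * (1 + waveInvMean k₁ x) < k₂ * (1 + waveInvMean k₂ x) := by nlinarith
  calc waveTan k₁ x ≤ k₁ * (1 + waveInvMean k₁ x) / (2 + waveMean k₂ x) := by
        unfold waveTan
        gcongr
    _ < _ := by
        simp only [waveTan]
        gcongr

theorem waveTan_strictAntiOn {k : ℝ} (hk : 0 < k) : StrictAntiOn (waveTan k) (Ici 0) := by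
  intro x₁ h₁ x₂ h₂ h
  have a := waveMean_strictMonoOn k h₁ h₂ h
  have b := waveInvMean_antitoneOn k h₁ h₂ h.le
  have a1 := waveMean_nonneg k h₁
  have b1 := waveInvMean_nonneg k h₁
  have b2 := waveInvMean_nonneg k h₂
  calc waveTan k x₂ ≤ k * (1 + waveInvMean k x₁) / (2 + waveMean k x₂) := by
        have a2 := waveMean_nonneg k h₂
        unfold waveTan
        gcongr
    _ < _ := by
        unfold waveTan
        gcongr

theorem waveTan_zero_left (x : ℝ) : waveTan 0 x = 0 := by simp [waveTan]

theorem waveTan_zero_right (k : ℝ) : waveTan k 0 = k := by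
  rw [waveTan, waveInvMean_zero_right, waveMean_zero_right]
  ring

theorem tendsto_waveTan_atTop {x : ℝ} (hx : 0 ≤ x) :
    Tendsto (fun k => waveTan k x) atTop atTop := by
  have h0 := waveMean_nonneg 0 hx
  have h1 : Tendsto (fun k : ℝ => k / (2 + waveMean 0 x)) atTop atTop :=
    tendsto_id.atTop_div_const (by positivity)
  refine tendsto_atTop_mono' _ ?_ h1
  filter_upwards [eventually_ge_atTop (0 : ℝ)] with k hk
  have a := waveMean_le_of_le hx le_rfl hk
  have a0 := waveMean_nonneg k hx
  have b := waveInvMean_nonneg k hx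
  unfold waveTan
  gcongr
  nlinarith

theorem tendsto_waveTan_right {k : ℝ} (hk : 0 < k) : Tendsto (waveTan k) atTop (𝓝 0) := by
  have h1 : Tendsto (fun x => k * 2 / (2 + waveMean k x)) atTop (𝓝 0) :=
    tendsto_const_nhds.div_atTop (tendsto_atTop_add_const_left _ _ (tendsto_waveMean_atTop k))
  refine tendsto_of_tendsto_of_tendsto_of_le_of_le' tendsto_const_nhds h1 ?_ ?_
  · filter_upwards [eventually_ge_atTop (0 : ℝ)] with x hx
    have a0 := waveMean_nonneg k hx
    have b := waveInvMean_nonneg k hx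
    unfold waveTan
    positivity
  · filter_upwards [eventually_ge_atTop (0 : ℝ)] with x hx
    have a0 := waveMean_nonneg k hx
    have b := waveInvMean_le_one k hx
    unfold waveTan
    gcongr
    linarith

/-- Along a level curve of the phase, `waveMean` increases with `x`. -/
theorem waveMean_lt_of_waveTan_eq {k₁ k₂ x₁ x₂ : ℝ} (hk₁ : 0 ≤ k₁) (hk₂ : 0 ≤ k₂)
    (h₁ : 0 ≤ x₁) (h : x₁ < x₂) (heq : waveTan k₁ x₁ = waveTan k₂ x₂) :
    waveMean k₁ x₁ < waveMean k₂ x₂ := by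
  have h₂ : 0 < x₂ := by linarith
  rcases h₁.eq_or_lt with rfl | h₁
  · rw [waveMean_zero_right]
    exact waveMean_pos k₂ h₂
  by_contra! hcon
  -- If the mean did not increase, neither the denominator of `waveTan` nor the factor `1 +
  -- waveInvMean` would move in the direction that lowers the phase.
  have b := waveInvMean_le_of_waveMean_le h₁ h hcon
  have a1 := waveMean_nonneg k₁ h₁.le
  have a2 := waveMean_nonneg k₂ h₂.le
  have b1 := waveInvMean_nonneg k₁ h₁.le
  have b2 := waveInvMean_nonneg k₂ h₂.le
  have hk : k₁ = 0 → k₂ = 0 := by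
    rintro rfl
    rw [waveTan_zero_left, waveTan, eq_comm, div_eq_zero_iff] at heq
    rcases heq with h | h
    · exact (mul_eq_zero.1 h).resolve_right (by positivity)
    · exact absurd h (by positivity)
  rcases hk₁.eq_or_lt with h0 | hk₁'
  · have h0' := hk h0.symm
    rw [h0', ← h0] at hcon
    exact absurd (waveMean_strictMonoOn 0 (mem_Ici.2 h₁.le) (mem_Ici.2 h₂.le) h) (not_lt.2 hcon)
  · have hklt : k₁ < k₂ := by
      have := waveTan_strictAntiOn hk₁' (mem_Ici.2 h₁.le) (mem_Ici.2 h₂.le) h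
      rw [heq] at this
      exact (waveTan_strictMonoOn h₂.le).lt_iff_lt hk₁ hk₂ |>.1 this
    have hn : k₁ * (1 + waveInvMean k₁ x₁) < k₂ * (1 + waveInvMean k₂ x₂) := by nlinarith
    refine absurd heq (ne_of_lt ?_)
    calc waveTan k₁ x₁ ≤ k₁ * (1 + waveInvMean k₁ x₁) / (2 + waveMean k₂ x₂) := by
          unfold waveTan
          gcongr
      _ < _ := by
          simp only [waveTan]
          gcongr

/-! ### Solving the phase equation for the speed. -/

theorem continuousOn_Ici_of_strictMonoOn {f : ℝ → ℝ} {a b : ℝ} (hf : StrictMonoOn f (Ici a))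
    (him : f '' Ici a = Ici b) : ContinuousOn f (Ici a) := by
  rw [continuousOn_iff_continuous_domRestrict]
  have hb : (Subtype.val ∘ (fun x : Ici a => (⟨f x, by rw [← him]; exact mem_image_of_mem f x.2⟩ : Ici b))) =
      (Ici a).domRestrict f := rfl
  rw [← hb]
  refine continuous_subtype_val.comp (Monotone.continuous_of_surjective ?_ ?_)
  · intro x y hxy
    exact hf.monotoneOn x.2 y.2 hxy
  · rintro ⟨y, hy⟩
    rw [← him] at hy
    obtain ⟨x, hx, rfl⟩ := hy
    exact ⟨⟨x, hx⟩, rfl⟩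

theorem invFunOn_strictMonoOn_Ici {f : ℝ → ℝ} {a b : ℝ} (hf : StrictMonoOn f (Ici a))
    (him : f '' Ici a = Ici b) : StrictMonoOn (Function.invFunOn f (Ici a)) (Ici b) := by
  intro x hx y hy hxy
  rw [← him] at hx hy
  refine (hf.lt_iff_lt (Function.invFunOn_mem hx) (Function.invFunOn_mem hy)).1 ?_
  rwa [Function.invFunOn_eq hx, Function.invFunOn_eq hy]

theorem invFunOn_image_Ici {f : ℝ → ℝ} {a b : ℝ} (hf : StrictMonoOn f (Ici a))
    (him : f '' Ici a = Ici b) : Function.invFunOn f (Ici a) '' Ici b = Ici a := by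
  rw [← him]
  exact hf.injOn.leftInvOn_invFunOn.image_image

theorem waveTan_exists {t x : ℝ} (ht : 0 ≤ t) (hx : 0 ≤ x) : ∃ k, 0 ≤ k ∧ waveTan k x = t := by
  obtain ⟨b, hb0, hb⟩ := ((eventually_ge_atTop (0 : ℝ)).and
    ((tendsto_waveTan_atTop hx).eventually_ge_atTop t)).exists
  have hc : ContinuousOn (fun k => waveTan k x) (Icc 0 b) :=
    continuousOn_waveTan.comp (f := fun k => (k, x)) (by fun_prop) fun k _ => ⟨mem_univ _, hx⟩
  obtain ⟨k, hk, hkt⟩ := intermediate_value_Icc hb0 hc (by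
    rw [waveTan_zero_left]
    exact ⟨ht, hb⟩ : t ∈ Icc _ _)
  exact ⟨k, hk.1, hkt⟩

open Classical in
/-- The nonnegative `k` with `waveTan k x = t`. -/
noncomputable def waveSpeed (t x : ℝ) : ℝ :=
  if h : ∃ k, 0 ≤ k ∧ waveTan k x = t then h.choose else 0

section waveSpeed

variable {t x : ℝ}

theorem waveSpeed_spec (ht : 0 ≤ t) (hx : 0 ≤ x) :
    0 ≤ waveSpeed t x ∧ waveTan (waveSpeed t x) x = t := by
  have h := waveTan_exists ht hx
  rw [waveSpeed, dif_pos h]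
  exact h.choose_spec

/-- Uniqueness holds among all real `k`, because a negative `k` gives a negative tangent. -/
theorem waveTan_eq_iff (ht : 0 ≤ t) (hx : 0 ≤ x) {k : ℝ} :
    waveTan k x = t ↔ k = waveSpeed t x := by
  obtain ⟨h0, h1⟩ := waveSpeed_spec ht hx
  refine ⟨fun h => ?_, fun h => by rw [h, h1]⟩
  rcases le_or_gt 0 k with hk | hk
  · exact (waveTan_strictMonoOn hx).injOn hk h0 (h.trans h1.symm)
  · exfalso
    have a := waveMean_nonneg k hx
    have b := waveInvMean_nonneg k hx
    have : waveTan k x < 0 := div_neg_of_neg_of_pos (mul_neg_of_neg_of_pos hk (by positivity))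
      (by positivity)
    linarith

theorem waveSpeed_zero_right (ht : 0 ≤ t) : waveSpeed t 0 = t :=
  ((waveTan_eq_iff ht le_rfl).1 (waveTan_zero_right t)).symm

theorem waveSpeed_zero_left (hx : 0 ≤ x) : waveSpeed 0 x = 0 :=
  ((waveTan_eq_iff le_rfl hx).1 (waveTan_zero_left x)).symm

theorem waveSpeed_pos (ht : 0 < t) (hx : 0 ≤ x) : 0 < waveSpeed t x := by
  obtain ⟨h0, h1⟩ := waveSpeed_spec ht.le hx
  refine h0.lt_of_ne fun h => ?_
  rw [← h, waveTan_zero_left] at h1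
  exact ht.ne h1

theorem waveSpeed_strictMonoOn (ht : 0 < t) : StrictMonoOn (waveSpeed t) (Ici 0) := by
  intro x₁ h₁ x₂ h₂ h
  have s₁ := waveSpeed_spec ht.le h₁
  have s₂ := waveSpeed_spec ht.le h₂
  have := waveTan_strictAntiOn (waveSpeed_pos ht h₁) h₁ h₂ h
  replace this := this.trans_eq (s₁.2.trans s₂.2.symm)
  exact ((waveTan_strictMonoOn h₂).lt_iff_lt s₁.1 s₂.1).1 this

/-- For fixed `k ≥ t`, the phase falls continuously from `k` at `x = 0` to `0` at infinity, so it
takes the value `t`. Continuity of `waveSpeed` then comes from monotonicity and surjectivity, with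
no implicit function theorem. -/
theorem waveSpeed_image (ht : 0 < t) : waveSpeed t '' Ici 0 = Ici t := by
  ext k
  constructor
  · rintro ⟨x, hx, rfl⟩
    have := (waveSpeed_strictMonoOn ht).monotoneOn self_mem_Ici hx hx
    rwa [waveSpeed_zero_right ht.le] at this
  · intro hk
    have hk0 : 0 < k := ht.trans_le hk
    obtain ⟨b, hb0, hb⟩ := ((eventually_ge_atTop (0 : ℝ)).and
      ((tendsto_waveTan_right hk0).eventually_le_const ht)).exists
    have hc : ContinuousOn (fun x => waveTan k x) (Icc 0 b) :=
      continuousOn_waveTan.comp (f := fun x => (k, x)) (by fun_prop)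
        fun x hx => ⟨mem_univ _, hx.1⟩
    obtain ⟨x, hx, hxt⟩ := intermediate_value_Icc' hb0 hc (by
      rw [waveTan_zero_right]
      exact ⟨hb, hk⟩ : t ∈ Icc _ _)
    exact ⟨x, hx.1, ((waveTan_eq_iff ht.le hx.1).1 hxt).symm⟩

theorem continuousOn_waveSpeed (ht : 0 ≤ t) : ContinuousOn (waveSpeed t) (Ici 0) := by
  rcases ht.eq_or_lt with rfl | ht
  · exact continuousOn_const.congr fun x hx => waveSpeed_zero_left hx
  · exact continuousOn_Ici_of_strictMonoOn (waveSpeed_strictMonoOn ht) (waveSpeed_image ht)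

end waveSpeed

/-! ### The branch for `α < π/2` and its inverse parametrization by `μ`. -/

/-- The speed along the nontrivial branch, as a function of `r`. -/
noncomputable def branchSpeed (α s : ℝ) : ℝ := waveSpeed (tan α) (s ^ 2 / 4)

/-- The parameter `μ` along the nontrivial branch, as a function of `r`. -/
noncomputable def branchParam (α s : ℝ) : ℝ :=
  (2 + waveMean (branchSpeed α s) (s ^ 2 / 4)) / cos α

/-- The modulus `r` along the nontrivial branch, as a function of `μ`. -/
noncomputable def branchRadius (α μ : ℝ) : ℝ := Function.invFunOn (branchParam α) (Ici 0) μ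

theorem calT_eq (k : ℝ) {r : ℝ} (hr : r ≠ 0) : calT 1 k r = waveTan k (r ^ 2 / 4) := by
  have hx : 0 ≤ r ^ 2 / 4 := by positivity
  have h1 := (waveModSq_pos k hx).ne'
  rw [calT, calC_eq k hr, calS_eq k hr, waveTan, div_div_div_cancel_right₀ h1]

theorem calC_sq_add_calS_sq (k : ℝ) {r : ℝ} (hr : r ≠ 0) :
    calC 1 k r ^ 2 + calS 1 k r ^ 2 = 1 / waveModSq k (r ^ 2 / 4) := by
  have hx : 0 ≤ r ^ 2 / 4 := by positivity
  have h1 := (waveModSq_pos k hx).ne'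
  rw [calC_eq k hr, calS_eq k hr, div_pow, div_pow, ← add_div, mul_pow, ← waveModSq]
  field_simp

theorem calC_pos (k : ℝ) {r : ℝ} (hr : r ≠ 0) : 0 < calC 1 k r := by
  have hx : 0 ≤ r ^ 2 / 4 := by positivity
  have h1 := waveModSq_pos k hx
  have h2 := waveMean_nonneg k hx
  rw [calC_eq k hr]
  positivity

theorem calC_neg_left (k : ℝ) {r : ℝ} (hr : r ≠ 0) : calC 1 (-k) r = calC 1 k r := by
  simp only [calC_eq _ hr, waveModSq, waveMean_neg, waveInvMean_neg, neg_sq]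

theorem calS_neg_left (k : ℝ) {r : ℝ} (hr : r ≠ 0) : calS 1 (-k) r = -calS 1 k r := by
  simp only [calS_eq _ hr, waveModSq, waveMean_neg, waveInvMean_neg, neg_sq]
  ring

theorem cartesianSystem_neg {α μ k r : ℝ} (hr : r ≠ 0) :
    CartesianSystem (π - α) (-μ) (-k) r ↔ CartesianSystem α μ k r := by
  simp only [CartesianSystem, calC_neg_left k hr, calS_neg_left k hr, cos_pi_sub, sin_pi_sub,
    div_neg, neg_div, neg_neg, neg_inj]

/-- `𝓒₁` is even and `𝓢₁` odd in `k`. The convention for `sgn` at `k = 0` is odd under the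
reflection precisely because `α ≠ π / 2`. -/
theorem polarSystem_neg {α μ k r : ℝ} (hα : α ≠ π / 2) (hr : r ≠ 0) :
    PolarSystem (π - α) (-μ) (-k) r ↔ PolarSystem α μ k r := by
  have hs : sgn (π - α) (-k) = -sgn α k := by
    unfold sgn
    rcases eq_or_ne k 0 with rfl | hk
    · rcases lt_or_gt_of_ne hα with h | h
      · rw [neg_zero, if_pos rfl, if_pos rfl, if_pos h, if_neg (by linarith)]
      · rw [neg_zero, if_pos rfl, if_pos rfl, if_pos (by linarith),
          if_neg (not_lt.2 h.le), neg_neg]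
    · rw [if_neg hk, if_neg (neg_ne_zero.2 hk), Real.sign_neg]
  simp only [PolarSystem, calR, calT, hs, calC_neg_left k hr, calS_neg_left k hr, tan_pi_sub,
    neg_sq, neg_mul, div_neg, neg_div, neg_inj]

theorem sgn_eq_one {α k : ℝ} (hα : α < π / 2) (hk : 0 ≤ k) : sgn α k = 1 := by
  unfold sgn
  split_ifs with h
  · rfl
  · exact Real.sign_of_pos (hk.lt_of_ne' h)

section Branch

variable {α : ℝ}

theorem cos_pos_of_mem (hα : α ∈ Ico 0 (π / 2)) : 0 < cos α :=
  cos_pos_of_mem_Ioo ⟨by linarith [hα.1, pi_pos], hα.2⟩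

theorem tan_nonneg_of_mem (hα : α ∈ Ico 0 (π / 2)) : 0 ≤ tan α :=
  tan_nonneg_of_nonneg_of_le_pi_div_two hα.1 hα.2.le

/-- On the level curve `k (1 + B) = tan α (2 + A)`, so the squared modulus is `(2 + A)² (1 + tan²
α)`. -/
theorem waveModSq_eq_of_waveTan {k x : ℝ} (hα : α ∈ Ico 0 (π / 2)) (hx : 0 ≤ x)
    (h : waveTan k x = tan α) : waveModSq k x = ((2 + waveMean k x) / cos α) ^ 2 := by
  have hc := (cos_pos_of_mem hα).ne'
  have ha := waveMean_nonneg k hx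
  have h2 : (2 + waveMean k x) ≠ 0 := by positivity
  rw [waveTan, tan_eq_sin_div_cos, div_eq_div_iff h2 hc] at h
  have h3 := sin_sq_add_cos_sq α
  rw [waveModSq, div_pow, eq_div_iff (by positivity)]
  have h4 : (k * (1 + waveInvMean k x) * cos α) ^ 2 = (sin α * (2 + waveMean k x)) ^ 2 := by rw [h]
  linear_combination h4 + (2 + waveMean k x) ^ 2 * h3

theorem polarSystem_iff {μ k r : ℝ} (hα : α ∈ Ico 0 (π / 2)) (hr : r ≠ 0) :
    PolarSystem α μ k r ↔ k = branchSpeed α |r| ∧ μ = branchParam α |r| := by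
  have hx : 0 ≤ r ^ 2 / 4 := by positivity
  have hc := cos_pos_of_mem hα
  rw [PolarSystem, calR, calC_sq_add_calS_sq k hr, calT_eq k hr, branchParam, branchSpeed, sq_abs,
    and_comm]
  rw [← waveTan_eq_iff (tan_nonneg_of_mem hα) hx]
  refine and_congr_right fun h => ?_
  have hk := (waveTan_eq_iff (tan_nonneg_of_mem hα) hx).1 h
  have hk0 := (waveSpeed_spec (tan_nonneg_of_mem hα) hx).1
  rw [← hk] at hk0 ⊢
  have ha := waveMean_nonneg k hx
  rw [sgn_eq_one hα.2 hk0, one_mul, waveModSq_eq_of_waveTan hα hx h, one_div, one_div,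
    sqrt_inv, sqrt_sq (by positivity), inv_inj, eq_comm]

theorem cartesianSystem_iff {μ k r : ℝ} (hα : α ∈ Ico 0 (π / 2)) (hr : r ≠ 0) :
    CartesianSystem α μ k r ↔ k = branchSpeed α |r| ∧ μ = branchParam α |r| := by
  have hx : 0 ≤ r ^ 2 / 4 := by positivity
  have hc := cos_pos_of_mem hα
  rw [branchParam, branchSpeed, sq_abs, ← waveTan_eq_iff (tan_nonneg_of_mem hα) hx]
  constructor
  · rintro ⟨h1, h2⟩
    have hC := calC_pos k hr
    -- Division by zero gives `0` here, which the positivity of `𝓒₁` rules out.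
    have hμ : μ ≠ 0 := by
      rintro rfl
      rw [div_zero] at h1
      exact hC.ne' h1
    have ht : waveTan k (r ^ 2 / 4) = tan α := by
      rw [← calT_eq k hr, calT, h1, h2, div_div_div_cancel_right₀ hμ, tan_eq_sin_div_cos]
    refine ⟨ht, ?_⟩
    rw [← (waveTan_eq_iff (tan_nonneg_of_mem hα) hx).1 ht]
    have ha := waveMean_nonneg k hx
    rw [calC_eq k hr, waveModSq_eq_of_waveTan hα hx ht] at h1
    field_simp at h1 ⊢
    linarith
  · rintro ⟨ht, hμ⟩
    rw [← (waveTan_eq_iff (tan_nonneg_of_mem hα) hx).1 ht] at hμ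
    have ha := waveMean_nonneg k hx
    have hC : calC 1 k r = cos α / μ := by
      rw [calC_eq k hr, waveModSq_eq_of_waveTan hα hx ht, hμ]
      field_simp
    refine ⟨hC, ?_⟩
    have h3 := calT_eq k hr
    rw [ht, calT, div_eq_iff (calC_pos k hr).ne', hC, tan_eq_sin_div_cos] at h3
    rw [h3]
    field_simp

theorem branchSpeed_zero (hα : α ∈ Ico 0 (π / 2)) : branchSpeed α 0 = tan α := by
  simp [branchSpeed, waveSpeed_zero_right (tan_nonneg_of_mem hα)]

theorem branchParam_zero (α : ℝ) : branchParam α 0 = muCrit α := by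
  simp [branchParam, muCrit, waveMean_zero_right]

theorem continuous_branchSpeed (hα : α ∈ Ico 0 (π / 2)) :
    Continuous (branchSpeed α) :=
  (continuousOn_waveSpeed (tan_nonneg_of_mem hα)).comp_continuous (by fun_prop)
    fun s => mem_Ici.2 (by positivity)

theorem continuous_branchParam (hα : α ∈ Ico 0 (π / 2)) : Continuous (branchParam α) := by
  refine (continuous_const.add (continuousOn_waveMean.comp_continuous
    (f := fun s => (branchSpeed α s, s ^ 2 / 4)) ?_ fun s => ⟨mem_univ _, ?_⟩)).div_const _
  · exact (continuous_branchSpeed hα).prodMk (by fun_prop)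
  · exact mem_Ici.2 (by positivity)

theorem sq_div_four_lt {s₁ s₂ : ℝ} (h₁ : 0 ≤ s₁) (h : s₁ < s₂) : s₁ ^ 2 / 4 < s₂ ^ 2 / 4 := by
  gcongr

theorem branchParam_strictMonoOn (hα : α ∈ Ico 0 (π / 2)) :
    StrictMonoOn (branchParam α) (Ici 0) := by
  intro s₁ h₁ s₂ h₂ h
  have hc := cos_pos_of_mem hα
  have p₁ := waveSpeed_spec (tan_nonneg_of_mem hα) (by positivity : 0 ≤ s₁ ^ 2 / 4)
  have p₂ := waveSpeed_spec (tan_nonneg_of_mem hα) (by positivity : 0 ≤ s₂ ^ 2 / 4)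
  have := waveMean_lt_of_waveTan_eq p₁.1 p₂.1 (by positivity) (sq_div_four_lt h₁ h)
    (p₁.2.trans p₂.2.symm)
  unfold branchParam branchSpeed
  gcongr

theorem tendsto_sq_div_four : Tendsto (fun s : ℝ => s ^ 2 / 4) atTop atTop :=
  (tendsto_pow_atTop two_ne_zero).atTop_div_const (by norm_num)

theorem waveSpeed_tendsto {t : ℝ} (ht : 0 < t) : Tendsto (waveSpeed t) atTop atTop := by
  refine tendsto_atTop.2 fun b => ?_
  obtain ⟨x, hx, hxb⟩ : max b t ∈ waveSpeed t '' Ici 0 := by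
    rw [waveSpeed_image ht]
    exact le_max_right b t
  filter_upwards [eventually_ge_atTop x] with y hy
  calc b ≤ max b t := le_max_left b t
    _ = waveSpeed t x := hxb.symm
    _ ≤ _ := (waveSpeed_strictMonoOn ht).monotoneOn hx (le_trans (mem_Ici.1 hx) hy) hy

theorem tendsto_branchSpeed (hα : α ∈ Ioo 0 (π / 2)) : Tendsto (branchSpeed α) atTop atTop :=
  (waveSpeed_tendsto (tan_pos_of_pos_of_lt_pi_div_two hα.1 hα.2)).comp tendsto_sq_div_four

/-- If `tan α = 0`, the speed is zero and the mean at `k = 0` diverges. Otherwise the phase equation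
gives `k / tan α ≤ 2 + waveMean`, and the speed diverges. -/
theorem tendsto_branchParam (hα : α ∈ Ico 0 (π / 2)) : Tendsto (branchParam α) atTop atTop := by
  refine Tendsto.atTop_div_const (cos_pos_of_mem hα) ?_
  refine tendsto_atTop_add_const_left _ _ ?_
  rcases (tan_nonneg_of_mem hα).eq_or_lt with h0 | ht
  · refine ((tendsto_waveMean_atTop 0).comp tendsto_sq_div_four).congr fun s => ?_
    rw [branchSpeed, ← h0, waveSpeed_zero_left (by positivity)]
    rfl
  · have h1 : Tendsto (fun s => branchSpeed α s / tan α + -2) atTop atTop :=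
      tendsto_atTop_add_const_right _ _
        (((waveSpeed_tendsto ht).comp tendsto_sq_div_four).atTop_div_const ht)
    refine tendsto_atTop_mono (fun s => ?_) h1
    have hx : 0 ≤ s ^ 2 / 4 := by positivity
    obtain ⟨p0, p1⟩ := waveSpeed_spec ht.le hx
    have a := waveMean_nonneg (waveSpeed (tan α) (s ^ 2 / 4)) hx
    have b := waveInvMean_nonneg (waveSpeed (tan α) (s ^ 2 / 4)) hx
    rw [waveTan, div_eq_iff (by positivity)] at p1
    have : branchSpeed α s / tan α ≤ 2 + waveMean (branchSpeed α s) (s ^ 2 / 4) := by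
      rw [div_le_iff₀ ht, branchSpeed]
      nlinarith
    linarith

theorem branchParam_image (hα : α ∈ Ico 0 (π / 2)) :
    branchParam α '' Ici 0 = Ici (muCrit α) := by
  ext μ
  constructor
  · rintro ⟨s, hs, rfl⟩
    rw [← branchParam_zero α]
    exact (branchParam_strictMonoOn hα).monotoneOn self_mem_Ici hs hs
  · intro hμ
    obtain ⟨b, hb0, hb⟩ := ((eventually_ge_atTop (0 : ℝ)).and
      ((tendsto_branchParam hα).eventually_ge_atTop μ)).exists
    obtain ⟨s, hs, hst⟩ := intermediate_value_Icc hb0 (continuous_branchParam hα).continuousOn (by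
      rw [branchParam_zero]
      exact ⟨hμ, hb⟩ : μ ∈ Icc _ _)
    exact ⟨s, hs.1, hst⟩

theorem branchRadius_strictMonoOn (hα : α ∈ Ico 0 (π / 2)) :
    StrictMonoOn (branchRadius α) (Ici (muCrit α)) :=
  invFunOn_strictMonoOn_Ici (branchParam_strictMonoOn hα) (branchParam_image hα)

theorem branchRadius_image (hα : α ∈ Ico 0 (π / 2)) :
    branchRadius α '' Ici (muCrit α) = Ici 0 :=
  invFunOn_image_Ici (branchParam_strictMonoOn hα) (branchParam_image hα)

theorem continuousOn_branchRadius (hα : α ∈ Ico 0 (π / 2)) :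
    ContinuousOn (branchRadius α) (Ici (muCrit α)) :=
  continuousOn_Ici_of_strictMonoOn (branchRadius_strictMonoOn hα) (branchRadius_image hα)

theorem branchParam_branchRadius (hα : α ∈ Ico 0 (π / 2)) {μ : ℝ} (hμ : muCrit α ≤ μ) :
    branchParam α (branchRadius α μ) = μ := by
  have : μ ∈ branchParam α '' Ici 0 := by rwa [branchParam_image hα]
  exact Function.invFunOn_eq this

theorem branchRadius_branchParam (hα : α ∈ Ico 0 (π / 2)) {s : ℝ} (hs : 0 ≤ s) :
    branchRadius α (branchParam α s) = s :=
  (branchParam_strictMonoOn hα).injOn.leftInvOn_invFunOn hs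

theorem branchRadius_muCrit (hα : α ∈ Ico 0 (π / 2)) : branchRadius α (muCrit α) = 0 := by
  rw [← branchParam_zero, branchRadius_branchParam hα le_rfl]

theorem branchRadius_pos (hα : α ∈ Ico 0 (π / 2)) {μ : ℝ} (hμ : muCrit α < μ) :
    0 < branchRadius α μ := by
  rw [← branchRadius_muCrit hα]
  exact branchRadius_strictMonoOn hα self_mem_Ici hμ.le hμ

theorem muCrit_le_branchParam (hα : α ∈ Ico 0 (π / 2)) {s : ℝ} (hs : 0 ≤ s) :
    muCrit α ≤ branchParam α s := by
  have : branchParam α s ∈ Ici (muCrit α) := by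
    rw [← branchParam_image hα]
    exact mem_image_of_mem _ hs
  exact this

theorem muCrit_lt_branchParam (hα : α ∈ Ico 0 (π / 2)) {s : ℝ} (hs : 0 < s) :
    muCrit α < branchParam α s := by
  rw [← branchParam_zero]
  exact branchParam_strictMonoOn hα self_mem_Ici hs.le hs

/-- The quotient `waveMean k x / x`, continuously extended to `x = 0`. -/
noncomputable def waveSlope (k x : ℝ) : ℝ :=
  (∑' m : ℕ, (m + 1) * waveWeight k (m + 1) * x ^ m) / waveMass k x

theorem succ_mul_waveWeight_succ_le (k : ℝ) (m : ℕ) :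
    |(m + 1) * waveWeight k (m + 1)| ≤ 16 * (4 ^ m / m.factorial) := by
  have hw := waveWeight_pos k (m + 1)
  have h := succ_mul_waveWeight_le k (m + 1)
  rw [abs_of_pos (by positivity)]
  calc (m + 1) * waveWeight k (m + 1) ≤ ((m + 1 : ℕ) + 1) * waveWeight k (m + 1) := by
        push_cast
        gcongr
        linarith
    _ ≤ 4 * (4 ^ (m + 1) / (m + 1).factorial) := h
    _ ≤ 4 * (4 ^ (m + 1) / m.factorial) := by
        gcongr
        omega
    _ = _ := by ring

theorem waveMean_eq_mul_waveSlope (k : ℝ) {x : ℝ} :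
    waveMean k x = x * waveSlope k x := by
  have hs := summable_mul_waveWeight abs_cast_le_succ k x
  rw [waveMean, waveSlope, waveSum, hs.tsum_eq_zero_add, ← mul_div_assoc, ← tsum_mul_left]
  congr 1
  simp only [Nat.cast_zero, zero_mul, zero_add]
  refine tsum_congr fun m => ?_
  push_cast
  ring

theorem continuousOn_waveSlope :
    ContinuousOn (fun p : ℝ × ℝ => waveSlope p.1 p.2) (univ ×ˢ Ici 0) :=
  (continuous_tsum_mul_pow (fun m => continuous_const.mul (continuous_waveWeight (m + 1)))
    (fun m k => succ_mul_waveWeight_succ_le k m)).continuousOn.div continuousOn_waveMass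
      fun p hp => (waveMass_pos p.1 hp.2).ne'

theorem waveSlope_zero_pos (k : ℝ) : 0 < waveSlope k 0 := by
  refine div_pos ?_ (waveMass_pos k le_rfl)
  rw [tsum_eq_single 0 fun m hm => by simp [hm]]
  simpa using waveWeight_pos k 1

theorem tendsto_branchRadius_nhdsGT (hα : α ∈ Ico 0 (π / 2)) :
    Tendsto (branchRadius α) (𝓝[>] (muCrit α)) (𝓝 0) := by
  have := (continuousOn_branchRadius hα) (muCrit α) self_mem_Ici
  rw [ContinuousWithinAt, branchRadius_muCrit hα] at this
  exact this.mono_left (nhdsWithin_mono _ Ioi_subset_Ici_self)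

/-- On the branch `μ - μ_α = waveMean / cos α = (r² / 4) waveSlope / cos α`. Since `k` varies too,
joint continuity of `waveSlope` is needed to pass to the limit at `(tan α, 0)`. -/
theorem branch_tangency (hα : α ∈ Ico 0 (π / 2)) :
    ∃ q > 0, Tendsto (fun μ => (μ - muCrit α) / branchRadius α μ ^ 2) (𝓝[>] (muCrit α)) (𝓝 q) := by
  have hc := cos_pos_of_mem hα
  refine ⟨waveSlope (tan α) 0 / (4 * cos α), by have := waveSlope_zero_pos (tan α); positivity, ?_⟩
  have hcont : Continuous fun s => waveSlope (branchSpeed α s) (s ^ 2 / 4) / (4 * cos α) :=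
    (continuousOn_waveSlope.comp_continuous (f := fun s => (branchSpeed α s, s ^ 2 / 4))
      ((continuous_branchSpeed hα).prodMk (by fun_prop))
      fun s => ⟨mem_univ _, mem_Ici.2 (by positivity)⟩).div_const _
  have h1 := (hcont.tendsto 0).comp (tendsto_branchRadius_nhdsGT hα)
  rw [branchSpeed_zero hα, zero_pow two_ne_zero, zero_div] at h1
  refine h1.congr' ?_
  filter_upwards [self_mem_nhdsWithin] with μ hμ
  have hs := branchRadius_pos hα hμ
  have h2 := branchParam_branchRadius hα (le_of_lt hμ)
  nth_rw 2 [← h2]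
  rw [branchParam, waveMean_eq_mul_waveSlope, muCrit]
  simp only [Function.comp_apply]
  field_simp
  ring

theorem reducedSol_iff (hα : α ∈ Ico 0 (π / 2)) {μ k r : ℝ} : ReducedSol α μ k r ↔
    r = 0 ∨ (k = branchSpeed α |r| ∧ μ = branchParam α |r|) := by
  rcases eq_or_ne r 0 with h | hr
  · simp [ReducedSol, h]
  · rw [ReducedSol, polarSystem_iff hα hr]

theorem branchSpeed_abs (α s : ℝ) : branchSpeed α |s| = branchSpeed α s := by
  rw [branchSpeed, sq_abs, branchSpeed]

theorem supercriticalPitchfork (hα : α ∈ Ico 0 (π / 2)) :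
    SupercriticalPitchfork (ReducedSol α) (muCrit α) (tan α)
      (fun μ => branchSpeed α (branchRadius α μ)) (branchRadius α) where
  k_start := by rw [branchRadius_muCrit hα, branchSpeed_zero hα]
  r_start := branchRadius_muCrit hα
  k_cont := (continuous_branchSpeed hα).comp_continuousOn (continuousOn_branchRadius hα)
  r_cont := continuousOn_branchRadius hα
  r_pos := fun μ hμ => branchRadius_pos hα hμ
  trivial_only := by
    intro μ hμ k r
    rw [reducedSol_iff hα]
    refine ⟨fun h => h.elim id fun h' => by_contra fun hr => ?_, Or.inl⟩
    exact absurd (h'.2 ▸ hμ) (not_le.2 (muCrit_lt_branchParam hα (abs_pos.2 hr)))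
  pair := by
    intro μ hμ k r
    rw [reducedSol_iff hα]
    refine or_congr_right ?_
    have hpos := branchRadius_pos hα hμ
    constructor
    · rintro ⟨h1, h2⟩
      have h3 := branchRadius_branchParam hα (abs_nonneg r)
      rw [← h2] at h3
      exact ⟨by rw [h1, h3], by rcases abs_choice r with h | h <;> [left; right] <;> linarith⟩
    · rintro ⟨h1, h2⟩
      have h3 : |r| = branchRadius α μ := by
        rcases h2 with h | h
        · rw [h, abs_of_pos hpos]
        · rw [h, abs_neg, abs_of_pos hpos]
      exact ⟨by rw [h1, h3], by rw [h3, branchParam_branchRadius hα hμ.le]⟩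
  tangency := branch_tangency hα

theorem branchCurve_eq (hα : α ∈ Ico 0 (π / 2)) :
    branchCurve (fun μ => branchSpeed α (branchRadius α μ)) (branchRadius α) (Ici (muCrit α)) =
      {p | ∃ s, 0 ≤ s ∧ (p = (branchSpeed α s, s) ∨ p = (branchSpeed α s, -s))} := by
  ext p
  constructor
  · rintro ⟨μ, hμ, h⟩
    have : branchRadius α μ ∈ Ici 0 := by
      rw [← branchRadius_image hα]
      exact mem_image_of_mem _ hμ
    exact ⟨branchRadius α μ, this, h⟩
  · rintro ⟨s, hs, h⟩
    refine ⟨branchParam α s, muCrit_le_branchParam hα hs, ?_⟩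
    simpa only [branchRadius_branchParam hα hs] using h

theorem nontrivialSols_eq (hα : α ∈ Ico 0 (π / 2)) : nontrivialSols α =
    {p | ∃ s, 0 < s ∧ (p = (branchSpeed α s, s) ∨ p = (branchSpeed α s, -s))} := by
  ext ⟨k, r⟩
  constructor
  · rintro ⟨hr, μ, h⟩
    change r ≠ 0 at hr
    obtain ⟨h1, -⟩ := (polarSystem_iff hα hr).1 h
    refine ⟨|r|, abs_pos.2 hr, ?_⟩
    change k = _ at h1
    rw [← h1]
    rcases abs_choice r with h | h <;> rw [h] <;> simp
  · rintro ⟨s, hs, h⟩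
    have hr : r ≠ 0 := by
      rcases h with h | h <;> simp only [Prod.mk.injEq] at h <;> rw [h.2]
      · exact hs.ne'
      · exact (neg_ne_zero.2 hs.ne')
    refine ⟨hr, branchParam α |r|, (polarSystem_iff hα hr).2 ⟨?_, rfl⟩⟩
    rcases h with h | h <;> simp only [Prod.mk.injEq] at h <;> rw [branchSpeed_abs] <;>
      simp [h.1, h.2, branchSpeed]

theorem sq_div_four_image : (fun s : ℝ => s ^ 2 / 4) '' Ici 0 = Ici 0 := by
  ext x
  constructor
  · rintro ⟨s, -, rfl⟩
    exact mem_Ici.2 (by positivity)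
  · intro hx
    refine ⟨2 * √x, mem_Ici.2 (by positivity), ?_⟩
    simp only [mul_pow, sq_sqrt (mem_Ici.1 hx)]
    ring

theorem branchSpeed_strictMonoOn (hα : α ∈ Ioo 0 (π / 2)) :
    StrictMonoOn (branchSpeed α) (Ici 0) := by
  intro s₁ h₁ s₂ h₂ h
  exact waveSpeed_strictMonoOn (tan_pos_of_pos_of_lt_pi_div_two hα.1 hα.2)
    (mem_Ici.2 (by positivity)) (mem_Ici.2 (by positivity)) (sq_div_four_lt h₁ h)

theorem branchSpeed_bijOn (hα : α ∈ Ioo 0 (π / 2)) :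
    BijOn (branchSpeed α) (Ici 0) (Ici (tan α)) := by
  have him : branchSpeed α '' Ici 0 = Ici (tan α) := by
    have : branchSpeed α = waveSpeed (tan α) ∘ fun s => s ^ 2 / 4 := rfl
    rw [this, image_comp, sq_div_four_image,
      waveSpeed_image (tan_pos_of_pos_of_lt_pi_div_two hα.1 hα.2)]
  rw [← him]
  exact (branchSpeed_strictMonoOn hα).injOn.bijOn_image

theorem branchSpeed_zero_left (s : ℝ) : branchSpeed 0 s = 0 := by
  rw [branchSpeed, tan_zero, waveSpeed_zero_left (by positivity)]

theorem tan_lt_branchSpeed (hα : α ∈ Ioo 0 (π / 2)) {s : ℝ} (hs : 0 < s) :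
    tan α < branchSpeed α s := by
  rw [← branchSpeed_zero ⟨hα.1.le, hα.2⟩]
  exact branchSpeed_strictMonoOn hα self_mem_Ici hs.le hs

theorem tendsto_branchRadius_atTop (hα : α ∈ Ico 0 (π / 2)) :
    Tendsto (branchRadius α) atTop atTop := by
  refine tendsto_atTop.2 fun b => ?_
  filter_upwards [eventually_ge_atTop (branchParam α (max b 0))] with μ hμ
  have h0 := muCrit_le_branchParam hα (le_max_right b 0)
  have := (branchRadius_strictMonoOn hα).monotoneOn h0 (h0.trans hμ) hμ
  rw [branchRadius_branchParam hα (le_max_right b 0)] at this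
  exact (le_max_left b 0).trans this

end Branch

/-! ### Positivity, regularity and uniqueness for the linear profile equation. -/

theorem chiFactor_pos (k : ℝ) : 0 < chiFactor k := by
  have hπ := pi_pos
  unfold chiFactor
  split_ifs with h
  · positivity
  · rcases lt_or_gt_of_ne h with h | h
    · refine div_pos_of_neg_of_neg h (sub_neg.2 (one_lt_exp_iff.2 ?_))
      have : 2 * π * k < 0 := mul_neg_of_pos_of_neg (by positivity) h
      linarith
    · have h2 : 0 < 2 * π * k := by positivity
      refine div_pos h (sub_pos.2 ?_)
      rw [← exp_zero]
      exact exp_lt_exp.2 (by linarith)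

theorem chi_pos (k r φ : ℝ) : 0 < chi k r φ := by
  refine mul_pos (chiFactor_pos k) (intervalIntegral.intervalIntegral_pos_of_pos
    (Continuous.intervalIntegrable (by fun_prop) _ _) (fun s => by positivity) two_pi_pos)

theorem chi_neg_right (k r φ : ℝ) : chi k (-r) φ = chi k r (φ + π) := by
  have h : ∀ s, cos (φ + π - s) = -cos (φ - s) := fun s => by
    rw [show φ + π - s = φ - s + π by ring, cos_add_pi]
  simp only [chi, h, cos_add_pi, mul_neg, neg_mul]

theorem Ccoef_zero_neg_right (k r : ℝ) : Ccoef 0 k (-r) = Ccoef 0 k r :=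
  (hasSum_Ccoef_zero k (-r)).unique (by simpa only [neg_sq] using hasSum_Ccoef_zero k r)

theorem continuous_chi (k r : ℝ) : Continuous (chi k r) :=
  continuous_iff_continuousAt.2 fun φ => (chi_ode k r φ).continuousAt

theorem contDiff_chi (k r : ℝ) : ContDiff ℝ 2 (chi k r) := by
  have hd : deriv (chi k r) = fun φ => k - (r * sin φ + k) * chi k r φ :=
    funext fun φ => (chi_ode k r φ).deriv
  have hdiff : Differentiable ℝ (chi k r) := fun φ => (chi_ode k r φ).differentiableAt
  have step : ∀ n : ℕ, ContDiff ℝ n (chi k r) → ContDiff ℝ (n + 1) (chi k r) := by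
    intro n hn
    refine contDiff_succ_iff_deriv.2 ⟨hdiff, fun h => by simp at h, ?_⟩
    rw [hd]
    fun_prop
  have h1 := step 0 (contDiff_zero.2 (continuous_chi k r))
  have h2 := step 1 (by simpa using h1)
  convert h2 using 1
  norm_num

/-- The periodic solutions of the linear equation behind `chi`, with an arbitrary right-hand
side, are multiples of `chi`. -/
theorem exists_eq_smul_chi {k r c : ℝ} {f : ℝ → ℝ} (hp : Function.Periodic f (2 * π))
    (hf : ∀ φ, HasDerivAt f (c - (r * sin φ + k) * f φ) φ) :
    ∃ a, c = a * k ∧ f = fun φ => a * chi k r φ := by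
  -- This `a` makes `f - a χ` vanish at `0`, hence at `2π`. With the integrating factor its
  -- derivative is `c - a k` times a positive function, so both `c = a k` and `f = a χ` follow; in
  -- particular `c = 0` when `k = 0`.
  set a := f 0 / chi k r 0 with ha
  have ha0 : f 0 - a * chi k r 0 = 0 := by
    rw [ha, div_mul_cancel₀ _ (chi_pos k r 0).ne', sub_self]
  set g : ℝ → ℝ := fun y => exp (k * y - r * cos y) * (f y - a * chi k r y) with hg
  have hd : ∀ y, HasDerivAt g ((c - a * k) * exp (k * y - r * cos y)) y := fun y => by
    have h1 : HasDerivAt (fun y => exp (k * y - r * cos y))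
        (exp (k * y - r * cos y) * (k * 1 - r * -sin y)) y :=
      (((hasDerivAt_id y).const_mul k).sub ((hasDerivAt_cos y).const_mul r)).exp
    refine (h1.mul ((hf y).sub ((chi_ode k r y).const_mul a))).congr_deriv ?_
    simp only [Pi.sub_apply]
    ring
  have hg0 : g 0 = 0 := by simp only [hg, ha0, mul_zero]
  have hg1 : g (2 * π) = 0 := by
    have h1 := hp 0
    have h2 := chi_periodic k r 0
    rw [zero_add] at h1 h2
    simp only [hg, h1, h2, ha0, mul_zero]
  have hint := intervalIntegral.integral_eq_sub_of_hasDerivAt (a := 0) (b := 2 * π)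
    (fun y _ => hd y) (Continuous.intervalIntegrable (by fun_prop) _ _)
  rw [hg0, hg1, sub_zero, intervalIntegral.integral_const_mul] at hint
  have hpos : 0 < ∫ y in (0 : ℝ)..(2 * π), exp (k * y - r * cos y) :=
    intervalIntegral.intervalIntegral_pos_of_pos
      (Continuous.intervalIntegrable (by fun_prop) _ _) (fun s => by positivity) two_pi_pos
  have hc : c - a * k = 0 := (mul_eq_zero.1 hint).resolve_right hpos.ne'
  refine ⟨a, sub_eq_zero.1 hc, ?_⟩
  simp only [hc, zero_mul] at hd
  have hconst : ∀ x y, g x = g y :=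
    is_const_of_deriv_eq_zero (fun y => (hd y).differentiableAt) fun y => (hd y).deriv
  funext φ
  have h := hconst φ 0
  rw [hg0] at h
  exact sub_eq_zero.1 ((mul_eq_zero.1 h).resolve_left (exp_pos _).ne')

/-! ### First harmonics, self-consistency and traveling waves. -/

theorem deriv_W (α : ℝ) : deriv (W α) = fun θ => sin (θ - α) := by
  funext θ
  have h := ((hasDerivAt_cos (θ - α)).comp_sub_const θ α).neg
  rw [neg_neg] at h
  exact h.deriv

theorem integral_cos_sin_comb {ρ : ℝ → ℝ}
    (hρ : IntervalIntegrable ρ MeasureTheory.volume (-π) π) (a b : ℝ) :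
    ∫ η in (-π)..π, (a * cos η + b * sin η) * ρ η =
      a * (∫ η in (-π)..π, cos η * ρ η) + b * ∫ η in (-π)..π, sin η * ρ η := by
  have hc : IntervalIntegrable (fun η => cos η * ρ η) MeasureTheory.volume (-π) π :=
    hρ.continuousOn_mul (by fun_prop)
  have hs : IntervalIntegrable (fun η => sin η * ρ η) MeasureTheory.volume (-π) π :=
    hρ.continuousOn_mul (by fun_prop)
  rw [← intervalIntegral.integral_const_mul, ← intervalIntegral.integral_const_mul,
    ← intervalIntegral.integral_add (hc.const_mul a) (hs.const_mul b)]
  refine intervalIntegral.integral_congr fun η _ => ?_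
  ring

theorem circConv_deriv_W {ρ : ℝ → ℝ} (hρ : IntervalIntegrable ρ MeasureTheory.volume (-π) π)
    (α θ : ℝ) : circConv (deriv (W α)) ρ θ =
      sin (θ - α) * (∫ η in (-π)..π, cos η * ρ η) - cos (θ - α) * ∫ η in (-π)..π, sin η * ρ η := by
  have h := integral_cos_sin_comb hρ (sin (θ - α)) (-cos (θ - α))
  rw [circConv, deriv_W, sub_eq_add_neg, ← neg_mul, ← h]
  refine intervalIntegral.integral_congr fun η _ => ?_
  simp only
  rw [show θ - η - α = (θ - α) - η by ring, sin_sub]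
  ring

theorem circConv_W {ρ : ℝ → ℝ} (hρ : IntervalIntegrable ρ MeasureTheory.volume (-π) π)
    (α θ : ℝ) : circConv (W α) ρ θ =
      -(cos (θ - α) * (∫ η in (-π)..π, cos η * ρ η) +
        sin (θ - α) * ∫ η in (-π)..π, sin η * ρ η) := by
  have h := integral_cos_sin_comb hρ (-cos (θ - α)) (-sin (θ - α))
  rw [circConv, neg_add, ← neg_mul, ← neg_mul, ← h]
  refine intervalIntegral.integral_congr fun η _ => ?_
  simp only [W]
  rw [show θ - η - α = (θ - α) - η by ring, cos_sub]
  ring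

theorem integral_comp_sub_of_periodic {F : ℝ → ℝ} (hF : Function.Periodic F (2 * π)) (β : ℝ) :
    ∫ η in (-π)..π, F (η - β) = ∫ φ in (-π)..π, F φ := by
  rw [intervalIntegral.integral_comp_sub_right]
  have h := hF.intervalIntegral_add_eq (-π - β) (-π)
  rwa [show -π - β + 2 * π = π - β by ring, show -π + 2 * π = π by ring] at h

theorem integral_cos_mul_shift {g : ℝ → ℝ} (hg : Function.Periodic g (2 * π))
    (hi : IntervalIntegrable g MeasureTheory.volume (-π) π) (β : ℝ) :
    ∫ η in (-π)..π, cos η * g (η - β) =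
      cos β * (∫ φ in (-π)..π, cos φ * g φ) - sin β * ∫ φ in (-π)..π, sin φ * g φ := by
  have h := integral_comp_sub_of_periodic (F := fun φ => cos (φ + β) * g φ) (fun φ => by
    simp only [hg φ, show φ + 2 * π + β = φ + β + 2 * π by ring, cos_add_two_pi]) β
  simp only [sub_add_cancel] at h
  rw [h, sub_eq_add_neg, ← neg_mul, ← integral_cos_sin_comb hi]
  refine intervalIntegral.integral_congr fun η _ => ?_
  simp only [cos_add]
  ring

theorem integral_sin_mul_shift {g : ℝ → ℝ} (hg : Function.Periodic g (2 * π))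
    (hi : IntervalIntegrable g MeasureTheory.volume (-π) π) (β : ℝ) :
    ∫ η in (-π)..π, sin η * g (η - β) =
      sin β * (∫ φ in (-π)..π, cos φ * g φ) + cos β * ∫ φ in (-π)..π, sin φ * g φ := by
  have h := integral_comp_sub_of_periodic (F := fun φ => sin (φ + β) * g φ) (fun φ => by
    simp only [hg φ, show φ + 2 * π + β = φ + β + 2 * π by ring, sin_add_two_pi]) β
  simp only [sub_add_cancel] at h
  rw [h, ← integral_cos_sin_comb hi]
  refine intervalIntegral.integral_congr fun η _ => ?_
  simp only [sin_add]
  ring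

theorem avm_periodic (k r : ℝ) : Function.Periodic (avm k r) (2 * π) := fun φ => by
  rw [avm, avm, chi_periodic k r φ]

theorem avm_neg_right (k r φ : ℝ) : avm k (-r) φ = avm k r (φ + π) := by
  rw [avm, avm, chi_neg_right, Ccoef_zero_neg_right]

theorem contDiff_avm (k r : ℝ) : ContDiff ℝ 2 (avm k r) := (contDiff_chi k r).div_const _

theorem hasDerivAt_avm (k r φ : ℝ) : HasDerivAt (avm k r)
    (k / (2 * π * Ccoef 0 k r) - (r * sin φ + k) * avm k r φ) φ := by
  refine ((chi_ode k r φ).div_const _).congr_deriv ?_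
  rw [avm]
  ring

theorem isCircleDensity_avm (k r β : ℝ) : IsCircleDensity fun θ => avm k r (θ - β) where
  periodic := fun θ => by
    simp only [show θ + 2 * π - β = θ - β + 2 * π by ring, avm_periodic k r (θ - β)]
  nonneg := fun θ => by
    have h1 := chi_pos k r (θ - β)
    have h2 := Ccoef_zero_pos k r
    have h3 := pi_pos
    unfold avm
    positivity
  integrable := by
    refine Continuous.intervalIntegrable ?_ _ _
    exact (contDiff_avm k r).continuous.comp (by fun_prop)
  mass := by
    have h2 := (Ccoef_zero_pos k r).ne'
    have h3 := pi_pos.ne'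
    rw [integral_comp_sub_of_periodic (avm_periodic k r)]
    unfold avm
    rw [intervalIntegral.integral_div, div_eq_one_iff_eq (by positivity)]
    simp only [Ccoef, Int.cast_zero, zero_mul, cos_zero, one_mul]
    field_simp

theorem integrable_avm (k r : ℝ) : IntervalIntegrable (avm k r) MeasureTheory.volume (-π) π :=
  (contDiff_avm k r).continuous.intervalIntegrable _ _

theorem integral_cos_mul_avm (k : ℝ) {r : ℝ} (hr : r ≠ 0) :
    ∫ φ in (-π)..π, cos φ * avm k r φ = r * calC 1 k r := by
  have h2 := (Ccoef_zero_pos k r).ne'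
  have h3 := pi_pos.ne'
  have h : ∀ φ, cos φ * avm k r φ = (cos φ * chi k r φ) / (2 * π * Ccoef 0 k r) := fun φ => by
    rw [avm, mul_div_assoc]
  simp only [h]
  have h1 : Ccoef 1 k r = 1 / (2 * π) * ∫ φ in (-π)..π, cos φ * chi k r φ := by
    simp only [Ccoef, Int.cast_one, one_mul]
  rw [intervalIntegral.integral_div, calC, h1]
  field_simp

theorem integral_sin_mul_avm (k : ℝ) {r : ℝ} (hr : r ≠ 0) :
    ∫ φ in (-π)..π, sin φ * avm k r φ = -(r * calS 1 k r) := by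
  have h2 := (Ccoef_zero_pos k r).ne'
  have h3 := pi_pos.ne'
  have h : ∀ φ, sin φ * avm k r φ = (sin φ * chi k r φ) / (2 * π * Ccoef 0 k r) := fun φ => by
    rw [avm, mul_div_assoc]
  simp only [h]
  have h1 : Scoef 1 k r = 1 / (2 * π) * ∫ φ in (-π)..π, sin φ * chi k r φ := by
    simp only [Scoef, Int.cast_one, one_mul]
  rw [intervalIntegral.integral_div, calS, h1]
  field_simp

section Coherent

variable {α μ k r : ℝ}

theorem CartesianSystem.mu_ne_zero (h : CartesianSystem α μ k r) (hr : r ≠ 0) : μ ≠ 0 := by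
  rintro rfl
  have h1 := h.1
  rw [div_zero] at h1
  exact (calC_pos k hr).ne' h1

/-- The Cartesian system makes the phase of the first harmonic of `avm` cancel the shift `α`, so the
field times `μ` is the `r sin φ` assumed in the profile equation. -/
theorem circConv_deriv_W_avm (h : CartesianSystem α μ k r) (hr : r ≠ 0) (β θ : ℝ) :
    circConv (deriv (W α)) (fun θ => avm k r (θ - β)) θ = r / μ * sin (θ - β) := by
  have hp := avm_periodic k r
  have hi := integrable_avm k r
  rw [circConv_deriv_W (isCircleDensity_avm k r β).integrable, integral_cos_mul_shift hp hi,
    integral_sin_mul_shift hp hi, integral_cos_mul_avm k hr, integral_sin_mul_avm k hr, h.1, h.2]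
  obtain ⟨ψ, rfl⟩ : ∃ ψ, θ = ψ + α + β := ⟨θ - β - α, by ring⟩
  rw [show ψ + α + β - α = ψ + β by ring, add_sub_cancel_right, sin_add, cos_add, sin_add]
  linear_combination (sin ψ * (r * (cos α / μ)) + cos ψ * (r * (sin α / μ))) *
    sin_sq_add_cos_sq β

theorem circConv_W_avm (h : CartesianSystem α μ k r) (hr : r ≠ 0) (β θ : ℝ) :
    circConv (W α) (fun θ => avm k r (θ - β)) θ = -(r / μ * cos (θ - β)) := by
  have hp := avm_periodic k r
  have hi := integrable_avm k r
  rw [circConv_W (isCircleDensity_avm k r β).integrable, integral_cos_mul_shift hp hi,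
    integral_sin_mul_shift hp hi, integral_cos_mul_avm k hr, integral_sin_mul_avm k hr, h.1, h.2]
  obtain ⟨ψ, rfl⟩ : ∃ ψ, θ = ψ + α + β := ⟨θ - β - α, by ring⟩
  rw [show ψ + α + β - α = ψ + β by ring, add_sub_cancel_right, cos_add, sin_add, cos_add]
  linear_combination (-(cos ψ * (r * (cos α / μ))) + sin ψ * (r * (sin α / μ))) *
    sin_sq_add_cos_sq β

theorem isTravelingWave_avm (h : CartesianSystem α μ k r) (hr : r ≠ 0) (β : ℝ) :
    IsTravelingWave α μ k (k / (2 * π * Ccoef 0 k r)) fun θ => avm k r (θ - β) where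
  density := isCircleDensity_avm k r β
  differentiable := fun θ => ((hasDerivAt_avm k r (θ - β)).comp_sub_const θ β).differentiableAt
  equation := fun θ => by
    have hμ := h.mu_ne_zero hr
    rw [circConv_deriv_W_avm h hr, ((hasDerivAt_avm k r (θ - β)).comp_sub_const θ β).deriv]
    field_simp
    ring

theorem isMcKeanVlasovSolution_avm (h : CartesianSystem α μ k r) (hr : r ≠ 0) (β : ℝ) :
    IsMcKeanVlasovSolution α μ fun t θ => avm k r (θ - β - k * t) where
  density := fun t => by
    simpa only [sub_sub] using isCircleDensity_avm k r (β + k * t)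
  smooth := by
    have : (Function.uncurry fun t θ => avm k r (θ - β - k * t)) =
      avm k r ∘ fun p : ℝ × ℝ => p.2 - β - k * p.1 := rfl
    rw [this]
    exact (contDiff_avm k r).comp (by fun_prop)
  equation := fun t θ => by
    have hμ := h.mu_ne_zero hr
    set c := k / (2 * π * Ccoef 0 k r) with hc
    have hsub : ∀ θ, θ - β - k * t = θ - (β + k * t) := fun θ => by ring
    have ha : ∀ θ, HasDerivAt (fun θ => avm k r (θ - (β + k * t)))
        (c - (r * sin (θ - (β + k * t)) + k) * avm k r (θ - (β + k * t))) θ := fun θ =>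
      (hasDerivAt_avm k r _).comp_sub_const θ _
    have hsin : ∀ θ, HasDerivAt (fun θ => sin (θ - (β + k * t))) (cos (θ - (β + k * t))) θ :=
      fun θ => (hasDerivAt_sin _).comp_sub_const θ _
    have hcos : ∀ θ, HasDerivAt (fun θ => -(r / μ * cos (θ - (β + k * t))))
        (-(r / μ * -sin (θ - (β + k * t)))) θ :=
      fun θ => (((hasDerivAt_cos _).comp_sub_const θ _).const_mul _).neg
    have ht : HasDerivAt (fun s => avm k r (θ - β - k * s))
        ((c - (r * sin (θ - β - k * t) + k) * avm k r (θ - β - k * t)) * -(k * 1)) t :=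
      HasDerivAt.comp (h := fun s => θ - β - k * s) t (hasDerivAt_avm k r (θ - β - k * t))
        (((hasDerivAt_id' t).const_mul k).const_sub (θ - β))
    have hd1 : deriv (fun θ => avm k r (θ - (β + k * t))) = fun θ =>
        c - (r * sin (θ - (β + k * t)) + k) * avm k r (θ - (β + k * t)) :=
      funext fun θ => (ha θ).deriv
    have hd2 : HasDerivAt (fun θ =>
        c - (r * sin (θ - (β + k * t)) + k) * avm k r (θ - (β + k * t)))
        (-(r * cos (θ - (β + k * t)) * avm k r (θ - (β + k * t)) +
          (r * sin (θ - (β + k * t)) + k) *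
            (c - (r * sin (θ - (β + k * t)) + k) * avm k r (θ - (β + k * t))))) θ :=
      ((((hsin θ).const_mul r).add_const k).mul (ha θ)).const_sub c
    have hW : circConv (W α) (fun θ => avm k r (θ - (β + k * t))) =
        fun θ => -(r / μ * cos (θ - (β + k * t))) := funext fun θ => circConv_W_avm h hr _ θ
    have hd3 : ∀ η, deriv (fun θ => -(r / μ * cos (θ - (β + k * t)))) η =
        r / μ * sin (η - (β + k * t)) := fun η => by
      rw [(hcos η).deriv, mul_neg, neg_neg]
    have hd4 : HasDerivAt (fun η => avm k r (η - (β + k * t)) * (r / μ * sin (η - (β + k * t))))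
        ((c - (r * sin (θ - (β + k * t)) + k) * avm k r (θ - (β + k * t))) *
          (r / μ * sin (θ - (β + k * t))) +
          avm k r (θ - (β + k * t)) * (r / μ * cos (θ - (β + k * t)))) θ :=
      (ha θ).mul ((hsin θ).const_mul _)
    rw [ht.deriv]
    simp only [hsub]
    rw [hd1, hW, hd2.deriv]
    simp only [hd3]
    rw [hd4.deriv]
    field_simp
    ring

/-- The first cosine moment is `r 𝓒₁ ≠ 0`, whereas that of a constant vanishes. -/
theorem avm_ne_incoherent (k : ℝ) {r : ℝ} (hr : r ≠ 0) :
    avm k r ≠ incoherent := by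
  intro heq
  have h1 := integral_cos_mul_avm k hr
  rw [heq] at h1
  simp only [incoherent] at h1
  rw [intervalIntegral.integral_mul_const, integral_cos] at h1
  simp at h1
  exact h1.elim hr (calC_pos k hr).ne'

end Coherent

theorem isTravelingWave_incoherent (α μ k : ℝ) :
    IsTravelingWave α μ k (k / (2 * π)) incoherent where
  density :=
    { periodic := fun _ => rfl
      nonneg := fun _ => by
        have := pi_pos
        unfold incoherent
        positivity
      integrable := intervalIntegrable_const
      mass := by
        have := pi_pos.ne'
        simp only [incoherent, intervalIntegral.integral_const, smul_eq_mul]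
        field_simp
        ring }
  differentiable := differentiable_const _
  equation := fun θ => by
    have hi : IntervalIntegrable incoherent MeasureTheory.volume (-π) π :=
      intervalIntegrable_const
    have hd : deriv incoherent θ = 0 := deriv_const θ _
    rw [circConv_deriv_W hi, hd]
    simp [incoherent]
    ring

/-- Every traveling wave is incoherent or is given by a nontrivial solution of the reduced
system. -/
theorem IsTravelingWave.classify {α μ k c : ℝ} {ρ : ℝ → ℝ} (h : IsTravelingWave α μ k c ρ) :
    (ρ = incoherent ∧ c = k / (2 * π)) ∨ ∃ r θ₀ : ℝ, r ≠ 0 ∧ CartesianSystem α μ k r ∧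
      c = k / (2 * π * Ccoef 0 k r) ∧ ρ = fun θ => avm k r (θ - θ₀ - α) := by
  have hπ := pi_pos
  have hi := h.density.integrable
  -- The complex order parameter: its argument gives the rotation `θ₀`, and its modulus `a` gives `r
  -- = μ a`, which is negative when `μ < 0` and `a > 0`.
  set z : ℂ := ⟨∫ η in (-π)..π, cos η * ρ η, ∫ η in (-π)..π, sin η * ρ η⟩ with hz
  set a := ‖z‖ with ha
  set θ₀ := z.arg with hθ
  have hre : ∫ η in (-π)..π, cos η * ρ η = a * cos θ₀ := (Complex.norm_mul_cos_arg z).symm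
  have him : ∫ η in (-π)..π, sin η * ρ η = a * sin θ₀ := (Complex.norm_mul_sin_arg z).symm
  set f : ℝ → ℝ := fun φ => ρ (φ + (θ₀ + α)) with hf
  have hρf : ρ = fun θ => f (θ - θ₀ - α) := by
    funext θ
    simp only [hf]
    ring_nf
  have hfp : Function.Periodic f (2 * π) := fun φ => by
    simp only [hf, show φ + 2 * π + (θ₀ + α) = φ + (θ₀ + α) + 2 * π by ring, h.density.periodic _]
  have hfd : ∀ φ, HasDerivAt f (c - (μ * a * sin φ + k) * f φ) φ := by
    intro φ
    have h1 := (h.differentiable (φ + (θ₀ + α))).hasDerivAt.comp_add_const φ (θ₀ + α)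
    refine h1.congr_deriv ?_
    have h2 := h.equation (φ + (θ₀ + α))
    rw [circConv_deriv_W hi, hre, him] at h2
    have e : sin φ = sin (φ + θ₀ - θ₀) := by ring_nf
    rw [show φ + (θ₀ + α) - α = φ + θ₀ by ring] at h2
    rw [e, sin_sub]
    simp only [hf]
    linarith
  obtain ⟨b, hb, hfb⟩ := exists_eq_smul_chi hfp hfd
  have hmass : b * (2 * π * Ccoef 0 k (μ * a)) = 1 := by
    have h1 := h.density.mass
    have h2 := integral_comp_sub_of_periodic hfp (θ₀ + α)
    have h3 : ∀ η, f (η - (θ₀ + α)) = ρ η := fun η => by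
      rw [hρf]
      ring_nf
    simp only [h3] at h2
    rw [h1, hfb, intervalIntegral.integral_const_mul] at h2
    rw [h2, Ccoef]
    simp only [Int.cast_zero, zero_mul, cos_zero, one_mul]
    field_simp
  have hC := Ccoef_zero_pos k (μ * a)
  have hbe : b = 1 / (2 * π * Ccoef 0 k (μ * a)) := by
    rw [eq_div_iff (by positivity)]
    exact hmass
  have hfa : f = avm k (μ * a) := by
    rw [hfb]
    funext φ
    rw [avm, hbe]
    ring
  have hce : c = k / (2 * π * Ccoef 0 k (μ * a)) := by
    rw [hb, hbe]
    ring
  rcases eq_or_ne (μ * a) 0 with h0 | hr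
  · left
    have hC1 : Ccoef 0 k 0 = 1 := by
      simp only [Ccoef, chi_zero_right]
      simp
      field_simp
      ring
    rw [h0, hC1, mul_one] at hce
    refine ⟨?_, hce⟩
    rw [hρf, hfa, h0]
    funext θ
    rw [avm, chi_zero_right, hC1, mul_one, incoherent]
  · right
    refine ⟨μ * a, θ₀, hr, ?_, hce, by rw [hρf, hfa]⟩
    have hp := avm_periodic k (μ * a)
    have hia := integrable_avm k (μ * a)
    have hρ' : ∀ η, ρ η = avm k (μ * a) (η - (θ₀ + α)) := fun η => by
      rw [hρf, hfa]
      ring_nf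
    have e1 := hre
    have e2 := him
    simp only [hρ'] at e1 e2
    rw [integral_cos_mul_shift hp hia, integral_cos_mul_avm k hr, integral_sin_mul_avm k hr] at e1
    rw [integral_sin_mul_shift hp hia, integral_cos_mul_avm k hr, integral_sin_mul_avm k hr] at e2
    have ha0 : a ≠ 0 := right_ne_zero_of_mul hr
    have hμ0 : μ ≠ 0 := left_ne_zero_of_mul hr
    set P := calC 1 k (μ * a)
    set Q := calS 1 k (μ * a)
    -- Dividing self-consistency by `a` leaves `μ (P, Q)` rotated; undoing the rotation by `θ₀ + α`
    -- yields `(cos α, sin α)`.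
    have e1' : μ * (cos (θ₀ + α) * P + sin (θ₀ + α) * Q) = cos θ₀ :=
      mul_left_cancel₀ ha0 (by linear_combination e1)
    have e2' : μ * (sin (θ₀ + α) * P - cos (θ₀ + α) * Q) = sin θ₀ :=
      mul_left_cancel₀ ha0 (by linear_combination e2)
    have hs := sin_sq_add_cos_sq (θ₀ + α)
    have hca : cos α = cos (θ₀ + α) * cos θ₀ + sin (θ₀ + α) * sin θ₀ := by
      rw [← cos_sub]
      ring_nf
    have hsa : sin α = sin (θ₀ + α) * cos θ₀ - cos (θ₀ + α) * sin θ₀ := by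
      rw [← sin_sub]
      ring_nf
    constructor
    · rw [eq_div_iff hμ0, hca, ← e1', ← e2']
      linear_combination (-μ * P) * hs
    · rw [eq_div_iff hμ0, hsa, ← e1', ← e2']
      linear_combination (-μ * Q) * hs

theorem onlyIncoherent_of {α μ : ℝ} (h : ∀ k r, r ≠ 0 → ¬ CartesianSystem α μ k r) :
    OnlyIncoherent α μ := by
  intro k c ρ
  constructor
  · intro hw
    rcases hw.classify with h1 | ⟨r, θ₀, hr, hcs, -⟩
    · exact h1
    · exact absurd hcs (h k r hr)
  · rintro ⟨rfl, rfl⟩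
    exact isTravelingWave_incoherent α μ k

theorem uniqueCoherentWave_of {α μ k₁ r₁ : ℝ} (hr₁ : 0 < r₁)
    (h : ∀ k r, r ≠ 0 → (CartesianSystem α μ k r ↔ k = k₁ ∧ |r| = r₁)) :
    UniqueCoherentWave α μ k₁ r₁ := by
  have h₁ : CartesianSystem α μ k₁ r₁ := (h k₁ r₁ hr₁.ne').2 ⟨rfl, abs_of_pos hr₁⟩
  refine ⟨fun k c ρ => ?_, avm_ne_incoherent k₁ hr₁.ne', fun θ₀ => ?_⟩
  · constructor
    · intro hw
      refine hw.classify.imp id ?_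
      rintro ⟨r, θ₀, hr, hcs, hc, hρ⟩
      obtain ⟨hk, hrr⟩ := (h k r hr).1 hcs
      subst hk
      -- The two signs of `r` give the same family of waves, as changing the sign rotates the
      -- profile by `π`.
      obtain ⟨θ₁, hθ₁⟩ : ∃ θ₁, ρ = fun θ => avm k r₁ (θ - θ₁ - α) := by
        rcases abs_choice r with h' | h'
        · exact ⟨θ₀, by rw [hρ, ← hrr, h']⟩
        · refine ⟨θ₀ - π, ?_⟩
          have : r = -r₁ := by linarith
          rw [hρ, this]
          funext θ
          rw [avm_neg_right]
          ring_nf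
      have hC : Ccoef 0 k r = Ccoef 0 k r₁ := by
        rcases abs_choice r with h' | h'
        · rw [← hrr, h']
        · rw [← hrr, h', Ccoef_zero_neg_right]
      refine ⟨rfl, by rw [hc, hC], toIcoMod two_pi_pos 0 θ₁, ?_, ?_⟩
      · simpa using toIcoMod_mem_Ico two_pi_pos 0 θ₁
      · rw [hθ₁]
        funext θ
        rw [toIcoMod, zsmul_eq_mul]
        rw [show θ - (θ₁ - (toIcoDiv two_pi_pos 0 θ₁ : ℝ) * (2 * π)) - α =
          θ - θ₁ - α + (toIcoDiv two_pi_pos 0 θ₁ : ℝ) * (2 * π) by ring]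
        exact ((avm_periodic k r₁).int_mul _ _).symm
    · rintro (⟨rfl, rfl⟩ | ⟨rfl, rfl, θ₀, -, rfl⟩)
      · exact isTravelingWave_incoherent α μ k
      · simpa only [sub_sub] using isTravelingWave_avm h₁ hr₁.ne' (θ₀ + α)
  · simpa only [sub_sub, add_assoc] using isMcKeanVlasovSolution_avm h₁ hr₁.ne' (θ₀ + α)

/-! ### Solutions of the Cartesian system, and the reflected branch for `α > π/2`. -/

section RightBranch

variable {α : ℝ}

theorem cartesianSystem_iff_branchRadius {μ k r : ℝ} (hα : α ∈ Ico 0 (π / 2))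
    (hμ : muCrit α < μ) (hr : r ≠ 0) : CartesianSystem α μ k r ↔
      k = branchSpeed α (branchRadius α μ) ∧ |r| = branchRadius α μ := by
  rw [cartesianSystem_iff hα hr]
  constructor
  · rintro ⟨h1, h2⟩
    have h3 := branchRadius_branchParam hα (abs_nonneg r)
    rw [← h2] at h3
    exact ⟨by rw [h1, h3], h3.symm⟩
  · rintro ⟨h1, h2⟩
    exact ⟨by rw [h1, h2], by rw [h2, branchParam_branchRadius hα hμ.le]⟩

theorem not_cartesianSystem_of_le_muCrit {μ : ℝ} (hα : α ∈ Ico 0 (π / 2)) (hμ : μ ≤ muCrit α)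
    (k r : ℝ) (hr : r ≠ 0) : ¬ CartesianSystem α μ k r := by
  rw [cartesianSystem_iff hα hr]
  rintro ⟨-, h2⟩
  exact absurd (h2 ▸ hμ) (not_le.2 (muCrit_lt_branchParam hα (abs_pos.2 hr)))

theorem not_cartesianSystem_pi_div_two (μ k r : ℝ) (hr : r ≠ 0) :
    ¬ CartesianSystem (π / 2) μ k r := by
  intro h
  have h1 := h.1
  rw [cos_pi_div_two, zero_div] at h1
  exact (calC_pos k hr).ne' h1

end RightBranch

section LeftBranch

variable {α : ℝ}

theorem pi_sub_mem_Ico (hα : α ∈ Ioc (π / 2) π) : π - α ∈ Ico 0 (π / 2) :=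
  ⟨by linarith [hα.2], by linarith [hα.1]⟩

theorem pi_sub_mem_Ioo (hα : α ∈ Ioo (π / 2) π) : π - α ∈ Ioo 0 (π / 2) :=
  ⟨by linarith [hα.2], by linarith [hα.1]⟩

theorem muCrit_pi_sub (α : ℝ) : muCrit (π - α) = -muCrit α := by
  rw [muCrit, muCrit, cos_pi_sub, div_neg]

theorem SupercriticalPitchfork.neg_speed {Sol Sol' : ℝ → ℝ → ℝ → Prop} {μ₀ k₀ : ℝ}
    {kb rb : ℝ → ℝ} (h : SupercriticalPitchfork Sol μ₀ k₀ kb rb)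
    (hSol : ∀ μ k r, Sol' μ k r ↔ Sol μ (-k) r) :
    SupercriticalPitchfork Sol' μ₀ (-k₀) (fun μ => -kb μ) rb where
  k_start := by rw [h.k_start]
  r_start := h.r_start
  k_cont := h.k_cont.neg
  r_cont := h.r_cont
  r_pos := h.r_pos
  trivial_only := fun μ hμ k r => by rw [hSol, h.trivial_only μ hμ]
  pair := fun μ hμ k r => by rw [hSol, h.pair μ hμ, neg_eq_iff_eq_neg]
  tangency := h.tangency

theorem ne_pi_div_two_of_mem (hα : α ∈ Ioc (π / 2) π) : α ≠ π / 2 := hα.1.ne'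

theorem reducedSol_neg (hα : α ≠ π / 2) (μ k r : ℝ) :
    ReducedSol α (-μ) k r ↔ ReducedSol (π - α) μ (-k) r := by
  rcases eq_or_ne r 0 with h | hr
  · simp [ReducedSol, h]
  · have := polarSystem_neg (μ := -μ) (k := k) hα hr
    rw [neg_neg] at this
    rw [ReducedSol, ReducedSol, this]

theorem subcriticalPitchfork (hα : α ∈ Ioc (π / 2) π) :
    SubcriticalPitchfork (ReducedSol α) (muCrit α) (tan α)
      (fun μ => -branchSpeed (π - α) (branchRadius (π - α) (-μ)))
      (fun μ => branchRadius (π - α) (-μ)) := by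
  have h := (supercriticalPitchfork (pi_sub_mem_Ico hα)).neg_speed
    (reducedSol_neg (ne_pi_div_two_of_mem hα))
  rw [muCrit_pi_sub, tan_pi_sub, neg_neg] at h
  simpa only [SubcriticalPitchfork, neg_neg] using h

theorem branchCurve_left_eq (hα : α ∈ Ioc (π / 2) π) :
    branchCurve (fun μ => -branchSpeed (π - α) (branchRadius (π - α) (-μ)))
        (fun μ => branchRadius (π - α) (-μ)) (Iic (muCrit α)) =
      {p | ∃ s, 0 ≤ s ∧ (p = (-branchSpeed (π - α) s, s) ∨
        p = (-branchSpeed (π - α) s, -s))} := by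
  have hβ := pi_sub_mem_Ico hα
  have hcrit := muCrit_pi_sub α
  ext p
  constructor
  · rintro ⟨μ, hμ, h⟩
    have : branchRadius (π - α) (-μ) ∈ Ici 0 := by
      rw [← branchRadius_image hβ]
      refine mem_image_of_mem _ ?_
      rw [hcrit]
      exact neg_le_neg (mem_Iic.1 hμ)
    exact ⟨branchRadius (π - α) (-μ), this, h⟩
  · rintro ⟨s, hs, h⟩
    have h1 := muCrit_le_branchParam hβ hs
    refine ⟨-branchParam (π - α) s, mem_Iic.2 (by linarith), ?_⟩
    simpa only [neg_neg, branchRadius_branchParam hβ hs] using h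

theorem nontrivialSols_left_eq (hα : α ∈ Ioc (π / 2) π) : nontrivialSols α =
    {p | ∃ s, 0 < s ∧ (p = (-branchSpeed (π - α) s, s) ∨
      p = (-branchSpeed (π - α) s, -s))} := by
  have h := nontrivialSols_eq (pi_sub_mem_Ico hα)
  ext ⟨k, r⟩
  have h1 : (k, r) ∈ nontrivialSols α ↔ (-k, r) ∈ nontrivialSols (π - α) := by
    refine and_congr_right fun hr => ⟨?_, ?_⟩
    · rintro ⟨μ, hμ⟩
      exact ⟨-μ, (polarSystem_neg (ne_pi_div_two_of_mem hα) hr).2 hμ⟩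
    · rintro ⟨μ, hμ⟩
      refine ⟨-μ, (polarSystem_neg (ne_pi_div_two_of_mem hα) hr).1 ?_⟩
      rwa [neg_neg]
  rw [h1, h]
  simp only [mem_ofPred_eq, Prod.mk.injEq, neg_eq_iff_eq_neg]

theorem cartesianSystem_left_iff {μ k r : ℝ} (hα : α ∈ Ioc (π / 2) π)
    (hμ : μ < muCrit α) (hr : r ≠ 0) : CartesianSystem α μ k r ↔
      k = -branchSpeed (π - α) (branchRadius (π - α) (-μ)) ∧
        |r| = branchRadius (π - α) (-μ) := by
  have h : muCrit (π - α) < -μ := by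
    rw [muCrit_pi_sub]
    linarith
  rw [← cartesianSystem_neg hr, cartesianSystem_iff_branchRadius (pi_sub_mem_Ico hα) h hr,
    neg_eq_iff_eq_neg]

theorem not_cartesianSystem_of_muCrit_le {μ : ℝ} (hα : α ∈ Ioc (π / 2) π) (hμ : muCrit α ≤ μ)
    (k r : ℝ) (hr : r ≠ 0) : ¬ CartesianSystem α μ k r := by
  rw [← cartesianSystem_neg hr]
  refine not_cartesianSystem_of_le_muCrit (pi_sub_mem_Ico hα) ?_ (-k) r hr
  rw [muCrit_pi_sub]
  linarith

end LeftBranch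

/-! ### Assembling both ranges of `α`. -/

theorem polarSystem_iff_cartesianSystem {α μ k r : ℝ} (hα : α ∈ Icc 0 π) (hα' : α ≠ π / 2)
    (hr : r ≠ 0) : PolarSystem α μ k r ↔ CartesianSystem α μ k r := by
  rcases lt_or_gt_of_ne hα' with h | h
  · rw [polarSystem_iff ⟨hα.1, h⟩ hr, cartesianSystem_iff ⟨hα.1, h⟩ hr]
  · rw [← polarSystem_neg hα' hr, ← cartesianSystem_neg hr,
      polarSystem_iff (pi_sub_mem_Ico ⟨h, hα.2⟩) hr,
      cartesianSystem_iff (pi_sub_mem_Ico ⟨h, hα.2⟩) hr]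

/-- The speed `k_α(μ)` of the coherent wave. -/
noncomputable def coherentSpeed (α μ : ℝ) : ℝ :=
  if α < π / 2 then branchSpeed α (branchRadius α μ)
  else -branchSpeed (π - α) (branchRadius (π - α) (-μ))

/-- The modulus `r_α(μ)` of the coherent wave. -/
noncomputable def coherentRadius (α μ : ℝ) : ℝ :=
  if α < π / 2 then branchRadius α μ else branchRadius (π - α) (-μ)

/-- The speed `𝓚_α(r)` along the branch of coherent waves. -/
noncomputable def coherentCurve (α s : ℝ) : ℝ :=
  if α < π / 2 then branchSpeed α s else -branchSpeed (π - α) s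

section

variable {α : ℝ}

theorem coherentSpeed_of_lt (h : α < π / 2) :
    coherentSpeed α = fun μ => branchSpeed α (branchRadius α μ) :=
  funext fun _ => if_pos h

theorem coherentRadius_of_lt (h : α < π / 2) : coherentRadius α = branchRadius α :=
  funext fun _ => if_pos h

theorem coherentCurve_of_lt (h : α < π / 2) : coherentCurve α = branchSpeed α :=
  funext fun _ => if_pos h

theorem coherentSpeed_of_gt (h : π / 2 < α) :
    coherentSpeed α = fun μ => -branchSpeed (π - α) (branchRadius (π - α) (-μ)) :=
  funext fun _ => if_neg h.not_gt

theorem coherentRadius_of_gt (h : π / 2 < α) :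
    coherentRadius α = fun μ => branchRadius (π - α) (-μ) :=
  funext fun _ => if_neg h.not_gt

theorem coherentCurve_of_gt (h : π / 2 < α) :
    coherentCurve α = fun s => -branchSpeed (π - α) s :=
  funext fun _ => if_neg h.not_gt

theorem coherentCurve_strictAntiOn (hα : α ∈ Ioo (π / 2) π) :
    StrictAntiOn (coherentCurve α) (Ici 0) ∧ BijOn (coherentCurve α) (Ici 0) (Iic (tan α)) := by
  rw [coherentCurve_of_gt hα.1]
  have hβ := pi_sub_mem_Ioo hα
  refine ⟨(branchSpeed_strictMonoOn hβ).neg, ?_⟩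
  have h1 : BijOn (fun k : ℝ => -k) (Ici (tan (π - α))) (Iic (tan α)) := by
    rw [tan_pi_sub]
    refine ⟨fun k hk => ?_, neg_injective.injOn, fun k hk => ⟨-k, ?_, neg_neg k⟩⟩
    · exact mem_Iic.2 (neg_le.1 hk)
    · exact neg_le_neg (mem_Iic.1 hk)
  exact h1.comp (branchSpeed_bijOn hβ)

theorem tan_lt_coherentSpeed (hα : α ∈ Ioo 0 (π / 2)) {μ : ℝ} (hμ : muCrit α < μ) :
    tan α < coherentSpeed α μ := by
  rw [coherentSpeed_of_lt hα.2]
  exact tan_lt_branchSpeed hα (branchRadius_pos ⟨hα.1.le, hα.2⟩ hμ)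

theorem coherentSpeed_lt_tan (hα : α ∈ Ioo (π / 2) π) {μ : ℝ} (hμ : μ < muCrit α) :
    coherentSpeed α μ < tan α := by
  rw [coherentSpeed_of_gt hα.1]
  have hβ := pi_sub_mem_Ioo hα
  have h1 : muCrit (π - α) < -μ := by
    rw [muCrit_pi_sub]
    linarith
  have := tan_lt_branchSpeed hβ (branchRadius_pos ⟨hβ.1.le, hβ.2⟩ h1)
  rw [tan_pi_sub] at this
  linarith

end

end SakaguchiKuramoto

theorem theorem1 :
    ∃ k r K : ℝ → ℝ → ℝ,
      -- equivalence of the two forms of the reduced system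
      (∀ α ∈ Icc 0 π, α ≠ π / 2 → ∀ μ k' r' : ℝ, r' ≠ 0 →
        (PolarSystem α μ k' r' ↔
          CartesianSystem α μ k' r')) ∧
      -- the reduced system, `α ∈ [0, π/2)`: supercritical pitchfork with global branch
      (∀ α ∈ Ico 0 (π / 2),
        SupercriticalPitchfork (ReducedSol α)
          (muCrit α) (tan α) (k α) (r α) ∧
        branchCurve (k α) (r α) (Ici (muCrit α)) =
          {p | ∃ s, 0 ≤ s ∧ (p = (K α s, s) ∨ p = (K α s, -s))} ∧
        nontrivialSols α =
          {p | ∃ s, 0 < s ∧ (p = (K α s, s) ∨ p = (K α s, -s))}) ∧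
      (∀ α ∈ Ioo 0 (π / 2),
        StrictMonoOn (K α) (Ici 0) ∧ BijOn (K α) (Ici 0) (Ici (tan α))) ∧
      -- the reduced system, `α ∈ (π/2, π]`: subcritical pitchfork with global branch
      (∀ α ∈ Ioc (π / 2) π,
        SubcriticalPitchfork (ReducedSol α)
          (muCrit α) (tan α) (k α) (r α) ∧
        branchCurve (k α) (r α) (Iic (muCrit α)) =
          {p | ∃ s, 0 ≤ s ∧ (p = (K α s, s) ∨ p = (K α s, -s))} ∧
        nontrivialSols α =
          {p | ∃ s, 0 < s ∧ (p = (K α s, s) ∨ p = (K α s, -s))}) ∧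
      (∀ α ∈ Ioo (π / 2) π,
        StrictAntiOn (K α) (Ici 0) ∧ BijOn (K α) (Ici 0) (Iic (tan α))) ∧
      -- the symmetric cases: the branch is the half line `k = 0`
      (∀ s, 0 ≤ s → K 0 s = 0 ∧ K π s = 0) ∧
      -- the reduced system, `α = π/2`: no nontrivial solution
      (∀ μ k' r' : ℝ, r' ≠ 0 → ¬ CartesianSystem (π / 2) μ k' r') ∧
      -- the traveling-wave equation
      (∀ α ∈ Ico 0 (π / 2),
        (∀ μ ≤ muCrit α, OnlyIncoherent α μ) ∧
        (∀ μ, muCrit α < μ →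
          UniqueCoherentWave α μ (k α μ) (r α μ))) ∧
      (∀ α ∈ Ioc (π / 2) π,
        (∀ μ, muCrit α ≤ μ → OnlyIncoherent α μ) ∧
        (∀ μ < muCrit α,
          UniqueCoherentWave α μ (k α μ) (r α μ))) ∧
      (∀ μ : ℝ, OnlyIncoherent (π / 2) μ) ∧
      -- the speed of the wave
      (∀ α ∈ Ioo 0 (π / 2), 0 < tan α ∧
        ∀ μ, muCrit α < μ → tan α < k α μ) ∧
      (∀ α ∈ Ioo (π / 2) π, tan α < 0 ∧
        ∀ μ < muCrit α, k α μ < tan α) ∧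
      (∀ μ, 2 < μ → k 0 μ = 0) ∧
      (∀ μ < -2, k π μ = 0) ∧
      -- limits
      (∀ α ∈ Ioo 0 (π / 2),
        Tendsto (k α) (𝓝[>] (muCrit α)) (𝓝 (tan α)) ∧
        Tendsto (k α) atTop atTop ∧
        Tendsto (r α) atTop atTop) ∧
      (∀ M : ℝ, ∀ᶠ α in 𝓝[<] (π / 2),
        ∀ μ, muCrit α < μ → M < k α μ) := by
  have hpi := pi_pos
  refine ⟨coherentSpeed, coherentRadius, coherentCurve, ?_, ?_, ?_, ?_, ?_, ?_, ?_, ?_, ?_, ?_,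
    ?_, ?_, ?_, ?_, ?_, ?_⟩
  · exact fun α hα hα' μ k r hr => polarSystem_iff_cartesianSystem hα hα' hr
  · intro α hα
    rw [coherentSpeed_of_lt hα.2, coherentRadius_of_lt hα.2, coherentCurve_of_lt hα.2]
    exact ⟨supercriticalPitchfork hα, branchCurve_eq hα, nontrivialSols_eq hα⟩
  · intro α hα
    rw [coherentCurve_of_lt hα.2]
    exact ⟨branchSpeed_strictMonoOn hα, branchSpeed_bijOn hα⟩
  · intro α hα
    rw [coherentSpeed_of_gt hα.1, coherentRadius_of_gt hα.1, coherentCurve_of_gt hα.1]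
    exact ⟨subcriticalPitchfork hα, branchCurve_left_eq hα, nontrivialSols_left_eq hα⟩
  · exact fun α hα => coherentCurve_strictAntiOn hα
  · intro s _
    rw [coherentCurve_of_lt (by linarith), coherentCurve_of_gt (by linarith)]
    simp only [sub_self, branchSpeed_zero_left, neg_zero, and_self]
  · exact not_cartesianSystem_pi_div_two
  · intro α hα
    rw [coherentSpeed_of_lt hα.2, coherentRadius_of_lt hα.2]
    exact ⟨fun μ hμ => onlyIncoherent_of (not_cartesianSystem_of_le_muCrit hα hμ),
      fun μ hμ => uniqueCoherentWave_of (branchRadius_pos hα hμ)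
        fun k r hr => cartesianSystem_iff_branchRadius hα hμ hr⟩
  · intro α hα
    rw [coherentSpeed_of_gt hα.1, coherentRadius_of_gt hα.1]
    refine ⟨fun μ hμ => onlyIncoherent_of (not_cartesianSystem_of_muCrit_le hα hμ),
      fun μ hμ => uniqueCoherentWave_of (branchRadius_pos (pi_sub_mem_Ico hα) ?_)
        fun k r hr => cartesianSystem_left_iff hα hμ hr⟩
    rw [muCrit_pi_sub]
    linarith
  · exact fun μ => onlyIncoherent_of (not_cartesianSystem_pi_div_two μ)
  · exact fun α hα => ⟨tan_pos_of_pos_of_lt_pi_div_two hα.1 hα.2,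
      fun μ hμ => tan_lt_coherentSpeed hα hμ⟩
  · intro α hα
    have hβ := pi_sub_mem_Ioo hα
    have := tan_pos_of_pos_of_lt_pi_div_two hβ.1 hβ.2
    rw [tan_pi_sub] at this
    exact ⟨by linarith, fun μ hμ => coherentSpeed_lt_tan hα hμ⟩
  · intro μ _
    simp only [coherentSpeed_of_lt (by linarith : (0 : ℝ) < π / 2), branchSpeed_zero_left]
  · intro μ _
    simp only [coherentSpeed_of_gt (by linarith : π / 2 < π), sub_self, branchSpeed_zero_left,
      neg_zero]
  · intro α hα
    have hα' : α ∈ Ico 0 (π / 2) := ⟨hα.1.le, hα.2⟩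
    rw [coherentSpeed_of_lt hα.2, coherentRadius_of_lt hα.2]
    refine ⟨?_, (tendsto_branchSpeed hα).comp (tendsto_branchRadius_atTop hα'),
      tendsto_branchRadius_atTop hα'⟩
    have := ((continuous_branchSpeed hα').tendsto 0).comp (tendsto_branchRadius_nhdsGT hα')
    rwa [branchSpeed_zero hα'] at this
  · intro M
    -- The lower bound `tan α` for the speed does not involve `μ`, hence the uniformity.
    filter_upwards [tendsto_tan_pi_div_two.eventually_gt_atTop M,
      Ioo_mem_nhdsLT (by linarith : (0 : ℝ) < π / 2)] with α hM hα μ hμ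
    exact hM.trans (tan_lt_coherentSpeed hα hμ)
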